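/- Theorem 1.2. Let $(M,g)$ be a closed Riemannian manifold of dimension at least one, and let $W_*:\mathbb R\to\mathbb R$ be a smooth bounded symmetric double-well potential: $W_*\ge 0$, $W_*(-t)=W_*(t)$, the critical points of $W_*$ are exactly $0,\pm1$, $W_*(\pm1)=0$, $W_*''(\pm1)>0$, and $0$ is a local maximum. For $\varepsilon>0$ and $u\in H^1(M)$ put $$E_\varepsilon(u)=\int_M \varepsilon\frac{|\nabla u|^2}{2}+\frac{W_*(u)}{\varepsilon}.$$ For a finite simplicial complex $\tilde X$ with a free simplicial $\mathbb Z_2$-action and quotient $X$, let $f:X\to\mathbb{RP}^\infty$ be the map induced by a $\mathbb Z_2$-equivariant continuous map from $\tilde X$ to the total space $S^\infty$ of the universal $\mathbb Z_2$-bundle, let $\xi$ be the nonzero class in $H^1(\mathbb{RP}^\infty,\mathbb Z_2)$, and let $\mathrm{Ind}_{\mathbb Z_2}(\tilde X)$ be the supremum of all $p\ge 1$ with $f^*(\xi^{p-1})\neq 0$ in $H^{p-1}(X,\mathbb Z_2)$. The $\varepsilon$-phase-transition spectrum is $c_\varepsilon(0)=0$ and, for $p\ge1$, $$c_\varepsilon(p)=\inf_{\tilde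 X}\ \inf_{h}\ \sup_{x\in\tilde X}E_\varepsilon(h(x)),$$ where $\tilde X$ runs over all such complexes with $\mathrm{Ind}_{\mathbb Z_2}(\tilde X)\ge p+1$ and $h$ over all continuous $\mathbb Z_2$-equivariant maps $\tilde X\to H^1(M)\setminus\{0\}$ (with the action $u\mapsto -u$). The one-parameter $\varepsilon$-Allen--Cahn width is $$\gamma_\varepsilon=\inf_h\sup_{t\in[0,1]}E_\varepsilon(h(t)),$$ where $h$ runs over all continuous paths $[0,1]\to H^1(M)$ from the constant function $1$ to the constant function $-1$. Then all $c_\varepsilon(p)$ and $\gamma_\varepsilon$ are finite, and for every $\varepsilon>0$ and all integers $k,m\ge0$ $$c_\varepsilon(k+m+1)\le c_\varepsilon(k)+c_\varepsilon(m)+\gamma_\varepsilon .$$ Hence, with $\sigma=\int_{-1}^1\sqrt{W_*(t)/2}\,dt$, $\ell_p=\frac1{2\sigma}\lim_{\varepsilon\to0^+}c_\varepsilon(p)$ (so $\ell_0=0$) and $\gamma=\frac1{2\sigma}\lim_{\varepsilon\to0^+}\gamma_\varepsilon$, one has for all $k,m\ge0$ $$\ell_{k+m+1}\le\ell_k+\ell_m+\gamma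 .$$ This last inequality holds whenever the four limits occurring in it exist, and it holds without any assumption when all limits are replaced by upper limits. -/

import Mathlib

open MeasureTheory Filter Topology Bundle
open scoped Manifold ContDiff ENNReal

noncomputable section

namespace AllenCahn

/-! ### Singular cochains with coefficients in `ℤ/2` -/

/-- Singular `p`-simplices of `X`: continuous maps from the standard `p`-simplex to `X`. -/
abbrev SingularSimplex (X : Type*) [TopologicalSpace X] (p : ℕ) : Type _ :=
  C(stdSimplex ℝ (Fin (p + 1)), X)

/-- Singular `p`-cochains of `X` with coefficients in `ℤ/2`. -/
abbrev Cochain (X : Type*) [TopologicalSpace X] (p : ℕ) : Type _ :=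
  SingularSimplex X p → ZMod 2

/-- The affine map of standard simplices which is given by `f` on the vertices. -/
def simplexMap {p q : ℕ} (f : Fin (p + 1) → Fin (q + 1)) :
    C(stdSimplex ℝ (Fin (p + 1)), stdSimplex ℝ (Fin (q + 1))) :=
  ⟨stdSimplex.map f, stdSimplex.continuous_map f⟩

variable {X Y : Type*} [TopologicalSpace X] [TopologicalSpace Y]

/-- The singular coboundary (no signs, because the coefficients are `ℤ/2`). -/
def coboundary {p : ℕ} (c : Cochain X p) : Cochain X (p + 1) := fun s =>
  ∑ i : Fin (p + 2), c (s.comp (simplexMap i.succAbove))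

/-- `c` is a cocycle. -/
def IsCocycle {p : ℕ} (c : Cochain X p) : Prop := coboundary c = 0

/-- `c` is a coboundary (in degree `0`, only the zero cochain is one); a cocycle represents the
zero class in singular cohomology if and only if it is a coboundary. -/
def IsCoboundary : {p : ℕ} → Cochain X p → Prop
  | 0, c => c = 0
  | _ + 1, c => ∃ b, coboundary b = c

/-- The cup product of cochains: evaluate `a` on the front `p`-face and `b` on the
back `q`-face. -/
def cup {p q : ℕ} (a : Cochain X p) (b : Cochain X q) : Cochain X (p + q) := fun s =>
  a (s.comp (simplexMap fun i => ⟨i, by omega⟩)) *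
    b (s.comp (simplexMap fun j => ⟨p + j, by omega⟩))

/-- The cup powers of a `1`-cochain; the power `0` is the unit cochain. -/
def cupPow (a : Cochain X 1) : (p : ℕ) → Cochain X p
  | 0 => fun _ => 1
  | p + 1 => cup (cupPow a p) a

/-- The pull-back of cochains by a continuous map. -/
def pullback (f : C(X, Y)) {p : ℕ} (c : Cochain Y p) : Cochain X p := fun s => c (f.comp s)

/-! ### Involutions and the universal `ℤ/2`-bundle -/

/-- The quotient of `X` by the equivalence relation generated by `x ∼ T x`, with the quotient
topology. If `T` is an involution, then this is the orbit space of the `ℤ/2`-action given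
by `T`. -/
def OrbitSpace (T : X → X) : Type _ := Quot fun x y => y = T x

instance (T : X → X) : TopologicalSpace (OrbitSpace T) :=
  inferInstanceAs (TopologicalSpace (Quot _))

/-- The map of orbit spaces induced by an equivariant continuous map. -/
def orbitMap {T : X → X} {S : Y → Y} (f : C(X, Y)) (hf : ∀ x, f (T x) = S (f x)) :
    C(OrbitSpace T, OrbitSpace S) where
  toFun := Quot.map f fun x y (hxy : y = T x) => by rw [hxy, hf]
  continuous_toFun :=
    continuous_quot_lift _ (continuous_quot_mk.comp f.continuous)

/-- The infinite dimensional sphere, here the unit sphere of `ℓ²`. It is contractible and the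
antipodal map is free, so it is the total space of a universal `ℤ/2`-principal bundle. -/
abbrev SInfty : Type := Metric.sphere (0 : lp (fun _ : ℕ => ℝ) 2) 1

/-- The base `SInfty / {±1}` of the universal `ℤ/2`-principal bundle. -/
abbrev RPInfty : Type := OrbitSpace fun x : SInfty => -x

/-! ### Finite simplicial complexes with a free simplicial `ℤ/2`-action -/

/-- The geometric realization of a simplicial complex `K` on a finite vertex set `V`: the points
of the standard simplex on `V` whose support is a face of `K`. -/
def realization {V : Type} [Fintype V] (K : PreAbstractSimplicialComplex V) : Set (V → ℝ) :=
  {x | x ∈ stdSimplex ℝ V ∧ ∃ s ∈ K.faces, ∀ v, v ∈ s ↔ x v ≠ 0}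

/-- A finite simplicial complex with a free simplicial action of `ℤ/2`. -/
structure FreeZ2Complex where
  /-- the vertex set -/
  V : Type
  [fintypeV : Fintype V]
  /-- the simplices -/
  K : PreAbstractSimplicialComplex V
  /-- the action of the generator of `ℤ/2` on the vertices -/
  swap : V → V
  swap_swap : ∀ v, swap (swap v) = v
  /-- simplices are mapped to simplices -/
  swap_faces : ∀ s ∈ K.faces, ∃ t ∈ K.faces, ∀ v, v ∈ t ↔ swap v ∈ s
  /-- no point of the geometric realization is fixed -/
  free : ∀ x ∈ realization K, (fun v => x (swap v)) ≠ x

attribute [instance] FreeZ2Complex.fintypeV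

namespace FreeZ2Complex

/-- The underlying topological space of the complex. -/
abbrev Space (K : FreeZ2Complex) : Type := realization K.K

/-- The action of the generator of `ℤ/2` on the underlying space. -/
def T (K : FreeZ2Complex) (x : K.Space) : K.Space :=
  ⟨fun v => x.1 (K.swap v), by
    obtain ⟨h, s, hs, hsx⟩ := x.2
    refine ⟨⟨fun v => h.1 _, ?_⟩, ?_⟩
    · exact ((Function.Involutive.bijective K.swap_swap).sum_comp x.1).trans h.2
    · obtain ⟨t, ht, h⟩ := K.swap_faces s hs
      exact ⟨t, ht, fun v => (h v).trans (hsx _)⟩⟩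

/-- `f^*(ξ^p) ≠ 0` in `H^p(X, ℤ/2)`, where `X` is the orbit space of the complex, `f` is the map
from `X` to `RPInfty` which is induced by an equivariant continuous map to `SInfty` (unique up to
equivariant homotopy), and `ξ` is the nonzero class in `H^1(RPInfty, ℤ/2)`. -/
def ClassPowNeZero (K : FreeZ2Complex) (p : ℕ) : Prop :=
  ∃ (f : C(K.Space, SInfty)) (hf : ∀ x, f (K.T x) = -f x) (ξ : Cochain RPInfty 1),
    IsCocycle ξ ∧ ¬ IsCoboundary ξ ∧
      ¬ IsCoboundary (pullback (orbitMap (T := K.T) (S := fun y : SInfty => -y) f hf)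
        (cupPow ξ p))

/-- The `ℤ/2`-index: the supremum of the numbers `p ≥ 1` with `f^*(ξ^(p-1)) ≠ 0`. -/
def index (K : FreeZ2Complex) : ℕ∞ :=
  ⨆ (p : ℕ) (_ : 1 ≤ p ∧ K.ClassPowNeZero (p - 1)), (p : ℕ∞)

end FreeZ2Complex

/-! ### The Sobolev space and the Allen-Cahn functional -/

/-- A smooth, bounded, symmetric double-well potential. -/
structure IsDoubleWell (W : ℝ → ℝ) : Prop where
  smooth : ContDiff ℝ ∞ W
  bounded : ∃ C, ∀ t, |W t| ≤ C
  even : ∀ t, W (-t) = W t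
  nonneg : ∀ t, 0 ≤ W t
  critical : ∀ t, deriv W t = 0 ↔ t = 0 ∨ t = 1 ∨ t = -1
  zero_one : W 1 = 0
  zero_neg_one : W (-1) = 0
  pos_one : 0 < deriv (deriv W) 1
  pos_neg_one : 0 < deriv (deriv W) (-1)
  localMax : IsLocalMax W 0

/-- The constant `σ = ∫_{-1}^1 √(W(t)/2) dt`. -/
def sigma (W : ℝ → ℝ) : ℝ := ∫ t in (-1 : ℝ)..1, √(W t / 2)

section Manifold

variable (n : ℕ) (M : Type*) [EMetricSpace M] [MeasurableSpace M] [BorelSpace M]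
  [ChartedSpace (EuclideanSpace ℝ (Fin (n + 1))) M]
  [RiemannianBundle (fun x : M => TangentSpace (𝓡 (n + 1)) x)]

/-- The Riemannian volume measure: the `(n+1)`-dimensional Hausdorff measure of the Riemannian
distance, normalized to agree with the Lebesgue measure on Euclidean space. -/
def vol : Measure M := Measure.euclideanHausdorffMeasure (n + 1)

variable {M}

/-- `α` is the distributional differential of `u`: in every chart `e` of the atlas, the coordinate
expressions of `u` and `α` are locally integrable and satisfy the integration by parts formula
`∫ u ∂_v η = - ∫ α(∂_v) η` for all test functions `η`. -/
structure IsWeakDifferential (u : M → ℝ)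
    (α : (x : M) → TangentSpace (𝓡 (n + 1)) x →L[ℝ] ℝ) : Prop where
  locInt_fun : ∀ e ∈ atlas (EuclideanSpace ℝ (Fin (n + 1))) M,
    LocallyIntegrableOn (fun y => u (e.symm y)) e.target volume
  locInt_diff : ∀ e ∈ atlas (EuclideanSpace ℝ (Fin (n + 1))) M,
    ∀ v : EuclideanSpace ℝ (Fin (n + 1)),
    LocallyIntegrableOn (fun y => α (e.symm y) (mfderiv (𝓡 (n + 1)) (𝓡 (n + 1)) e.symm y v))
      e.target volume
  parts : ∀ e ∈ atlas (EuclideanSpace ℝ (Fin (n + 1))) M,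
    ∀ η : EuclideanSpace ℝ (Fin (n + 1)) → ℝ, ContDiff ℝ ∞ η → HasCompactSupport η →
    tsupport η ⊆ e.target → ∀ v : EuclideanSpace ℝ (Fin (n + 1)),
    ∫ y in e.target, u (e.symm y) * fderiv ℝ η y v =
      - ∫ y in e.target, α (e.symm y) (mfderiv (𝓡 (n + 1)) (𝓡 (n + 1)) e.symm y v) * η y

variable (M)

/-- The Sobolev space `H¹(M)`: the classes `u` in `L²(M)` which have a distributional differential
in `L²(M)`. -/
def H1 : Type _ :=
  {u : Lp ℝ 2 (vol n M) // ∃ α, IsWeakDifferential n (fun x => u x) α ∧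
    ∫⁻ x, ENNReal.ofReal (‖α x‖ ^ 2) ∂(vol n M) < ⊤}

variable {M}

/-- The Sobolev norm `(∫ |u|² + |∇u|²)^(1/2)`. (The distributional differential is unique up to
null sets, so the infimum is over a single value, or over none and then it is `⊤`.) -/
def h1Norm (u : Lp ℝ 2 (vol n M)) : ℝ≥0∞ :=
  (⨅ (α : (x : M) → TangentSpace (𝓡 (n + 1)) x →L[ℝ] ℝ)
    (_ : IsWeakDifferential n (fun x => u x) α),
    ∫⁻ x, ENNReal.ofReal (u x ^ 2 + ‖α x‖ ^ 2) ∂(vol n M)) ^ (1 / 2 : ℝ)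

/-- The topology on `H¹(M)` given by the Sobolev norm. -/
instance : TopologicalSpace (H1 n M) where
  IsOpen U := ∀ u ∈ U, ∃ r : ℝ≥0∞, 0 < r ∧ ∀ v : H1 n M, h1Norm n (v.1 - u.1) < r → v ∈ U
  isOpen_univ := fun _ _ => ⟨1, one_pos, fun _ _ => trivial⟩
  isOpen_inter := fun U V hU hV u hu => by
    obtain ⟨r, hr, h⟩ := hU u hu.1
    obtain ⟨s, hs, h'⟩ := hV u hu.2
    exact ⟨min r s, lt_min hr hs, fun v hv =>
      ⟨h v (hv.trans_le (min_le_left _ _)), h' v (hv.trans_le (min_le_right _ _))⟩⟩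
  isOpen_sUnion := fun S hS u ⟨U, hU, hu⟩ => by
    obtain ⟨r, hr, h⟩ := hS U hU u hu
    exact ⟨r, hr, fun v hv => ⟨U, hU, h v hv⟩⟩

/-- The Allen-Cahn functional `E_ε(u) = ∫ ε |∇u|² / 2 + W(u) / ε`. (As for the norm, the infimum
is over a single value.) -/
def energy (W : ℝ → ℝ) (ε : ℝ) (u : H1 n M) : ℝ≥0∞ :=
  ⨅ (α : (x : M) → TangentSpace (𝓡 (n + 1)) x →L[ℝ] ℝ)
    (_ : IsWeakDifferential n (fun x => u.1 x) α),
    ∫⁻ x, ENNReal.ofReal (ε * ‖α x‖ ^ 2 / 2 + W (u.1 x) / ε) ∂(vol n M)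

variable (M)

/-- The set of continuous `ℤ/2`-equivariant maps from the complex `K` to `H¹(M) ∖ {0}`. -/
def equivariantMaps (K : FreeZ2Complex) : Set C(K.Space, H1 n M) :=
  {h | (∀ x, (h x).1 ≠ 0) ∧ ∀ x, (h (K.T x)).1 = -(h x).1}

/-- The `ε`-phase-transition spectrum `c_ε(p)`, `p ≥ 1`, with the convention `c_ε(0) = 0`. -/
def cSpectrum (W : ℝ → ℝ) (ε : ℝ) (p : ℕ) : ℝ≥0∞ :=
  if p = 0 then 0 else
    ⨅ (K : FreeZ2Complex) (_ : (p : ℕ∞) + 1 ≤ K.index),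
      ⨅ h ∈ equivariantMaps n M K, ⨆ x, energy n W ε (h x)

/-- The continuous paths in `H¹(M)` from the constant function `1` to the constant
function `-1`. -/
def connectingPaths : Set C(unitInterval, H1 n M) :=
  {h | (∀ᵐ x ∂(vol n M), (h 0).1 x = 1) ∧ ∀ᵐ x ∂(vol n M), (h 1).1 x = -1}

/-- The one-parameter `ε`-Allen-Cahn width `γ_ε`. -/
def gammaWidth (W : ℝ → ℝ) (ε : ℝ) : ℝ≥0∞ :=
  ⨅ h ∈ connectingPaths n M, ⨆ t, energy n W ε (h t)

/-- `c_ε(p) / (2σ)`. -/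
def rescaledSpectrum (W : ℝ → ℝ) (p : ℕ) (ε : ℝ) : ℝ≥0∞ :=
  cSpectrum n M W ε p / ENNReal.ofReal (2 * sigma W)

/-- `γ_ε / (2σ)`. -/
def rescaledWidth (W : ℝ → ℝ) (ε : ℝ) : ℝ≥0∞ :=
  gammaWidth n M W ε / ENNReal.ofReal (2 * sigma W)

/-- `l` is the limit `ℓ_p = (1/2σ) lim_{ε → 0+} c_ε(p)`. -/
def IsPhaseTransitionLimit (W : ℝ → ℝ) (p : ℕ) (l : ℝ≥0∞) : Prop :=
  Tendsto (rescaledSpectrum n M W p) (𝓝[>] 0) (𝓝 l)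

/-- `g` is the limit `γ = (1/2σ) lim_{ε → 0+} γ_ε`. -/
def IsAllenCahnWidthLimit (W : ℝ → ℝ) (g : ℝ≥0∞) : Prop :=
  Tendsto (rescaledWidth n M W) (𝓝[>] 0) (𝓝 g)

/-- The phase-transition spectrum `ℓ_p`, written with the upper limit as `ε → 0+`, so that it is
defined without presupposing that the limit exists; it is the limit whenever the limit exists. -/
def phaseTransitionSpectrum (W : ℝ → ℝ) (p : ℕ) : ℝ≥0∞ :=
  limsup (rescaledSpectrum n M W p) (𝓝[>] 0)

/-- The one-parameter Allen-Cahn width `γ`, written with the upper limit as `ε → 0+`; it is the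
limit whenever the limit exists. -/
def allenCahnWidth (W : ℝ → ℝ) : ℝ≥0∞ :=
  limsup (rescaledWidth n M W) (𝓝[>] 0)

end Manifold

end AllenCahn

end

open MeasureTheory Filter Topology Bundle AllenCahn
open scoped Manifold ContDiff ENNReal

set_option linter.unusedSectionVars false


/-! ### Charts of a Riemannian manifold are locally bi-Lipschitz -/

section RiemannianCharts

open Manifold Metric Set
open scoped NNReal

attribute [local instance] normedAddCommGroupTangentSpaceVectorSpace
  normedSpaceTangentSpaceVectorSpace

variable {E : Type*} [NormedAddCommGroup E] [NormedSpace ℝ E] {H : Type*} [TopologicalSpace H]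
  (I : ModelWithCorners ℝ E H) {M : Type*} [EMetricSpace M] [ChartedSpace H M]
  [RiemannianBundle (fun x : M => TangentSpace I x)] [IsManifold I 1 M]
  [IsContinuousRiemannianBundle E (fun x : M => TangentSpace I x)] [IsRiemannianManifold I M]

/-! The mechanism is to glue families over a join. Take equivariant families `u` over `K` and `v`
over `L` that almost realize `c_ε(k)` and `c_ε(m)`, and an almost optimal path `w` from `1` to `-1`.
Over a point of the join of `K` and `L`, let `w` run along the join parameter, and add the
truncation of `u` to `[-w⁺, w⁺]` and the truncation of `v` to `[-w⁻, w⁻]` (`H1.merge`). Where `w =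
1` the second summand vanishes, and where `w = -1` the first does, so the construction does not see
the factor that is undefined at an end of the join (`continuous_merge_join`). The result is odd in
`(u, v)`, and `w` is constant on orbits, so the family is equivariant.

At almost every point the glued function equals `u`, `v`, `w` or `-w`. Weak differentials agree
almost everywhere on coincidence sets and `W` is even, so the energy is at most the sum of the three
energies (`energy_le_add_add`). The function `0` has energy `W(0) vol(M) / ε`. If the sum of the
three bounds is smaller than this, the glued family avoids `0`. Otherwise nothing is to be shown,
because every `c_ε(p)` is at most `W(0) vol(M) / ε`: any free complex maps equivariantly into a
small sphere-like set of a finite-dimensional space of smooth functions near `0`, where `W ≤ W(0)`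
(`exists_equivariantMap_energy_le`). The case `k = 0` or `m = 0` uses the two-point complex mapped
to the constants `1` and `-1`.

Topologically, one needs that nonvanishing of `ξ^p` for `K` and of `ξ^q` for `L` gives nonvanishing
of `ξ^(p+q+1)` for the join (`classPowNeZero_join`). On the total space `ξ` becomes the coboundary
of an odd `ℤ/2`-valued function, and nonvanishing of `ξ^p` is witnessed by a chain `c` with
invariant boundary on which the lifted power is `1`. If `c`, `d` are such chains, the power takes
the value `1` on `c * (d + Td)`. The boundary of this chain is `∂c * d + T(∂c * d)`, on which every
invariant cochain vanishes, so the power is not the coboundary of an invariant cochain.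

The analytic input is that `u ↦ |u|` is continuous on `H¹` and that weak differentials vanish almost
everywhere on zero sets. Both come from the chain rule for weak derivatives in charts, and charts
transport null sets in both directions because they are locally bi-Lipschitz. -/

lemma ContinuousLinearMap.enorm_apply_le_of_enorm_lt {F G : Type*} [NormedAddCommGroup F]
    [NormedSpace ℝ F] [NormedAddCommGroup G] [NormedSpace ℝ G] (A : F →L[ℝ] G) {C : ℝ≥0∞}
    (h : ‖A‖ₑ < C) (v : F) : ‖A v‖ₑ ≤ C * ‖v‖ₑ :=
  (ContinuousLinearMap.le_opENorm _ _).trans (by gcongr)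

lemma ContinuousLinearMap.norm_apply_le_of_norm_lt {F G : Type*} [NormedAddCommGroup F]
    [NormedSpace ℝ F] [NormedAddCommGroup G] [NormedSpace ℝ G] (A : F →L[ℝ] G) {C : ℝ}
    (h : ‖A‖ < C) (v : F) : ‖A v‖ ≤ C * ‖v‖ :=
  A.le_of_opNorm_le h.le v

/-- The inverse of the extended chart is Lipschitz near the centre of the chart. -/
lemma exists_lipschitzOnWith_extChartAt_symm (x : M) :
    ∃ C : ℝ≥0, ∃ s ∈ 𝓝[range I] (extChartAt I x x),
      s ⊆ (extChartAt I x).target ∧ LipschitzOnWith C (extChartAt I x).symm s := by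
  rcases eventually_enorm_mfderivWithin_symm_extChartAt_lt I x with ⟨C, C_pos, hC⟩
  replace hC : ∀ᶠ y in 𝓝[range I] (extChartAt I x x), ∀ v : E,
      ‖mfderiv[range I] (extChartAt I x).symm y v‖ₑ ≤ C * ‖v‖ₑ := by
    filter_upwards [hC] with y hy v
    exact @ContinuousLinearMap.enorm_apply_le_of_enorm_lt (TangentSpace 𝓘(ℝ, E) y)
      (TangentSpace I ((extChartAt I x).symm y)) _ _ _ _
      (mfderiv[range I] (extChartAt I x).symm y) C hy v
  obtain ⟨r, r_pos, hr⟩ : ∃ r > 0,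
      ball (extChartAt I x x) r ∩ range I ⊆ (extChartAt I x).target ∩
        {y | ∀ v : E, ‖mfderiv[range I] (extChartAt I x).symm y v‖ₑ ≤ C * ‖v‖ₑ} :=
    mem_nhdsWithin_iff.1 (inter_mem (extChartAt_target_mem_nhdsWithin x) hC)
  refine ⟨C, ball (extChartAt I x x) r ∩ range I, ?_, fun y hy => (hr hy).1, ?_⟩
  · rw [inter_comm]
    exact inter_mem_nhdsWithin _ (ball_mem_nhds _ r_pos)
  intro y hy z hz
  rw [IsRiemannianManifold.out (I := I)]
  -- The segment from `y` to `z` stays in the convex set, so its image in `M` has length at most `C`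
  -- times the distance of `y` and `z`; this bounds the Riemannian distance.
  let η := ContinuousAffineMap.lineMap (R := ℝ) y z
  set γ := (extChartAt I x).symm ∘ η
  have hη : Icc 0 1 ⊆ ⇑η ⁻¹' ((extChartAt I x).target ∩
        {y | ∀ v : E, ‖mfderiv[range I] (extChartAt I x).symm y v‖ₑ ≤ C * ‖v‖ₑ}) := by
    simp only [← image_subset_iff, ContinuousAffineMap.coe_lineMap_eq,
     ← segment_eq_image_lineMap, η]
    exact Subset.trans (((convex_ball _ _).inter I.convex_range).segment_subset hy hz) hr
  simp only [preimage_inter, subset_inter_iff] at hη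
  have η_smooth : CMDiff[Icc 0 1] 1 η := by
    apply ContMDiff.contMDiffOn
    rw [contMDiff_iff_contDiff]
    exact ContinuousAffineMap.contDiff _
  have : riemannianEDist I ((extChartAt I x).symm y) ((extChartAt I x).symm z)
      ≤ pathELength I γ 0 1 := by
    apply riemannianEDist_le_pathELength _ _ _ zero_le_one
    · exact (contMDiffOn_extChartAt_symm x).comp η_smooth hη.1
    · simp [γ, η, ContinuousAffineMap.coe_lineMap_eq]
    · simp [γ, η, ContinuousAffineMap.coe_lineMap_eq]
  apply this.trans
  rw [← lintegral_fderiv_lineMap_eq_edist, pathELength_eq_lintegral_mfderivWithin_Icc,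
    ← lintegral_const_mul' _ _ ENNReal.coe_ne_top]
  apply setLIntegral_mono' measurableSet_Icc (fun t ht ↦ ?_)
  have : mfderiv[Icc 0 1] γ t =
      (mfderiv[range I] (extChartAt I x).symm (η t)) ∘L (mfderiv[Icc 0 1] η t) := by
    apply mfderivWithin_comp
    · exact mdifferentiableWithinAt_extChartAt_symm (hη.1 ht)
    · exact η_smooth.mdifferentiableOn one_ne_zero t ht
    · exact hη.1.trans (preimage_mono (extChartAt_target_subset_range x))
    · rw [uniqueMDiffWithinAt_iff_uniqueDiffWithinAt]
      exact uniqueDiffOn_Icc zero_lt_one t ht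
  have : mfderiv[Icc 0 1] γ t 1 =
      (mfderiv[range I] (extChartAt I x).symm (η t)) (mfderiv[Icc 0 1] η t 1) := congr($this 1)
  rw [this]
  apply (hη.2 ht _).trans
  gcongr
  · simp only [mfderivWithin_eq_fderivWithin]
    exact le_of_eq rfl

/-- The differential of the extended chart is bounded near the centre of the chart. -/
lemma eventually_norm_mfderiv_extChartAt_apply_le (x : M) :
    ∃ C > (0 : ℝ), ∀ᶠ y in 𝓝 x, ∀ v : TangentSpace I y,
      ‖(mfderiv% (extChartAt I x) y v : E)‖ ≤ C * ‖v‖ := by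
  rcases eventually_norm_mfderiv_extChartAt_lt I x with ⟨C, C_pos, hC⟩
  refine ⟨C, C_pos, ?_⟩
  filter_upwards [hC] with y hy v
  exact @ContinuousLinearMap.norm_apply_le_of_norm_lt (TangentSpace I y)
    (TangentSpace 𝓘(ℝ, E) (extChartAt I x y)) _ _ _ _
    (mfderiv% (extChartAt I x) y) C hy v

/-- The extended chart is Lipschitz near its centre. -/
lemma exists_lipschitzOnWith_extChartAt (x : M) :
    ∃ C : ℝ≥0, ∃ s ∈ 𝓝 x, LipschitzOnWith C (extChartAt I x) s := by
  rcases eventually_enorm_mfderiv_extChartAt_lt I x with ⟨C, C_pos, hC⟩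
  replace hC : ∀ᶠ y in 𝓝 x, ∀ v : TangentSpace I y,
      ‖mfderiv% (extChartAt I x) y v‖ₑ ≤ C * ‖v‖ₑ := by
    filter_upwards [hC] with y hy v
    exact @ContinuousLinearMap.enorm_apply_le_of_enorm_lt (TangentSpace I y)
      (TangentSpace 𝓘(ℝ, E) (extChartAt I x y)) _ _ _ _
      (mfderiv% (extChartAt I x) y) C hy v
  obtain ⟨r, r_pos, hr⟩ : ∃ r > 0, Metric.eball x r ⊆ {y | ∀ v : TangentSpace I y, ‖mfderiv% (extChartAt I x) y v‖ₑ ≤ C * ‖v‖ₑ} ∩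
      (chartAt H x).source :=
    EMetric.mem_nhds_iff.1 (inter_mem hC (chart_source_mem_nhds H x))
  -- Two points of the ball of radius `r / 4` have distance less than `r / 2`, and a path of length
  -- less than `r / 2` that starts in this ball cannot leave the ball of radius `r`, where the
  -- differential is controlled.
  refine ⟨C, Metric.eball x (r / 4), Metric.eball_mem_nhds _ (ENNReal.div_pos r_pos.ne' (by simp)),
    fun y hy z hz => ?_⟩
  rw [Metric.mem_eball] at hy hz
  have hyz : edist y z < r / 2 := by
    calc edist y z ≤ edist y x + edist x z := edist_triangle _ _ _
      _ < r / 4 + r / 4 := ENNReal.add_lt_add hy (by rwa [edist_comm])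
      _ = r / 2 := by
        rw [← ENNReal.add_halves (r / 2), show r / 4 = r / 2 / 2 by
          rw [ENNReal.div_eq_inv_mul, ENNReal.div_eq_inv_mul, ENNReal.div_eq_inv_mul, ← mul_assoc,
            ← ENNReal.mul_inv (by simp) (by simp)]
          norm_num]
  -- If the Lipschitz bound failed, some path from `y` to `z` would be so short that its image under
  -- the chart is shorter than the distance of its end points.
  by_contra! hlt
  have hC0 : (C : ℝ≥0∞) ≠ 0 := by exact_mod_cast C_pos.ne'
  rw [mul_comm, ← ENNReal.lt_div_iff_mul_lt (Or.inl hC0) (Or.inl ENNReal.coe_ne_top)] at hlt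
  obtain ⟨R, hR, hR'⟩ := exists_between (lt_min hlt hyz)
  rw [IsRiemannianManifold.out (I := I)] at hR
  obtain ⟨γ, hγ0, hγ1, γ_smooth, hγ⟩ := exists_lt_of_riemannianEDist_lt hR
  have hmem : ∀ t ∈ Icc (0 : ℝ) 1, γ t ∈ Metric.eball x r := by
    intro t ht
    have h1 : edist y (γ t) < R := by
      rw [IsRiemannianManifold.out (I := I)]
      refine (riemannianEDist_le_pathELength (γ_smooth.mono (Icc_subset_Icc le_rfl ht.2)) hγ0 rfl
        ht.1).trans_lt (lt_of_le_of_lt ?_ hγ)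
      exact pathELength_mono le_rfl ht.2
    rw [Metric.mem_eball]
    calc edist (γ t) x ≤ edist (γ t) y + edist y x := edist_triangle _ _ _
      _ < r / 2 + r / 2 := by
        refine ENNReal.add_lt_add ?_ (hy.trans_le (ENNReal.div_le_div_left (by norm_num) _))
        rw [edist_comm]
        exact h1.trans (hR'.trans_le (min_le_right _ _))
      _ = r := ENNReal.add_halves r
  let γ' := extChartAt I x ∘ γ
  have hC' : CMDiff[Icc 0 1] 1 γ' :=
    contMDiffOn_extChartAt.comp (I' := I) (t := (chartAt H x).source)
      γ_smooth (fun t' ht' ↦ (hr (hmem t' ht')).2)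
  have key : edist (extChartAt I x y) (extChartAt I x z) ≤ C * pathELength I γ 0 1 := by
    calc edist (extChartAt I x y) (extChartAt I x z)
    _ = ‖γ' 1 - γ' 0‖ₑ := by
      rw [edist_comm, edist_eq_enorm_sub]; simp [γ', hγ0, hγ1]
    _ ≤ ∫⁻ t' in Icc 0 1, ‖derivWithin γ' (Icc 0 1) t'‖ₑ := by
      apply enorm_sub_le_lintegral_derivWithin_Icc_of_contDiffOn_Icc _ zero_le_one
      rwa [← contMDiffOn_iff_contDiffOn]
    _ = ∫⁻ t' in Icc 0 1, ‖mfderiv[Icc 0 1] γ' t' 1‖ₑ := by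
      simp_rw [← fderivWithin_derivWithin, mfderivWithin_eq_fderivWithin]
      rfl
    _ ≤ ∫⁻ t' in Icc 0 1, C * ‖mfderiv[Icc 0 1] γ t' 1‖ₑ := by
      apply setLIntegral_mono' measurableSet_Icc (fun t' ht' ↦ ?_)
      have : mfderiv[Icc 0 1] γ' t' =
          (mfderiv% (extChartAt I x) (γ t')) ∘L (mfderiv[Icc 0 1] γ t') := by
        apply mfderiv_comp_mfderivWithin
        · exact mdifferentiableAt_extChartAt (hr (hmem t' ht')).2
        · exact (γ_smooth.mdifferentiableOn one_ne_zero) _ ht'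
        · rw [uniqueMDiffWithinAt_iff_uniqueDiffWithinAt]
          exact uniqueDiffOn_Icc zero_lt_one _ ht'
      have : mfderiv[Icc 0 1] γ' t' 1 =
          (mfderiv% (extChartAt I x) (γ t')) (mfderiv[Icc 0 1] γ t' 1) :=
        congr($this 1)
      rw [this]
      exact (hr (hmem t' ht')).1 _
    _ = C * pathELength I γ 0 1 := by
      rw [lintegral_const_mul' _ _ ENNReal.coe_ne_top,
          pathELength_eq_lintegral_mfderivWithin_Icc]
  have : edist (extChartAt I x y) (extChartAt I x z) < edist (extChartAt I x y) (extChartAt I x z) :=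
    calc _ ≤ C * pathELength I γ 0 1 := key
      _ < C * R := ENNReal.mul_lt_mul_right hC0 ENNReal.coe_ne_top hγ
      _ ≤ C * (edist (extChartAt I x y) (extChartAt I x z) / C) := by
        gcongr; exact (hR'.trans_le (min_le_left _ _)).le
      _ ≤ _ := ENNReal.mul_div_le
  exact this.false

end RiemannianCharts


/-! ### The volume measure in charts -/

section Volume

open Manifold Metric Set
open scoped NNReal

lemma euclideanHausdorffMeasure_image_le {X Y : Type*} [EMetricSpace X] [MeasurableSpace X]
    [BorelSpace X] [EMetricSpace Y] [MeasurableSpace Y] [BorelSpace Y] {C : ℝ≥0} {f : X → Y}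
    {s : Set X} (h : LipschitzOnWith C f s) (d : ℕ) :
    (μHE[d] : Measure Y) (f '' s) ≤ (C : ℝ≥0∞) ^ (d : ℝ) * (μHE[d] : Measure X) s := by
  simp only [Measure.euclideanHausdorffMeasure_def, Measure.smul_apply]
  have := h.hausdorffMeasure_image_le (d := d) (by positivity)
  calc _ ≤ Measure.addHaarScalarFactor (volume : Measure (EuclideanSpace ℝ (Fin d))) μH[d] •
        ((C : ℝ≥0∞) ^ (d : ℝ) * μH[d] s) := by gcongr
    _ = _ := by simp only [ENNReal.smul_def, smul_eq_mul]; ring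

variable {n : ℕ} {M : Type*} [EMetricSpace M]
  [ChartedSpace (EuclideanSpace ℝ (Fin (n + 1))) M] [IsManifold (𝓡 (n + 1)) ∞ M]
  [RiemannianBundle (fun x : M => TangentSpace (𝓡 (n + 1)) x)]
  [IsContMDiffRiemannianBundle (𝓡 (n + 1)) ∞ (EuclideanSpace ℝ (Fin (n + 1)))
    (fun x : M => TangentSpace (𝓡 (n + 1)) x)]

variable (n M) in
/-- A smooth Riemannian metric is continuous. -/
lemma isContinuousRiemannianBundle_tangentSpace :
    IsContinuousRiemannianBundle (EuclideanSpace ℝ (Fin (n + 1)))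
      (fun x : M => TangentSpace (𝓡 (n + 1)) x) := by
  obtain ⟨g, hg, h⟩ := IsContMDiffRiemannianBundle.exists_contMDiff (IB := 𝓡 (n + 1)) (n := ∞)
    (F := EuclideanSpace ℝ (Fin (n + 1))) (E := fun x : M => TangentSpace (𝓡 (n + 1)) x)
  exact ⟨g, hg.continuous, h⟩

variable [IsRiemannianManifold (𝓡 (n + 1)) M]
  {e : OpenPartialHomeomorph M (EuclideanSpace ℝ (Fin (n + 1)))}

/-- The estimate is known for the preferred chart at `x`; any other chart differs from it by a
smooth, hence locally Lipschitz, transition map. -/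
lemma exists_lipschitzOnWith_of_mem_atlas
    (he : e ∈ atlas (EuclideanSpace ℝ (Fin (n + 1))) M) {x : M} (hx : x ∈ e.source) :
    ∃ C : ℝ≥0, ∃ s ∈ 𝓝 x, LipschitzOnWith C e s := by
  have := isContinuousRiemannianBundle_tangentSpace n M
  obtain ⟨C, s, hs, hC⟩ := exists_lipschitzOnWith_extChartAt (𝓡 (n + 1)) x
  have h1 := (contMDiffAt_iff.1 (contMDiffAt_of_mem_maximalAtlas (I := 𝓡 (n + 1)) (n := ∞)
    (IsManifold.subset_maximalAtlas he) hx)).2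
  simp only [modelWithCornersSelf_coe, range_id, contDiffWithinAt_univ] at h1
  obtain ⟨C', t, ht, hC'⟩ := (h1.of_le (by exact_mod_cast le_top)).exists_lipschitzOnWith
  have hsrc : (extChartAt (𝓡 (n + 1)) x).source ∈ 𝓝 x := extChartAt_source_mem_nhds x
  refine ⟨C' * C, s ∩ (extChartAt (𝓡 (n + 1)) x).source ∩ extChartAt (𝓡 (n + 1)) x ⁻¹' t,
    inter_mem (inter_mem hs hsrc) ((continuousAt_extChartAt x).preimage_mem_nhds ht), ?_⟩
  have := hC'.comp (hC.mono (show s ∩ (extChartAt (𝓡 (n + 1)) x).source ∩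
    extChartAt (𝓡 (n + 1)) x ⁻¹' t ⊆ s from fun y hy => hy.1.1)) (fun y hy => hy.2)
  intro y hy z hz
  have h2 := this hy hz
  simp only [Function.comp_apply, (extChartAt (𝓡 (n + 1)) x).left_inv hy.1.2,
    (extChartAt (𝓡 (n + 1)) x).left_inv hz.1.2] at h2
  simpa only [mfld_simps, chartAt_self_eq] using h2

lemma exists_lipschitzOnWith_symm_of_mem_atlas
    (he : e ∈ atlas (EuclideanSpace ℝ (Fin (n + 1))) M) {y : EuclideanSpace ℝ (Fin (n + 1))}
    (hy : y ∈ e.target) :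
    ∃ C : ℝ≥0, ∃ s ∈ 𝓝 y, s ⊆ e.target ∧ LipschitzOnWith C e.symm s := by
  have := isContinuousRiemannianBundle_tangentSpace n M
  set x := e.symm y with hx
  obtain ⟨C, s, hs, hst, hC⟩ := exists_lipschitzOnWith_extChartAt_symm (𝓡 (n + 1)) x
  have h0 := (contMDiffOn_symm_of_mem_maximalAtlas (I := 𝓡 (n + 1)) (n := ∞)
    (IsManifold.subset_maximalAtlas he)).contMDiffAt (e.open_target.mem_nhds hy)
  have h1 := (contMDiffAt_iff.1 h0).2
  simp only [modelWithCornersSelf_coe, range_id, contDiffWithinAt_univ] at h1 hs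
  rw [nhdsWithin_univ] at hs
  obtain ⟨C', t, ht, hC'⟩ := (h1.of_le (by exact_mod_cast le_top)).exists_lipschitzOnWith
  have hfun : (extChartAt (𝓡 (n + 1)) x ∘ e.symm ∘ (extChartAt (𝓡 (n + 1)) y).symm) =
    extChartAt (𝓡 (n + 1)) x ∘ e.symm := by
    ext1 z; simp only [mfld_simps, chartAt_self_eq]
  have hyy : extChartAt (𝓡 (n + 1)) y y = y := by simp only [mfld_simps, chartAt_self_eq]
  rw [← hx, hfun] at hC'
  rw [hyy] at ht
  have hcont : ContinuousAt e.symm y := h0.continuousAt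
  have hsrc : e.symm ⁻¹' (extChartAt (𝓡 (n + 1)) x).source ∈ 𝓝 y :=
    hcont.preimage_mem_nhds (extChartAt_source_mem_nhds x)
  have hss : e.symm ⁻¹' (extChartAt (𝓡 (n + 1)) x ⁻¹' s) ∈ 𝓝 y :=
    hcont.preimage_mem_nhds ((continuousAt_extChartAt x).preimage_mem_nhds hs)
  refine ⟨C * C', t ∩ e.symm ⁻¹' (extChartAt (𝓡 (n + 1)) x).source ∩
    e.symm ⁻¹' (extChartAt (𝓡 (n + 1)) x ⁻¹' s) ∩ e.target,
    inter_mem (inter_mem (inter_mem ht hsrc) hss) (e.open_target.mem_nhds hy),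
    fun z hz => hz.2, ?_⟩
  have := hC.comp (hC'.mono (show t ∩ e.symm ⁻¹' (extChartAt (𝓡 (n + 1)) x).source ∩
    e.symm ⁻¹' (extChartAt (𝓡 (n + 1)) x ⁻¹' s) ∩ e.target ⊆ t from fun y hy => hy.1.1.1))
    (fun y hy => hy.1.2)
  intro z hz w hw
  have h2 := this hz hw
  simp only [Function.comp_apply] at h2
  rwa [(extChartAt (𝓡 (n + 1)) x).left_inv hz.1.1.2,
    (extChartAt (𝓡 (n + 1)) x).left_inv hw.1.1.2] at h2

variable [MeasurableSpace M] [BorelSpace M]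

/-- Lipschitz maps send Hausdorff null sets to null sets, and being null is a local property. With
the inverse chart in place of the chart, the same argument gives `vol_eq_zero_of_volume_target`. -/
lemma volume_target_eq_zero_of_vol (he : e ∈ atlas (EuclideanSpace ℝ (Fin (n + 1))) M) {N : Set M}
    (hN : vol n M N = 0) : volume (e.target ∩ e.symm ⁻¹' N) = 0 := by
  refine measure_null_of_locally_null _ fun y hy => ?_
  obtain ⟨C, s, hs, hC⟩ := exists_lipschitzOnWith_of_mem_atlas he (e.map_target hy.1)
  refine ⟨(e.target ∩ e.symm ⁻¹' s) ∩ e.symm ⁻¹' N, ?_, ?_⟩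
  · refine mem_nhdsWithin.2 ⟨e.target ∩ e.symm ⁻¹' (interior s), ?_, ?_, ?_⟩
    · exact e.isOpen_inter_preimage_symm isOpen_interior
    · exact ⟨hy.1, mem_interior_iff_mem_nhds.2 hs⟩
    · exact fun z hz => ⟨⟨hz.1.1, interior_subset (s := s) hz.1.2⟩, hz.2.2⟩
  · have h1 := euclideanHausdorffMeasure_image_le (hC.mono (inter_subset_left (t := N))) (n + 1)
    rw [show (μHE[n + 1] : Measure M) (s ∩ N) = 0 from
      measure_mono_null inter_subset_right hN, mul_zero,
      EuclideanSpace.euclideanHausdorffMeasure_eq_volume] at h1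
    refine measure_mono_null ?_ (le_antisymm h1 bot_le)
    exact fun z hz => ⟨e.symm z, ⟨hz.1.2, hz.2⟩, e.right_inv hz.1.1⟩

variable [CompactSpace M]

lemma vol_eq_zero_of_volume_target (he : e ∈ atlas (EuclideanSpace ℝ (Fin (n + 1))) M) {N : Set M}
    (hN : volume (e.target ∩ e.symm ⁻¹' N) = 0) : vol n M (e.source ∩ N) = 0 := by
  refine measure_null_of_locally_null _ fun x hx => ?_
  obtain ⟨C, s, hs, hst, hC⟩ := exists_lipschitzOnWith_symm_of_mem_atlas he (e.map_source hx.1)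
  refine ⟨(e.source ∩ e ⁻¹' s) ∩ N, ?_, ?_⟩
  · refine mem_nhdsWithin.2 ⟨e.source ∩ e ⁻¹' (interior s), ?_, ?_, ?_⟩
    · exact e.isOpen_inter_preimage isOpen_interior
    · exact ⟨hx.1, mem_interior_iff_mem_nhds.2 hs⟩
    · exact fun z hz => ⟨⟨hz.1.1, interior_subset (s := s) hz.1.2⟩, hz.2.2⟩
  · have h1 := euclideanHausdorffMeasure_image_le
      (hC.mono (inter_subset_left (t := e.symm ⁻¹' N))) (n + 1)
    rw [EuclideanSpace.euclideanHausdorffMeasure_eq_volume,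
      measure_mono_null (inter_subset_inter_left _ hst) hN, mul_zero] at h1
    refine measure_mono_null ?_ (le_antisymm h1 bot_le)
    intro z hz
    refine ⟨e z, ⟨hz.1.2, ?_⟩, e.left_inv hz.1.1⟩
    rw [mem_preimage, e.left_inv hz.1.1]
    exact hz.2

/-- A property holds almost everywhere in the domain of a chart if and only if it holds almost
everywhere in the coordinates. -/
lemma ae_source_iff (he : e ∈ atlas (EuclideanSpace ℝ (Fin (n + 1))) M) {p : M → Prop} :
    (∀ᵐ x ∂(vol n M), x ∈ e.source → p x) ↔
      ∀ᵐ y ∂(volume.restrict e.target), p (e.symm y) := by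
  rw [ae_restrict_iff' e.open_target.measurableSet, ae_iff, ae_iff]
  constructor
  · intro h
    refine measure_mono_null ?_ (volume_target_eq_zero_of_vol he h)
    intro y hy
    simp only [mem_ofPred_eq, Classical.not_imp] at hy ⊢
    exact ⟨hy.1, by simpa [e.map_target hy.1] using hy.2⟩
  · intro h
    refine measure_mono_null ?_ (vol_eq_zero_of_volume_target he (N := {x | ¬ p x})
      (measure_mono_null ?_ h))
    · intro x hx
      simpa using hx
    · intro y hy
      simpa using hy

/-- A property holds almost everywhere if it does so in the coordinates of each chart. -/
lemma ae_of_forall_chart {p : M → Prop}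
    (h : ∀ e ∈ atlas (EuclideanSpace ℝ (Fin (n + 1))) M,
      ∀ᵐ y ∂(volume.restrict e.target), p (e.symm y)) : ∀ᵐ x ∂(vol n M), p x := by
  rw [ae_iff]
  refine measure_null_of_locally_null _ fun x hx => ?_
  have h1 := (ae_source_iff (chart_mem_atlas _ x)).2 (h _ (chart_mem_atlas _ x))
  refine ⟨{z | ¬ (z ∈ (chartAt (EuclideanSpace ℝ (Fin (n + 1))) x).source → p z)}, ?_, h1⟩
  refine mem_nhdsWithin.2 ⟨_, (chartAt (EuclideanSpace ℝ (Fin (n + 1))) x).open_source,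
    mem_chart_source _ x, fun z hz => ?_⟩
  simpa using hz

/-- Each point has a neighbourhood that is a Lipschitz image of a Euclidean ball; compactness does
the rest. -/
instance isFiniteMeasure_vol : IsFiniteMeasure (vol n M) := by
  refine ⟨isCompact_univ.measure_lt_top_of_nhdsWithin fun x _ => ?_⟩
  rw [nhdsWithin_univ]
  have he := chart_mem_atlas (EuclideanSpace ℝ (Fin (n + 1))) x
  set e := chartAt (EuclideanSpace ℝ (Fin (n + 1))) x
  have hx : x ∈ e.source := mem_chart_source _ x
  obtain ⟨C, s, hs, hst, hC⟩ := exists_lipschitzOnWith_symm_of_mem_atlas he (e.map_source hx)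
  obtain ⟨r, hr, hrs⟩ := Metric.mem_nhds_iff.1 hs
  refine ⟨e.source ∩ e ⁻¹' (ball (e x) r), ?_, ?_⟩
  · exact inter_mem (e.open_source.mem_nhds hx)
      ((e.continuousAt hx).preimage_mem_nhds (ball_mem_nhds _ hr))
  · have h1 := euclideanHausdorffMeasure_image_le (hC.mono hrs) (n + 1)
    rw [EuclideanSpace.euclideanHausdorffMeasure_eq_volume] at h1
    refine (measure_mono ?_).trans_lt (h1.trans_lt ?_)
    · exact fun z hz => ⟨e z, hz.2, e.left_inv hz.1⟩
    · refine ENNReal.mul_lt_top (ENNReal.rpow_lt_top_of_nonneg (by positivity) ENNReal.coe_ne_top) measure_ball_lt_top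

/-- A null open set would be null in a chart, where nonempty open sets have positive Lebesgue
measure. This later turns almost everywhere identities of continuous functions into identities. -/
instance isOpenPosMeasure_vol : (vol n M).IsOpenPosMeasure := by
  refine ⟨fun U hU ⟨x, hx⟩ h0 => ?_⟩
  have he := chart_mem_atlas (EuclideanSpace ℝ (Fin (n + 1))) x
  set e := chartAt (EuclideanSpace ℝ (Fin (n + 1))) x
  have hx' : x ∈ e.source := mem_chart_source _ x
  have := volume_target_eq_zero_of_vol he h0
  refine ((e.isOpen_inter_preimage_symm hU).measure_ne_zero volume ⟨e x, e.map_source hx', ?_⟩) this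
  rwa [mem_preimage, e.left_inv hx']

/-- A function is almost everywhere measurable if it is so in the coordinates of each chart. -/
lemma aemeasurable_vol_of_forall_chart {f : M → ℝ}
    (h : ∀ e ∈ atlas (EuclideanSpace ℝ (Fin (n + 1))) M,
      AEMeasurable (fun y => f (e.symm y)) (volume.restrict e.target)) :
    AEMeasurable f (vol n M) := by
  have h1 : ∀ e ∈ atlas (EuclideanSpace ℝ (Fin (n + 1))) M,
      AEMeasurable f ((vol n M).restrict e.source) := by
    intro e he
    have hm : AEMeasurable e ((vol n M).restrict e.source) :=
      e.continuousOn.aemeasurable e.open_source.measurableSet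
    have hac : ((vol n M).restrict e.source).map e ≪ volume.restrict e.target := by
      refine Measure.AbsolutelyContinuous.mk fun N hN h0 => ?_
      rw [Measure.map_apply_of_aemeasurable hm hN, Measure.restrict_apply₀'
        e.open_source.measurableSet.nullMeasurableSet, inter_comm]
      refine vol_eq_zero_of_volume_target he ?_
      rw [Measure.restrict_apply hN] at h0
      refine measure_mono_null ?_ h0
      intro y hy
      exact ⟨by simpa [e.right_inv hy.1] using hy.2, hy.1⟩
    refine (((h e he).mono_ac hac).comp_aemeasurable hm).congr ?_
    filter_upwards [ae_restrict_mem e.open_source.measurableSet] with x hx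
    simp [e.left_inv hx]
  obtain ⟨t, ht, htu⟩ := isCompact_univ.elim_nhds_subcover
    (fun x : M => (chartAt (EuclideanSpace ℝ (Fin (n + 1))) x).source)
    (fun x _ => chart_source_mem_nhds _ x)
  have : AEMeasurable f ((vol n M).restrict (⋃ x : t,
      (chartAt (EuclideanSpace ℝ (Fin (n + 1))) (x : M)).source)) :=
    aemeasurable_iUnion_iff.2 fun x => h1 _ (chart_mem_atlas _ _)
  rwa [show (⋃ x : t, (chartAt (EuclideanSpace ℝ (Fin (n + 1))) (x : M)).source) = univ from
    eq_univ_of_univ_subset (htu.trans (iUnion₂_subset fun i hi => subset_iUnion (fun x : t =>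
      (chartAt (EuclideanSpace ℝ (Fin (n + 1))) (x : M)).source) ⟨i, hi⟩)), Measure.restrict_univ] at this

end Volume


/-! ### Measurability of the norm of a weak differential -/

section NormMeasurable

open Manifold Metric Set

variable {n : ℕ} {M : Type*} [EMetricSpace M]
  [ChartedSpace (EuclideanSpace ℝ (Fin (n + 1))) M] [IsManifold (𝓡 (n + 1)) ∞ M]
  [RiemannianBundle (fun x : M => TangentSpace (𝓡 (n + 1)) x)]
  [IsContMDiffRiemannianBundle (𝓡 (n + 1)) ∞ (EuclideanSpace ℝ (Fin (n + 1)))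
    (fun x : M => TangentSpace (𝓡 (n + 1)) x)]
  {e : OpenPartialHomeomorph M (EuclideanSpace ℝ (Fin (n + 1)))}

lemma continuousOn_norm_mfderiv_symm (he : e ∈ atlas (EuclideanSpace ℝ (Fin (n + 1))) M)
    (v : EuclideanSpace ℝ (Fin (n + 1))) :
    ContinuousOn (fun y => ‖(mfderiv (𝓡 (n + 1)) (𝓡 (n + 1)) e.symm y v :
      TangentSpace (𝓡 (n + 1)) (e.symm y))‖) e.target := by
  have := isContinuousRiemannianBundle_tangentSpace n M
  have h0 := contMDiffOn_symm_of_mem_maximalAtlas (I := 𝓡 (n + 1)) (n := ∞)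
    (IsManifold.subset_maximalAtlas he)
  have h1 : ContinuousOn (fun y : EuclideanSpace ℝ (Fin (n + 1)) =>
      tangentMapWithin (𝓡 (n + 1)) (𝓡 (n + 1)) e.symm e.target
      (⟨y, v⟩ : TangentBundle (𝓡 (n + 1)) (EuclideanSpace ℝ (Fin (n + 1))))) e.target := by
    refine (h0.continuousOn_tangentMapWithin (by exact_mod_cast le_top)
      e.open_target.uniqueMDiffOn).comp (f := fun y => (⟨y, v⟩ :
        TangentBundle (𝓡 (n + 1)) (EuclideanSpace ℝ (Fin (n + 1))))) ?_ (fun y hy => hy)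
    exact ((tangentBundleModelSpaceHomeomorph (𝓡 (n + 1))).symm.continuous.comp
      (f := fun y => ((y, v) : EuclideanSpace ℝ (Fin (n + 1)) × EuclideanSpace ℝ (Fin (n + 1))))
      (by fun_prop)).continuousOn
  have h2 : ContinuousOn (fun y => (⟨e.symm y, mfderiv (𝓡 (n + 1)) (𝓡 (n + 1)) e.symm y v⟩ :
      TotalSpace (EuclideanSpace ℝ (Fin (n + 1))) (fun x : M => TangentSpace (𝓡 (n + 1)) x)))
      e.target := by
    refine h1.congr fun y hy => ?_
    simp only [tangentMapWithin]
    rw [mfderivWithin_of_isOpen e.open_target hy]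
  have h3 := (ContinuousOn.inner_bundle h2 h2).sqrt
  refine h3.congr fun y hy => ?_
  simp only [norm_eq_sqrt_real_inner]

/-- A countable supremum suffices for the dual norm: the differential of the inverse chart is onto,
and the inequality `|α(Dv)| ≤ C ‖Dv‖` is a closed condition on `v`. Terms with `Dv = 0` are `0 / 0 =
0` and do no harm. -/
lemma norm_eq_iSup_of_mem_atlas (he : e ∈ atlas (EuclideanSpace ℝ (Fin (n + 1))) M)
    {y : EuclideanSpace ℝ (Fin (n + 1))} (hy : y ∈ e.target)
    (α : TangentSpace (𝓡 (n + 1)) (e.symm y) →L[ℝ] ℝ) :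
    ‖α‖ = ⨆ k : ℕ, |α (mfderiv (𝓡 (n + 1)) (𝓡 (n + 1)) e.symm y
        (TopologicalSpace.denseSeq (EuclideanSpace ℝ (Fin (n + 1))) k))| /
      ‖(mfderiv (𝓡 (n + 1)) (𝓡 (n + 1)) e.symm y
        (TopologicalSpace.denseSeq (EuclideanSpace ℝ (Fin (n + 1))) k) :
          TangentSpace (𝓡 (n + 1)) (e.symm y))‖ := by
  set D := mfderiv (𝓡 (n + 1)) (𝓡 (n + 1)) e.symm y
  have hsurj : Function.Surjective D :=
    (mdifferentiable_of_mem_atlas (I := 𝓡 (n + 1)) he).symm.mfderiv_surjective hy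
  have hle : ∀ k : ℕ, |α (D (TopologicalSpace.denseSeq (EuclideanSpace ℝ (Fin (n + 1))) k))| /
      ‖(D (TopologicalSpace.denseSeq (EuclideanSpace ℝ (Fin (n + 1))) k) :
          TangentSpace (𝓡 (n + 1)) (e.symm y))‖ ≤ ‖α‖ := fun k =>
    div_le_of_le_mul₀ (norm_nonneg _) α.opNorm_nonneg (α.le_opNorm _)
  refine le_antisymm ?_ (ciSup_le hle)
  have hbdd : BddAbove (range fun k : ℕ =>
      |α (D (TopologicalSpace.denseSeq (EuclideanSpace ℝ (Fin (n + 1))) k))| /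
      ‖(D (TopologicalSpace.denseSeq (EuclideanSpace ℝ (Fin (n + 1))) k) :
          TangentSpace (𝓡 (n + 1)) (e.symm y))‖) := ⟨‖α‖, by rintro _ ⟨k, rfl⟩; exact hle k⟩
  refine α.opNorm_le_bound (Real.iSup_nonneg fun k => by positivity) fun w => ?_
  obtain ⟨v, rfl⟩ := hsurj w
  have hcl : IsClosed {v : EuclideanSpace ℝ (Fin (n + 1)) | |α (D v)| ≤
      (⨆ k : ℕ, |α (D (TopologicalSpace.denseSeq (EuclideanSpace ℝ (Fin (n + 1))) k))| /
      ‖(D (TopologicalSpace.denseSeq (EuclideanSpace ℝ (Fin (n + 1))) k) :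
          TangentSpace (𝓡 (n + 1)) (e.symm y))‖) * ‖(D v : TangentSpace (𝓡 (n + 1)) (e.symm y))‖} :=
    isClosed_le (by fun_prop) (by fun_prop)
  refine closure_minimal (s := range (TopologicalSpace.denseSeq (EuclideanSpace ℝ (Fin (n + 1)))))
    ?_ hcl (TopologicalSpace.denseRange_denseSeq (EuclideanSpace ℝ (Fin (n + 1))) v)
  rintro _ ⟨k, rfl⟩
  rw [mem_ofPred_eq]
  by_cases h0 : (D (TopologicalSpace.denseSeq (EuclideanSpace ℝ (Fin (n + 1))) k) :
        TangentSpace (𝓡 (n + 1)) (e.symm y)) = 0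
  · rw [h0]; simp
  · rw [← div_le_iff₀ (norm_pos_iff.2 h0)]
    exact le_ciSup hbdd k

variable [IsRiemannianManifold (𝓡 (n + 1)) M] [MeasurableSpace M] [BorelSpace M] [CompactSpace M]

/-- A weak differential is an arbitrary section, and only its components in charts are known to be
measurable; the countable supremum above transfers this to the norm. -/
lemma AllenCahn.IsWeakDifferential.aemeasurable_norm {u : M → ℝ}
    {α : (x : M) → TangentSpace (𝓡 (n + 1)) x →L[ℝ] ℝ} (h : IsWeakDifferential n u α) :
    AEMeasurable (fun x => ‖α x‖) (vol n M) := by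
  refine aemeasurable_vol_of_forall_chart fun e he => ?_
  have h1 : AEMeasurable (fun y => ⨆ k : ℕ, |α (e.symm y) (mfderiv (𝓡 (n + 1)) (𝓡 (n + 1)) e.symm y
        (TopologicalSpace.denseSeq (EuclideanSpace ℝ (Fin (n + 1))) k))| /
      ‖(mfderiv (𝓡 (n + 1)) (𝓡 (n + 1)) e.symm y
        (TopologicalSpace.denseSeq (EuclideanSpace ℝ (Fin (n + 1))) k) :
          TangentSpace (𝓡 (n + 1)) (e.symm y))‖) (volume.restrict e.target) := by
    refine AEMeasurable.iSup fun k => AEMeasurable.div ?_ ?_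
    · exact (h.locInt_diff e he _).aestronglyMeasurable.aemeasurable.abs
    · exact (continuousOn_norm_mfderiv_symm he _).aemeasurable e.open_target.measurableSet
  refine h1.congr ?_
  filter_upwards [ae_restrict_mem e.open_target.measurableSet] with y hy
  exact (norm_eq_iSup_of_mem_atlas he hy _).symm

end NormMeasurable


/-! ### Mollification -/

section Mollification

open scoped Convolution

/-- Scheffé's lemma: almost everywhere convergence of nonnegative functions with constant
integral is convergence in `L¹`. -/
lemma tendsto_integral_abs_sub_of_ae_tendsto {X : Type*} [MeasurableSpace X] {μ : Measure X}
    {p : ℕ → X → ℝ} {q : X → ℝ} (hp : ∀ k, Integrable (p k) μ) (hq : Integrable q μ)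
    (hp0 : ∀ k x, 0 ≤ p k x) (hq0 : ∀ x, 0 ≤ q x) (hint : ∀ k, ∫ x, p k x ∂μ = ∫ x, q x ∂μ)
    (hlim : ∀ᵐ x ∂μ, Tendsto (fun k => p k x) atTop (𝓝 (q x))) :
    Tendsto (fun k => ∫ x, |p k x - q x| ∂μ) atTop (𝓝 0) := by
  -- The positive part of `q - p k` is dominated by `q`. Since `|p - q| = (p - q) + 2 (q - p)⁺` and
  -- `p - q` has integral zero, this is enough.
  have h1 : Tendsto (fun k => ∫ x, max (q x - p k x) 0 ∂μ) atTop (𝓝 (∫ _, (0 : ℝ) ∂μ)) := by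
    refine tendsto_integral_of_dominated_convergence q
      (fun k => ((hq.sub (hp k)).pos_part).aestronglyMeasurable) hq (fun k => ?_) ?_
    · refine Eventually.of_forall fun x => ?_
      rw [Real.norm_of_nonneg (le_max_right _ _)]
      exact max_le (by linarith [hp0 k x]) (hq0 x)
    · filter_upwards [hlim] with x hx
      simpa using ((tendsto_const_nhds (x := q x)).sub hx).max (tendsto_const_nhds (x := (0 : ℝ)))
  have h2 : ∀ k, ∫ x, |p k x - q x| ∂μ = 2 * ∫ x, max (q x - p k x) 0 ∂μ := by
    intro k
    have : ∫ x, |p k x - q x| ∂μ = ∫ x, (p k x - q x) + 2 * max (q x - p k x) 0 ∂μ := by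
      congr with x
      rcases le_total (p k x) (q x) with h | h
      · rw [abs_of_nonpos (by linarith), max_eq_left (by linarith)]; ring
      · rw [abs_of_nonneg (by linarith), max_eq_right (by linarith)]; ring
    have h3 : ∫ x, (p k x - q x) + 2 * max (q x - p k x) 0 ∂μ =
        ∫ x, (p k x - q x) ∂μ + ∫ x, 2 * max (q x - p k x) 0 ∂μ :=
      integral_add ((hp k).sub hq) (((hq.sub (hp k)).pos_part).const_mul 2)
    rw [this, h3, integral_sub (hp k) hq, hint, sub_self, zero_add, integral_const_mul]
  simp_rw [h2]
  simpa using h1.const_mul 2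

variable {E : Type*} [NormedAddCommGroup E] [NormedSpace ℝ E] [FiniteDimensional ℝ E]
  [MeasurableSpace E] [BorelSpace E] {μ : Measure E} [μ.IsAddHaarMeasure]

/-- Mollifications of an integrable function converge in `L¹`. -/
lemma tendsto_integral_abs_convolution_sub {φ : ℕ → ContDiffBump (0 : E)} {K : ℝ}
    (hφ : Tendsto (fun k => (φ k).rOut) atTop (𝓝 0)) (hK : ∀ k, (φ k).rOut ≤ K * (φ k).rIn)
    {g : E → ℝ} (hg : Integrable g μ) :
    Tendsto (fun k => ∫ x, |((φ k).normed μ ⋆[ContinuousLinearMap.lsmul ℝ ℝ, μ] g) x - g x| ∂μ)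
      atTop (𝓝 0) := by
  -- Mollification preserves positivity and the integral and converges almost everywhere, so
  -- Scheffé's lemma applies to nonnegative functions; a general `g` is split into its positive and
  -- negative parts.
  have hpos : ∀ {p : E → ℝ}, Integrable p μ → (∀ x, 0 ≤ p x) →
      Tendsto (fun k => ∫ x, |((φ k).normed μ ⋆[ContinuousLinearMap.lsmul ℝ ℝ, μ] p) x - p x| ∂μ)
      atTop (𝓝 0) := by
    intro p hp hp0
    refine tendsto_integral_abs_sub_of_ae_tendsto (fun k =>
      (φ k).integrable_normed.integrable_convolution _ hp) hp (fun k x => ?_) hp0 (fun k => ?_)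
      (ContDiffBump.ae_convolution_tendsto_right_of_locallyIntegrable hφ (.of_forall hK)
        hp.locallyIntegrable)
    · exact integral_nonneg fun t => mul_nonneg ((φ k).nonneg_normed t) (hp0 _)
    · rw [integral_convolution _ (φ k).integrable_normed hp, (φ k).integral_normed]
      simp
  have h1 := hpos hg.pos_part (fun x => le_max_right _ _)
  have h2 := hpos hg.neg_part (fun x => le_max_right _ _)
  refine squeeze_zero (fun k => integral_nonneg fun x => abs_nonneg _) (fun k => ?_)
    (by simpa using h1.add h2)
  have hcont : ∀ {p : E → ℝ}, Integrable p μ →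
      Integrable ((φ k).normed μ ⋆[ContinuousLinearMap.lsmul ℝ ℝ, μ] p) μ := fun hp =>
    (φ k).integrable_normed.integrable_convolution _ hp
  refine le_trans (integral_mono ((hcont hg).sub hg).abs
    (((hcont hg.pos_part).sub hg.pos_part).abs.add ((hcont hg.neg_part).sub hg.neg_part).abs)
    fun x => ?_) (integral_add ((hcont hg.pos_part).sub hg.pos_part).abs
    ((hcont hg.neg_part).sub hg.neg_part).abs).le
  have hdec : g + (fun x => max (-g x) 0) = fun x => max (g x) 0 := by
    ext x
    simp only [Pi.add_apply]
    rcases le_total (g x) 0 with h | h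
    · rw [max_eq_left (by linarith), max_eq_right h]; ring
    · rw [max_eq_right (by linarith), max_eq_left h]; ring
  have hex : ∀ {p : E → ℝ}, Integrable p μ →
      ConvolutionExists ((φ k).normed μ) p (ContinuousLinearMap.lsmul ℝ ℝ) μ := fun hp =>
    (φ k).hasCompactSupport_normed.convolutionExists_left _ (φ k).continuous_normed
      hp.locallyIntegrable
  have h3 := congrFun ((hex hg).distrib_add (hex hg.neg_part)) x
  rw [hdec] at h3
  have h4 := congrFun hdec x
  simp only [Pi.add_apply] at h3 h4
  simp only [Pi.add_apply, Pi.sub_apply]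
  rw [h3, ← h4]
  refine le_trans (le_of_eq ?_) (abs_sub _ _)
  congr 1
  ring

/-- `g` is the weak derivative of `u` in the direction `v` on the open set `Ω`. -/
def IsWeakLineDeriv (μ : Measure E) (Ω : Set E) (v : E) (u g : E → ℝ) : Prop :=
  ∀ η : E → ℝ, ContDiff ℝ ∞ η → HasCompactSupport η → tsupport η ⊆ Ω →
    ∫ y in Ω, u y * fderiv ℝ η y v ∂μ = - ∫ y in Ω, g y * η y ∂μ

/-- Mollification commutes with weak differentiation. -/
lemma fderiv_convolution_of_isWeakLineDeriv {u g : E → ℝ} {v : E} (hu : Integrable u μ)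
    (h : IsWeakLineDeriv μ Set.univ v u g) (φ : ContDiffBump (0 : E)) (x : E) :
    fderiv ℝ (φ.normed μ ⋆[ContinuousLinearMap.lsmul ℝ ℝ, μ] u) x v =
      (φ.normed μ ⋆[ContinuousLinearMap.lsmul ℝ ℝ, μ] g) x := by
  have hφ : ContDiff ℝ ∞ (φ.normed μ) := φ.contDiff_normed
  have h1 := φ.hasCompactSupport_normed.hasFDerivAt_convolution_left (μ := μ)
    (ContinuousLinearMap.lsmul ℝ ℝ) (hφ.of_le (by exact_mod_cast le_top)) hu.locallyIntegrable x
  rw [h1.fderiv]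
  -- The defining identity of the weak derivative is tested with the kernel centred at `x`; the
  -- reflection `y ↦ x - y` produces the sign.
  have hsub : ContDiff ℝ ∞ (fun y => φ.normed μ (x - y)) := hφ.comp (contDiff_const.sub contDiff_id)
  have hcs : HasCompactSupport (fun y => φ.normed μ (x - y)) :=
    φ.hasCompactSupport_normed.comp_homeomorph (Homeomorph.subLeft x)
  have h2 := h _ hsub hcs (Set.subset_univ _)
  simp only [Measure.restrict_univ] at h2
  have hder : ∀ y, fderiv ℝ (fun y => φ.normed μ (x - y)) y v = - fderiv ℝ (φ.normed μ) (x - y) v := by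
    intro y
    have h3 : HasFDerivAt (fun y => φ.normed μ (x - y))
        ((fderiv ℝ (φ.normed μ) (x - y)).comp (-ContinuousLinearMap.id ℝ E)) y :=
      ((hφ.differentiable (by simp)) (x - y)).hasFDerivAt.comp y ((hasFDerivAt_id y).const_sub x)
    rw [h3.fderiv]; simp
  simp_rw [hder] at h2
  have hconv : ConvolutionExistsAt (fderiv ℝ (φ.normed μ)) u x
      ((ContinuousLinearMap.lsmul ℝ ℝ).precompL E) μ :=
    (φ.hasCompactSupport_normed.fderiv ℝ).convolutionExists_left _
      (hφ.continuous_fderiv (by simp)) hu.locallyIntegrable x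
  rw [convolution_eq_swap, convolution_eq_swap]
  rw [ContinuousLinearMap.integral_apply]
  · simp only [ContinuousLinearMap.precompL_apply, ContinuousLinearMap.lsmul_apply, smul_eq_mul,
      mul_neg, integral_neg, neg_inj] at h2 ⊢
    simp_rw [mul_comm (fderiv ℝ (φ.normed μ) _ v), mul_comm (φ.normed μ _)]
    exact h2
  · exact hconv.integrable_swap

/-- The chain rule for weak derivatives of integrable functions. -/
lemma IsWeakLineDeriv.comp_of_integrable {u g : E → ℝ} {v : E} (hu : Integrable u μ)
    (hg : Integrable g μ) (h : IsWeakLineDeriv μ Set.univ v u g) {f : ℝ → ℝ} (hf : ContDiff ℝ 1 f)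
    {C : ℝ} (hC : ∀ t, |deriv f t| ≤ C) :
    IsWeakLineDeriv μ Set.univ v (fun x => f (u x)) (fun x => deriv f (u x) * g x) := by
  intro η hη hηc _
  simp only [Measure.restrict_univ]
  have hC0 : 0 ≤ C := (abs_nonneg _).trans (hC 0)
  -- The ratio of outer to inner radius is fixed at `2`; a bounded ratio is what almost everywhere
  -- convergence of mollifications requires.
  let φ : ℕ → ContDiffBump (0 : E) := fun k =>
    ⟨1 / ((k : ℝ) + 1), 2 * (1 / ((k : ℝ) + 1)), by positivity, by
      have : 0 < 1 / ((k : ℝ) + 1) := by positivity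
      linarith⟩
  have hφ : Tendsto (fun k => (φ k).rOut) atTop (𝓝 0) := by
    have := (tendsto_one_div_add_atTop_nhds_zero_nat (𝕜 := ℝ)).const_mul 2
    rwa [mul_zero] at this
  have hK : ∀ k, (φ k).rOut ≤ 2 * (φ k).rIn := fun k => le_rfl
  set U : ℕ → E → ℝ := fun k => ((φ k).normed μ ⋆[ContinuousLinearMap.lsmul ℝ ℝ, μ] u) with hU
  set G : ℕ → E → ℝ := fun k => ((φ k).normed μ ⋆[ContinuousLinearMap.lsmul ℝ ℝ, μ] g) with hG
  have hUi : ∀ k, Integrable (U k) μ := fun k =>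
    (φ k).integrable_normed.integrable_convolution _ hu
  have hGi : ∀ k, Integrable (G k) μ := fun k =>
    (φ k).integrable_normed.integrable_convolution _ hg
  have hUc : ∀ k, ContDiff ℝ 1 (U k) := fun k =>
    (φ k).hasCompactSupport_normed.contDiff_convolution_left _
      ((φ k).contDiff_normed (n := 1)) hu.locallyIntegrable
  have hηd : Continuous fun x => fderiv ℝ η x v := (hη.continuous_fderiv (by simp)).clm_apply
    continuous_const
  have hηdc : HasCompactSupport fun x => fderiv ℝ η x v := hηc.fderiv_apply ℝ v
  obtain ⟨A, hA⟩ := hη.continuous.bounded_above_of_compact_support hηc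
  obtain ⟨B, hB⟩ := hηd.bounded_above_of_compact_support hηdc
  have hf' : Continuous (deriv f) := hf.continuous_deriv le_rfl
  have hlip : ∀ a b, |f a - f b| ≤ C * |a - b| := by
    intro a b
    have := Convex.norm_image_sub_le_of_norm_deriv_le (f := f) (s := Set.univ) (C := C) (x := b)
      (y := a) (fun x _ => (hf.differentiable one_ne_zero) x) (fun x _ => hC x) convex_univ trivial trivial
    simpa using this
  have hfU : ∀ k, Continuous fun x => f (U k x) := fun k => hf.continuous.comp (hUc k).continuous
  have hfUG : ∀ k x, fderiv ℝ (fun x => f (U k x)) x v = deriv f (U k x) * G k x := by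
    intro k x
    have h1 : HasFDerivAt (fun x => f (U k x)) (deriv f (U k x) • fderiv ℝ (U k) x) x :=
      ((hf.differentiable one_ne_zero) (U k x)).hasDerivAt.comp_hasFDerivAt x
        (((hUc k).differentiable one_ne_zero) x).hasFDerivAt
    rw [h1.fderiv]
    simp only [smul_apply, smul_eq_mul]
    rw [fderiv_convolution_of_isWeakLineDeriv hu h]
  have hGc : ∀ k, Continuous fun x => deriv f (U k x) * G k x := by
    intro k
    simp_rw [← hfUG]
    exact ((hf.comp (hUc k)).continuous_fderiv one_ne_zero).clm_apply continuous_const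
  -- For the mollified function this is classical integration by parts. The two sides then converge
  -- separately.
  have hparts : ∀ k, ∫ x, f (U k x) * fderiv ℝ η x v ∂μ =
      - ∫ x, deriv f (U k x) * G k x * η x ∂μ := by
    intro k
    have := integral_mul_fderiv_eq_neg_fderiv_mul_of_integrable (μ := μ)
      (f := fun x => f (U k x)) (g := η) (v := v) ?_ ?_ ?_ ?_ ?_
    · simpa only [hfUG] using this
    · simp only [hfUG]
      exact ((hGc k).mul hη.continuous).integrable_of_hasCompactSupport hηc.mul_left
    · exact ((hfU k).mul hηd).integrable_of_hasCompactSupport hηdc.mul_left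
    · exact ((hfU k).mul hη.continuous).integrable_of_hasCompactSupport hηc.mul_left
    · exact fun x _ => ((hf.comp (hUc k)).differentiable one_ne_zero) x
    · exact fun x _ => (hη.differentiable (by simp)) x
  have hae := ContDiffBump.ae_convolution_tendsto_right_of_locallyIntegrable (μ := μ) hφ
    (.of_forall hK) hu.locallyIntegrable
  have hfum : AEStronglyMeasurable (fun x => f (u x)) μ :=
    hf.continuous.comp_aestronglyMeasurable hu.aestronglyMeasurable
  have hf'um : AEStronglyMeasurable (fun x => deriv f (u x)) μ :=
    hf'.comp_aestronglyMeasurable hu.aestronglyMeasurable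
  have hfi : Integrable (fun x => f (u x) * fderiv ℝ η x v) μ := by
    have h1 : Integrable (fun x => f 0 * fderiv ℝ η x v) μ :=
      (hηd.integrable_of_hasCompactSupport hηdc).const_mul _
    have h2 : Integrable (fun x => (f (u x) - f 0) * fderiv ℝ η x v) μ := by
      refine Integrable.mul_bdd (c := B) ?_ hηd.aestronglyMeasurable (.of_forall hB)
      refine (hu.abs.const_mul C).mono' (hfum.sub aestronglyMeasurable_const) (.of_forall fun x => ?_)
      simpa using hlip (u x) 0
    refine (h1.add h2).congr (.of_forall fun x => ?_)
    simp only [Pi.add_apply]; ring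
  have hgi : Integrable (fun x => deriv f (u x) * g x * η x) μ :=
    Integrable.mul_bdd (c := A) (hg.bdd_mul hf'um (.of_forall fun x => hC _))
      hη.continuous.aestronglyMeasurable (.of_forall hA)
  have hl : Tendsto (fun k => ∫ x, f (U k x) * fderiv ℝ η x v ∂μ) atTop
      (𝓝 (∫ x, f (u x) * fderiv ℝ η x v ∂μ)) := by
    have h0 := (tendsto_integral_abs_convolution_sub hφ hK hu).const_mul (C * B)
    rw [mul_zero] at h0
    rw [tendsto_iff_norm_sub_tendsto_zero]
    refine squeeze_zero (fun k => norm_nonneg _) (fun k => ?_) h0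
    have hki : Integrable (fun x => f (U k x) * fderiv ℝ η x v) μ :=
      ((hfU k).mul hηd).integrable_of_hasCompactSupport hηdc.mul_left
    rw [← integral_sub hki hfi, ← integral_const_mul]
    refine norm_integral_le_of_norm_le (((hUi k).sub hu).abs.const_mul _) (.of_forall fun x => ?_)
    rw [← sub_mul, norm_mul, Real.norm_eq_abs]
    calc _ ≤ (C * |U k x - u x|) * B :=
          mul_le_mul (hlip _ _) (hB x) (norm_nonneg _) (by positivity)
      _ = _ := by ring
  have hr : Tendsto (fun k => ∫ x, deriv f (U k x) * G k x * η x ∂μ) atTop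
      (𝓝 (∫ x, deriv f (u x) * g x * η x ∂μ)) := by
    -- The product `f'(U k) · G k` is split as `f'(U k) · g + f'(U k) · (G k - g)`: dominated
    -- convergence handles the first term, `L¹` convergence and the bound on `f'` the second.
    have h1 : Tendsto (fun k => ∫ x, deriv f (U k x) * g x * η x ∂μ) atTop
        (𝓝 (∫ x, deriv f (u x) * g x * η x ∂μ)) := by
      refine tendsto_integral_of_dominated_convergence (fun x => C * |g x| * A) (fun k => ?_)
        ((hg.abs.const_mul C).mul_const A) (fun k => ?_) ?_
      · exact ((hf'.comp (hUc k).continuous).aestronglyMeasurable.mul hg.aestronglyMeasurable).mul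
          hη.continuous.aestronglyMeasurable
      · refine .of_forall fun x => ?_
        rw [norm_mul, norm_mul]
        exact mul_le_mul (mul_le_mul_of_nonneg_right (hC _) (abs_nonneg _)) (hA x) (norm_nonneg _)
          (by positivity)
      · filter_upwards [hae] with x hx
        exact ((((hf'.tendsto _).comp hx)).mul_const _).mul_const _
    have h2 : Tendsto (fun k => ∫ x, deriv f (U k x) * (G k x - g x) * η x ∂μ) atTop (𝓝 0) := by
      have h0 := (tendsto_integral_abs_convolution_sub hφ hK hg).const_mul (C * A)
      rw [mul_zero] at h0
      refine squeeze_zero_norm (fun k => ?_) h0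
      rw [← integral_const_mul]
      refine norm_integral_le_of_norm_le (((hGi k).sub hg).abs.const_mul _) (.of_forall fun x => ?_)
      rw [norm_mul, norm_mul, Real.norm_eq_abs, Real.norm_eq_abs]
      calc _ ≤ (C * |G k x - g x|) * A :=
            mul_le_mul (mul_le_mul_of_nonneg_right (hC _) (abs_nonneg _)) (hA x) (norm_nonneg _)
              (by positivity)
        _ = _ := by ring
    have h3 := h2.add h1
    rw [zero_add] at h3
    refine h3.congr fun k => ?_
    have hm : AEStronglyMeasurable (fun x => deriv f (U k x)) μ :=
      (hf'.comp (hUc k).continuous).aestronglyMeasurable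
    rw [← integral_add]
    · congr with x; ring
    · exact Integrable.mul_bdd (c := A) (((hGi k).sub hg).bdd_mul hm (.of_forall fun x => hC _))
        hη.continuous.aestronglyMeasurable (.of_forall hA)
    · exact Integrable.mul_bdd (c := A) (hg.bdd_mul hm (.of_forall fun x => hC _))
        hη.continuous.aestronglyMeasurable (.of_forall hA)
  simp_rw [hparts] at hl
  exact tendsto_nhds_unique hl hr.neg

variable {Ω : Set E} {u g : E → ℝ} {v : E}

omit [FiniteDimensional ℝ E] [μ.IsAddHaarMeasure] [NormedSpace ℝ E] in
lemma MeasureTheory.LocallyIntegrableOn.integrable_mul_of_tsupport_subset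
    (hu : LocallyIntegrableOn u Ω μ) {ψ : E → ℝ} (hψ : Continuous ψ) (hc : HasCompactSupport ψ)
    (hs : tsupport ψ ⊆ Ω) : Integrable (fun x => u x * ψ x) μ := by
  obtain ⟨A, hA⟩ := hψ.bounded_above_of_compact_support hc
  have h1 : IntegrableOn (fun x => u x * ψ x) (tsupport ψ) μ :=
    Integrable.mul_bdd (c := A) (hu.integrableOn_compact_subset hs hc)
      hψ.aestronglyMeasurable (.of_forall hA)
  refine (integrableOn_iff_integrable_of_support_subset fun x hx => subset_tsupport ψ ?_).1 h1
  exact right_ne_zero_of_mul hx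

omit [NormedSpace ℝ E] [FiniteDimensional ℝ E] [BorelSpace E] [μ.IsAddHaarMeasure] in
lemma setIntegral_mul_eq_integral {ψ : E → ℝ} (hs : tsupport ψ ⊆ Ω) :
    ∫ x in Ω, u x * ψ x ∂μ = ∫ x, u x * ψ x ∂μ :=
  setIntegral_eq_integral_of_forall_compl_eq_zero fun x hx => by
    rw [image_eq_zero_of_notMem_tsupport fun h => hx (hs h), mul_zero]

/-- The chain rule for weak derivatives. -/
lemma IsWeakLineDeriv.comp (hΩ : IsOpen Ω) (hu : LocallyIntegrableOn u Ω μ)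
    (hg : LocallyIntegrableOn g Ω μ) (h : IsWeakLineDeriv μ Ω v u g) {f : ℝ → ℝ}
    (hf : ContDiff ℝ 1 f) {C : ℝ} (hC : ∀ t, |deriv f t| ≤ C) :
    IsWeakLineDeriv μ Ω v (fun x => f (u x)) (fun x => deriv f (u x) * g x) := by
  intro η hη hηc hηΩ
  -- Localization: with a cutoff `χ` that is `1` near the support of `η`, the product `u χ` is
  -- integrable on the whole space and has weak derivative `g χ + u ∂χ`, while `η` cannot
  -- distinguish it from `u`.
  obtain ⟨K, hK, hηK, hKΩ⟩ := exists_compact_between hηc.isCompact hΩ hηΩ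
  obtain ⟨χ', hχ1, hχ0, -⟩ := exists_contMDiffMap_one_nhds_of_subset_interior
    (modelWithCornersSelf ℝ E) (n := (⊤ : ℕ∞)) (isClosed_tsupport η) hηK
  set χ : E → ℝ := fun x => χ' x
  have hχ : ContDiff ℝ ∞ χ := χ'.contMDiff.contDiff
  have hχK : tsupport χ ⊆ K := closure_minimal (fun x hx => by_contra fun h => hx (hχ0 x h))
    hK.isClosed
  have hχc : HasCompactSupport χ := hK.of_isClosed_subset (isClosed_tsupport _) hχK
  have hχd : Continuous fun x => fderiv ℝ χ x v :=
    (hχ.continuous_fderiv (by simp)).clm_apply continuous_const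
  have hχdc : HasCompactSupport fun x => fderiv ℝ χ x v := hχc.fderiv_apply ℝ v
  have hχds : tsupport (fun x => fderiv ℝ χ x v) ⊆ tsupport χ := tsupport_fderiv_apply_subset ℝ v
  have hχΩ := hχK.trans hKΩ
  have hU : Integrable (fun x => u x * χ x) μ :=
    hu.integrable_mul_of_tsupport_subset hχ.continuous hχc hχΩ
  have hG1 : Integrable (fun x => g x * χ x) μ :=
    hg.integrable_mul_of_tsupport_subset hχ.continuous hχc hχΩ
  have hG2 : Integrable (fun x => u x * fderiv ℝ χ x v) μ :=
    hu.integrable_mul_of_tsupport_subset hχd hχdc (hχds.trans hχΩ)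
  have hw : IsWeakLineDeriv μ Set.univ v (fun x => u x * χ x)
      (fun x => g x * χ x + u x * fderiv ℝ χ x v) := by
    intro φ hφ hφc _
    simp only [Measure.restrict_univ]
    have hφd : Continuous fun x => fderiv ℝ φ x v :=
      (hφ.continuous_fderiv (by simp)).clm_apply continuous_const
    have hsub : ∀ {ψ : E → ℝ}, tsupport (fun x => χ x * ψ x) ⊆ Ω := fun {ψ} =>
      (tsupport_mul_subset_left (f := χ) (g := ψ)).trans hχΩ
    have hsub' : ∀ {ψ : E → ℝ}, tsupport (fun x => fderiv ℝ χ x v * ψ x) ⊆ Ω := fun {ψ} =>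
      (tsupport_mul_subset_left (f := fun x => fderiv ℝ χ x v) (g := ψ)).trans (hχds.trans hχΩ)
    have h1 := h (fun x => χ x * φ x) (hχ.mul hφ) hχc.mul_right hsub
    rw [setIntegral_mul_eq_integral hsub,
      setIntegral_mul_eq_integral ((tsupport_fderiv_apply_subset ℝ v).trans hsub)] at h1
    have hd : ∀ x, fderiv ℝ (fun x => χ x * φ x) x v = χ x * fderiv ℝ φ x v +
        fderiv ℝ χ x v * φ x := by
      intro x
      rw [fderiv_fun_mul ((hχ.differentiable (by simp)) x) ((hφ.differentiable (by simp)) x)]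
      simp only [add_apply, smul_apply, smul_eq_mul]
      ring
    have hi1 : Integrable (fun x => u x * (χ x * fderiv ℝ φ x v)) μ :=
      hu.integrable_mul_of_tsupport_subset (hχ.continuous.mul hφd) hχc.mul_right hsub
    have hi2 : Integrable (fun x => u x * (fderiv ℝ χ x v * φ x)) μ :=
      hu.integrable_mul_of_tsupport_subset (hχd.mul hφ.continuous) hχdc.mul_right hsub'
    have hi3 : Integrable (fun x => g x * (χ x * φ x)) μ :=
      hg.integrable_mul_of_tsupport_subset (hχ.continuous.mul hφ.continuous) hχc.mul_right hsub
    simp_rw [hd, mul_add] at h1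
    rw [integral_add hi1 hi2] at h1
    simp_rw [add_mul, mul_assoc]
    rw [integral_add hi3 hi2]
    linarith
  have hmain := hw.comp_of_integrable hU (hG1.add hG2) hf hC η hη hηc (Set.subset_univ _)
  simp only [Measure.restrict_univ] at hmain
  rw [setIntegral_mul_eq_integral hηΩ,
    setIntegral_mul_eq_integral ((tsupport_fderiv_apply_subset ℝ v).trans hηΩ)]
  have hnear : ∀ x ∈ tsupport η, χ =ᶠ[𝓝 x] fun _ => 1 := fun x hx =>
    (eventually_nhdsSet_iff_forall.1 hχ1) x hx
  convert hmain using 2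
  · ext x
    by_cases hx : x ∈ tsupport η
    · rw [(hnear x hx).eq_of_nhds, mul_one]
    · rw [image_eq_zero_of_notMem_tsupport (f := fun x => fderiv ℝ η x v)
        fun h => hx (tsupport_fderiv_apply_subset ℝ v h), mul_zero, mul_zero]
  · congr with x
    by_cases hx : x ∈ tsupport η
    · simp only [Pi.add_apply]
      rw [(hnear x hx).eq_of_nhds, mul_one, mul_one, (hnear x hx).fderiv_eq]
      simp
    · rw [image_eq_zero_of_notMem_tsupport hx, mul_zero, mul_zero]

/-- The chain rule for weak derivatives, for pointwise limits of `C¹` functions. -/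
lemma IsWeakLineDeriv.comp_of_tendsto (hΩ : IsOpen Ω) (hu : LocallyIntegrableOn u Ω μ)
    (hg : LocallyIntegrableOn g Ω μ) (h : IsWeakLineDeriv μ Ω v u g) {f : ℕ → ℝ → ℝ} {F G : ℝ → ℝ}
    (hf : ∀ k, ContDiff ℝ 1 (f k)) (hC : ∀ k t, |deriv (f k) t| ≤ 1) (h0 : ∀ k, |f k 0| ≤ 1)
    (hF : ∀ t, Tendsto (fun k => f k t) atTop (𝓝 (F t)))
    (hG : ∀ t, Tendsto (fun k => deriv (f k) t) atTop (𝓝 (G t))) :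
    IsWeakLineDeriv μ Ω v (fun x => F (u x)) (fun x => G (u x) * g x) := by
  intro η hη hηc hηΩ
  have hηd : Continuous fun x => fderiv ℝ η x v :=
    (hη.continuous_fderiv (by simp)).clm_apply continuous_const
  have hum : AEStronglyMeasurable u (μ.restrict Ω) := hu.aestronglyMeasurable
  have hgm : AEStronglyMeasurable g (μ.restrict Ω) := hg.aestronglyMeasurable
  have hb : ∀ k t, |f k t| ≤ |t| + 1 := by
    intro k t
    have h1 := Convex.norm_image_sub_le_of_norm_deriv_le (f := f k) (s := Set.univ) (C := 1) (x := 0)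
      (y := t) (fun x _ => ((hf k).differentiable one_ne_zero) x) (fun x _ => hC k x) convex_univ
      trivial trivial
    simp only [Real.norm_eq_abs, sub_zero, one_mul] at h1
    calc |f k t| = |(f k t - f k 0) + f k 0| := by ring_nf
      _ ≤ |f k t - f k 0| + |f k 0| := abs_add_le _ _
      _ ≤ |t| + 1 := add_le_add h1 (h0 k)
  have hl : Tendsto (fun k => ∫ x in Ω, f k (u x) * fderiv ℝ η x v ∂μ) atTop
      (𝓝 (∫ x in Ω, F (u x) * fderiv ℝ η x v ∂μ)) := by
    refine tendsto_integral_of_dominated_convergence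
      (fun x => ‖u x * fderiv ℝ η x v‖ + ‖fderiv ℝ η x v‖) (fun k => ?_) ?_ (fun k => ?_) ?_
    · exact ((hf k).continuous.comp_aestronglyMeasurable hum).mul hηd.aestronglyMeasurable
    · refine Integrable.add ?_ ?_
      · exact (hu.integrable_mul_of_tsupport_subset hηd (hηc.fderiv_apply ℝ v)
          ((tsupport_fderiv_apply_subset ℝ v).trans hηΩ)).norm.integrableOn
      · exact (hηd.integrable_of_hasCompactSupport (hηc.fderiv_apply ℝ v)).norm.integrableOn
    · refine .of_forall fun x => ?_
      rw [norm_mul, norm_mul]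
      calc _ ≤ (|u x| + 1) * ‖fderiv ℝ η x v‖ :=
            mul_le_mul_of_nonneg_right (hb k _) (norm_nonneg _)
        _ = _ := by rw [Real.norm_eq_abs (u x)]; ring
    · exact .of_forall fun x => (hF _).mul_const _
  have hr : Tendsto (fun k => ∫ x in Ω, deriv (f k) (u x) * g x * η x ∂μ) atTop
      (𝓝 (∫ x in Ω, G (u x) * g x * η x ∂μ)) := by
    refine tendsto_integral_of_dominated_convergence
      (fun x => ‖g x * η x‖) (fun k => ?_) ?_ (fun k => ?_) ?_
    · exact ((((hf k).continuous_deriv le_rfl).comp_aestronglyMeasurable hum).mul hgm).mul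
        hη.continuous.aestronglyMeasurable
    · exact (hg.integrable_mul_of_tsupport_subset hη.continuous hηc hηΩ).norm.integrableOn
    · refine .of_forall fun x => ?_
      rw [mul_assoc, norm_mul]
      exact mul_le_of_le_one_left (norm_nonneg _) (hC k _)
    · exact .of_forall fun x => ((hG _).mul_const _).mul_const _
  have hk : ∀ k, ∫ x in Ω, f k (u x) * fderiv ℝ η x v ∂μ =
      - ∫ x in Ω, deriv (f k) (u x) * g x * η x ∂μ := fun k =>
    h.comp hΩ hu hg (hf k) (hC k) η hη hηc hηΩ
  simp_rw [hk] at hl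
  exact tendsto_nhds_unique hl hr.neg

omit [BorelSpace E] [μ.IsAddHaarMeasure] in
lemma MeasureTheory.LocallyIntegrableOn.bdd_mul (hΩ : IsOpen Ω) (hg : LocallyIntegrableOn g Ω μ)
    {m : E → ℝ} (hm : AEStronglyMeasurable m (μ.restrict Ω)) {C : ℝ} (hC : ∀ x, ‖m x‖ ≤ C) :
    LocallyIntegrableOn (fun x => m x * g x) Ω μ := by
  have := FiniteDimensional.proper ℝ E
  rw [locallyIntegrableOn_iff hΩ.isLocallyClosed] at hg ⊢
  exact fun k hk hkc => Integrable.bdd_mul (c := C) (hg k hk hkc) (hm.mono_set hk) (.of_forall hC)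

/-- The weak derivative of the absolute value. -/
lemma IsWeakLineDeriv.abs (hΩ : IsOpen Ω) (hu : LocallyIntegrableOn u Ω μ)
    (hg : LocallyIntegrableOn g Ω μ) (h : IsWeakLineDeriv μ Ω v u g) :
    IsWeakLineDeriv μ Ω v (fun x => |u x|) (fun x => (SignType.sign (u x) : ℝ) * g x) := by
  set ε : ℕ → ℝ := fun k => 1 / ((k : ℝ) + 1)
  have hε : ∀ k, 0 < ε k := fun k => by positivity
  have hε1 : ∀ k, ε k ≤ 1 := fun k => by
    rw [div_le_one (by positivity)]; linarith [(Nat.cast_nonneg k : (0 : ℝ) ≤ k)]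
  have hε0 : Tendsto ε atTop (𝓝 0) := tendsto_one_div_add_atTop_nhds_zero_nat
  have hpos : ∀ k t, 0 < t ^ 2 + ε k ^ 2 := fun k t => by have := hε k; positivity
  have hder : ∀ k t, HasDerivAt (fun t => √(t ^ 2 + ε k ^ 2)) (t / √(t ^ 2 + ε k ^ 2)) t := by
    intro k t
    have := ((hasDerivAt_pow 2 t).add_const (ε k ^ 2)).sqrt (hpos k t).ne'
    convert this using 1
    norm_num
    field_simp
  -- The smooth functions `√(t² + ε²)` tend to `|t|`, and their derivatives tend to the sign of `t`,
  -- with the value `0` at `0`.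
  refine h.comp_of_tendsto hΩ hu hg (f := fun k t => √(t ^ 2 + ε k ^ 2))
    (G := fun t => (SignType.sign t : ℝ)) (fun k => ?_) (fun k t => ?_) (fun k => ?_)
    (fun t => ?_) (fun t => ?_)
  · exact ContDiff.sqrt (by fun_prop) fun t => (hpos k t).ne'
  · rw [(hder k t).deriv, abs_div, abs_of_pos (Real.sqrt_pos.2 (hpos k t)),
      div_le_one (Real.sqrt_pos.2 (hpos k t))]
    exact Real.abs_le_sqrt (by nlinarith [hε k])
  · simpa [Real.sqrt_sq (hε k).le, abs_of_pos (hε k)] using hε1 k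
  · have : Tendsto (fun k => √(t ^ 2 + ε k ^ 2)) atTop (𝓝 √(t ^ 2 + 0 ^ 2)) :=
      (tendsto_const_nhds.add (hε0.pow 2)).sqrt
    simpa [Real.sqrt_sq_eq_abs] using this
  · simp_rw [(hder _ t).deriv]
    rcases eq_or_ne t 0 with rfl | ht
    · simp
    · have : Tendsto (fun k => t / √(t ^ 2 + ε k ^ 2)) atTop (𝓝 (t / √(t ^ 2 + 0 ^ 2))) :=
        tendsto_const_nhds.div ((tendsto_const_nhds.add (hε0.pow 2)).sqrt) (by
          simpa [Real.sqrt_sq_eq_abs] using ht)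
      convert this using 2
      rw [zero_pow two_ne_zero, add_zero, Real.sqrt_sq_eq_abs]
      rcases lt_or_gt_of_ne ht with h | h
      · rw [sign_neg h, abs_of_neg h, div_neg, div_self ht]; simp
      · rw [sign_pos h, abs_of_pos h, div_self ht]; simp

/-- The weak derivative of a function vanishes almost everywhere on its zero set. -/
lemma IsWeakLineDeriv.ae_eq_zero (hΩ : IsOpen Ω) (hu : LocallyIntegrableOn u Ω μ)
    (hg : LocallyIntegrableOn g Ω μ) (h : IsWeakLineDeriv μ Ω v u g) :
    ∀ᵐ x ∂(μ.restrict Ω), u x = 0 → g x = 0 := by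
  set ε : ℕ → ℝ := fun k => 1 / ((k : ℝ) + 1)
  have hε : ∀ k, 0 < ε k := fun k => by positivity
  have hε0 : Tendsto ε atTop (𝓝 0) := tendsto_one_div_add_atTop_nhds_zero_nat
  have hder : ∀ k t, HasDerivAt (fun t => ε k * Real.arctan (t / ε k))
      (1 / (1 + (t / ε k) ^ 2)) t := by
    intro k t
    have := ((((hasDerivAt_id' t).div_const (ε k)).arctan).const_mul (ε k))
    have h1 : ε k * (1 / (1 + (t / ε k) ^ 2) * (1 / ε k)) = 1 / (1 + (t / ε k) ^ 2) := by
      rw [mul_comm, mul_assoc, one_div_mul_cancel (hε k).ne', mul_one]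
    rwa [h1] at this
  -- The functions `ε arctan(t / ε)` tend to `0`, but their derivatives tend to the indicator of
  -- `{0}`. Thus `g` restricted to `{u = 0}` is a weak derivative of the zero function and vanishes
  -- almost everywhere.
  have hw := h.comp_of_tendsto hΩ hu hg (f := fun k t => ε k * Real.arctan (t / ε k))
    (F := fun _ => 0) (G := fun t => if t = 0 then 1 else 0) (fun k => ?_) (fun k t => ?_)
    (fun k => by simp) (fun t => ?_) (fun t => ?_)
  · have hum : AEStronglyMeasurable u (μ.restrict Ω) := hu.aestronglyMeasurable
    have hloc : LocallyIntegrableOn (fun x => (if u x = 0 then 1 else 0) * g x) Ω μ := by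
      refine hg.bdd_mul hΩ (C := 1) ?_ (fun x => by split_ifs <;> simp)
      have : Measurable fun t : ℝ => if t = 0 then (1 : ℝ) else 0 :=
        Measurable.ite (measurableSet_singleton 0) measurable_const measurable_const
      exact (this.comp_aemeasurable hum.aemeasurable).aestronglyMeasurable
    have := hΩ.ae_eq_zero_of_integral_contDiff_smul_eq_zero hloc fun η hη hηc hηΩ => ?_
    · rw [ae_restrict_iff' hΩ.measurableSet]
      filter_upwards [this] with x hx hxΩ hux
      simpa [hux] using hx hxΩ
    · have h1 := hw η hη hηc hηΩ
      simp only [zero_mul, integral_zero, zero_eq_neg] at h1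
      rw [setIntegral_mul_eq_integral hηΩ] at h1
      simpa only [smul_eq_mul, mul_comm] using h1
  · exact contDiff_const.mul (Real.contDiff_arctan.comp (contDiff_id.div_const _))
  · rw [(hder k t).deriv, abs_of_nonneg (by positivity), div_le_one (by positivity)]
    nlinarith [sq_nonneg (t / ε k)]
  · refine squeeze_zero_norm (a := fun k => ε k * (Real.pi / 2)) (fun k => ?_) (by
      simpa using hε0.mul_const (Real.pi / 2))
    rw [norm_mul, Real.norm_of_nonneg (hε k).le]
    exact mul_le_mul_of_nonneg_left (abs_le.2 ⟨(Real.neg_pi_div_two_lt_arctan _).le,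
      (Real.arctan_lt_pi_div_two _).le⟩) (hε k).le
  · simp_rw [(hder _ t).deriv]
    rcases eq_or_ne t 0 with rfl | ht
    · simp
    · rw [if_neg ht]
      have h2 : Tendsto (fun k => ε k ^ 2 / (ε k ^ 2 + t ^ 2)) atTop (𝓝 (0 ^ 2 / (0 ^ 2 + t ^ 2))) :=
        (hε0.pow 2).div ((hε0.pow 2).add_const _) (by simpa using ht)
      rw [zero_pow two_ne_zero, zero_div] at h2
      refine h2.congr fun k => ?_
      have := (hε k).ne'
      field_simp

end Mollification


/-! ### Calculus of weak differentials -/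

section LineDerivAlgebra

variable {E : Type*} [NormedAddCommGroup E] [NormedSpace ℝ E]
  [MeasurableSpace E] [BorelSpace E] {μ : Measure E} {Ω : Set E} {u₁ u₂ g₁ g₂ : E → ℝ} {v : E}

lemma IsWeakLineDeriv.add (hu₁ : LocallyIntegrableOn u₁ Ω μ)
    (hu₂ : LocallyIntegrableOn u₂ Ω μ) (hg₁ : LocallyIntegrableOn g₁ Ω μ)
    (hg₂ : LocallyIntegrableOn g₂ Ω μ) (h₁ : IsWeakLineDeriv μ Ω v u₁ g₁)
    (h₂ : IsWeakLineDeriv μ Ω v u₂ g₂) :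
    IsWeakLineDeriv μ Ω v (fun x => u₁ x + u₂ x) (fun x => g₁ x + g₂ x) := by
  intro η hη hηc hηΩ
  have hηd : Continuous fun x => fderiv ℝ η x v :=
    (hη.continuous_fderiv (by simp)).clm_apply continuous_const
  have hs := (tsupport_fderiv_apply_subset ℝ v).trans hηΩ
  have hc := hηc.fderiv_apply ℝ v
  simp_rw [add_mul]
  rw [integral_add (hu₁.integrable_mul_of_tsupport_subset hηd hc hs).integrableOn
    (hu₂.integrable_mul_of_tsupport_subset hηd hc hs).integrableOn,
    integral_add (hg₁.integrable_mul_of_tsupport_subset hη.continuous hηc hηΩ).integrableOn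
    (hg₂.integrable_mul_of_tsupport_subset hη.continuous hηc hηΩ).integrableOn,
    h₁ η hη hηc hηΩ, h₂ η hη hηc hηΩ, neg_add]

lemma IsWeakLineDeriv.const_mul (c : ℝ) (h₁ : IsWeakLineDeriv μ Ω v u₁ g₁) :
    IsWeakLineDeriv μ Ω v (fun x => c * u₁ x) (fun x => c * g₁ x) := by
  intro η hη hηc hηΩ
  simp_rw [mul_assoc]
  rw [integral_const_mul, integral_const_mul, h₁ η hη hηc hηΩ, mul_neg]

end LineDerivAlgebra

section WeakDifferential

open Manifold Metric Set

variable {n : ℕ} {M : Type*} [EMetricSpace M] [MeasurableSpace M] [BorelSpace M] 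
  [ChartedSpace (EuclideanSpace ℝ (Fin (n + 1))) M]
  [RiemannianBundle (fun x : M => TangentSpace (𝓡 (n + 1)) x)]
  {u v : M → ℝ} {α β : (x : M) → TangentSpace (𝓡 (n + 1)) x →L[ℝ] ℝ}

namespace AllenCahn.IsWeakDifferential

lemma isWeakLineDeriv (h : IsWeakDifferential n u α)
    {e : OpenPartialHomeomorph M (EuclideanSpace ℝ (Fin (n + 1)))}
    (he : e ∈ atlas (EuclideanSpace ℝ (Fin (n + 1))) M) (w : EuclideanSpace ℝ (Fin (n + 1))) :
    IsWeakLineDeriv volume e.target w (fun y => u (e.symm y))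
      (fun y => α (e.symm y) (mfderiv (𝓡 (n + 1)) (𝓡 (n + 1)) e.symm y w)) :=
  fun η hη hηc hηΩ => h.parts e he η hη hηc hηΩ w

lemma add (h : IsWeakDifferential n u α) (h' : IsWeakDifferential n v β) :
    IsWeakDifferential n (fun x => u x + v x) (fun x => α x + β x) where
  locInt_fun e he := (h.locInt_fun e he).add (h'.locInt_fun e he)
  locInt_diff e he w := (h.locInt_diff e he w).add (h'.locInt_diff e he w)
  parts e he η hη hηc hηΩ w :=
    (h.isWeakLineDeriv he w).add (h.locInt_fun e he) (h'.locInt_fun e he) (h.locInt_diff e he w)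
      (h'.locInt_diff e he w) (h'.isWeakLineDeriv he w) η hη hηc hηΩ

lemma const_smul (h : IsWeakDifferential n u α) (c : ℝ) :
    IsWeakDifferential n (fun x => c * u x) (fun x => c • α x) where
  locInt_fun e he x hx :=
    let ⟨t, ht, hi⟩ := h.locInt_fun e he x hx
    ⟨t, ht, hi.const_mul c⟩
  locInt_diff e he w x hx :=
    let ⟨t, ht, hi⟩ := h.locInt_diff e he w x hx
    ⟨t, ht, hi.const_mul c⟩
  parts _ he η hη hηc hηΩ w := (h.isWeakLineDeriv he w).const_mul c η hη hηc hηΩ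

lemma sub (h : IsWeakDifferential n u α) (h' : IsWeakDifferential n v β) :
    IsWeakDifferential n (fun x => u x - v x) (fun x => α x - β x) := by
  have := h.add (h'.const_smul (-1))
  have h1 : (fun x => α x - β x) = fun x => α x + (-1 : ℝ) • β x := by
    ext1 x
    rw [sub_eq_add_neg]
    congr 1
    ext w
    simp
  have h2 : (fun x => u x - v x) = fun x => u x + -1 * v x := by
    ext1 x
    ring
  rw [h1, h2]
  exact this

lemma abs [IsManifold (𝓡 (n + 1)) ∞ M] (h : IsWeakDifferential n u α) :
    IsWeakDifferential n (fun x => |u x|) (fun x => (SignType.sign (u x) : ℝ) • α x) where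
  locInt_fun e he := (h.locInt_fun e he).norm
  locInt_diff e he w := by
    refine (h.locInt_diff e he w).bdd_mul e.open_target (C := 1) ?_ fun y => ?_
    · have : Measurable fun t : ℝ => ((SignType.sign t : SignType) : ℝ) := by
        have h0 : (fun t : ℝ => ((SignType.sign t : SignType) : ℝ)) =
            fun t => if 0 < t then 1 else if t < 0 then -1 else 0 := by
          ext t
          rcases lt_trichotomy t 0 with h | h | h
          · simp [h, h.not_gt]
          · simp [h]
          · simp [h]
        rw [h0]
        exact Measurable.ite measurableSet_Ioi measurable_const
          (Measurable.ite measurableSet_Iio measurable_const measurable_const)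
      exact (this.comp_aemeasurable
        (h.locInt_fun e he).aestronglyMeasurable.aemeasurable).aestronglyMeasurable
    · rcases lt_trichotomy (u (e.symm y)) 0 with h | h | h <;> simp [h]
  parts e he η hη hηc hηΩ w :=
    (h.isWeakLineDeriv he w).abs e.open_target (h.locInt_fun e he) (h.locInt_diff e he w) η hη hηc hηΩ

section

variable [IsManifold (𝓡 (n + 1)) ∞ M]
  [IsContMDiffRiemannianBundle (𝓡 (n + 1)) ∞ (EuclideanSpace ℝ (Fin (n + 1)))
    (fun x : M => TangentSpace (𝓡 (n + 1)) x)]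
  [IsRiemannianManifold (𝓡 (n + 1)) M] [CompactSpace M]

/-- The definition speaks of functions in charts, whereas elements of `H¹` are classes modulo null
sets of `M`; `ae_source_iff` reconciles the two. -/
lemma congr_ae (h : IsWeakDifferential n u α) (huv : u =ᵐ[vol n M] v) :
    IsWeakDifferential n v α := by
  have hc : ∀ e ∈ atlas (EuclideanSpace ℝ (Fin (n + 1))) M,
      (fun y => u (e.symm y)) =ᵐ[volume.restrict e.target] fun y => v (e.symm y) := fun e he =>
    (ae_source_iff he (p := fun x => u x = v x)).1 (huv.mono fun x hx _ => hx)
  refine ⟨fun e he => ?_, h.locInt_diff, fun e he η hη hηc hηΩ w => ?_⟩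
  · have hl := h.locInt_fun e he
    rw [locallyIntegrableOn_iff e.open_target.isLocallyClosed] at hl ⊢
    exact fun k hk hkc => (hl k hk hkc).congr (ae_restrict_of_ae_restrict_of_subset hk (hc e he))
  · rw [← h.parts e he η hη hηc hηΩ w]
    refine integral_congr_ae ?_
    filter_upwards [hc e he] with y hy
    rw [hy]

/-- A weak differential vanishes almost everywhere on the zero set of the function. -/
lemma ae_eq_zero (h : IsWeakDifferential n u α) : ∀ᵐ x ∂(vol n M), u x = 0 → α x = 0 := by
  refine ae_of_forall_chart fun e he => ?_
  -- Finitely many coordinate directions determine the covector, so a single exceptional null set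
  -- suffices.
  have h1 : ∀ᵐ y ∂(volume.restrict e.target), ∀ k : Fin (n + 1), u (e.symm y) = 0 →
      α (e.symm y) (mfderiv (𝓡 (n + 1)) (𝓡 (n + 1)) e.symm y
        (EuclideanSpace.basisFun (Fin (n + 1)) ℝ k)) = 0 := by
    rw [ae_all_iff]
    exact fun k => (h.isWeakLineDeriv he _).ae_eq_zero e.open_target (h.locInt_fun e he)
      (h.locInt_diff e he _)
  filter_upwards [h1, ae_restrict_mem e.open_target.measurableSet] with y hy hyt huy
  have hsurj : Function.Surjective (mfderiv (𝓡 (n + 1)) (𝓡 (n + 1)) e.symm y) :=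
    (mdifferentiable_of_mem_atlas (I := 𝓡 (n + 1)) he).symm.mfderiv_surjective hyt
  have h2 : ((α (e.symm y)).comp (mfderiv (𝓡 (n + 1)) (𝓡 (n + 1)) e.symm y)).toLinearMap = 0 :=
    (EuclideanSpace.basisFun (Fin (n + 1)) ℝ).toBasis.ext fun k => by
      rw [OrthonormalBasis.coe_toBasis]
      exact hy k huy
  ext w
  obtain ⟨z, rfl⟩ := hsurj w
  exact LinearMap.congr_fun h2 z

/-- Weak differentials of two functions agree almost everywhere where the functions agree. -/
lemma ae_eq_of_eq (h : IsWeakDifferential n u α) (h' : IsWeakDifferential n v β) :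
    ∀ᵐ x ∂(vol n M), u x = v x → α x = β x := by
  filter_upwards [(h.sub h').ae_eq_zero] with x hx huv
  exact sub_eq_zero.1 (hx (sub_eq_zero.2 huv))

end

end AllenCahn.IsWeakDifferential

end WeakDifferential


/-! ### The Sobolev topology -/

section Sobolev

open Manifold Metric Set

variable {n : ℕ} {M : Type*} [EMetricSpace M] [MeasurableSpace M] [BorelSpace M]
  [ChartedSpace (EuclideanSpace ℝ (Fin (n + 1))) M] [IsManifold (𝓡 (n + 1)) ∞ M]
  [RiemannianBundle (fun x : M => TangentSpace (𝓡 (n + 1)) x)]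
  [IsContMDiffRiemannianBundle (𝓡 (n + 1)) ∞ (EuclideanSpace ℝ (Fin (n + 1)))
    (fun x : M => TangentSpace (𝓡 (n + 1)) x)]
  [IsRiemannianManifold (𝓡 (n + 1)) M] [CompactSpace M]
  {u v : M → ℝ} {α β : (x : M) → TangentSpace (𝓡 (n + 1)) x →L[ℝ] ℝ}

namespace AllenCahn

variable (n) in
/-- The square of the Sobolev norm of a function `u` with differential `α`. -/
noncomputable def sobolevEnergy (u : M → ℝ) (α : (x : M) → TangentSpace (𝓡 (n + 1)) x →L[ℝ] ℝ) : ℝ≥0∞ :=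
  ∫⁻ x, ENNReal.ofReal (u x ^ 2 + ‖α x‖ ^ 2) ∂(vol n M)

lemma IsWeakDifferential.aemeasurable_fun (h : IsWeakDifferential n u α) :
    AEMeasurable u (vol n M) :=
  aemeasurable_vol_of_forall_chart fun e he =>
    (h.locInt_fun e he).aestronglyMeasurable.aemeasurable

lemma IsWeakDifferential.aemeasurable_sobolev (h : IsWeakDifferential n u α) :
    AEMeasurable (fun x => ENNReal.ofReal (u x ^ 2 + ‖α x‖ ^ 2)) (vol n M) :=
  ((h.aemeasurable_fun.pow_const 2).add (h.aemeasurable_norm.pow_const 2)).ennreal_ofReal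

lemma sobolevEnergy_congr (huv : u =ᵐ[vol n M] v) :
    sobolevEnergy n u α = sobolevEnergy n v α := by
  refine lintegral_congr_ae ?_
  filter_upwards [huv] with x hx
  rw [hx]

/-- From `(a + b)² ≤ 2a² + 2b²`. This weak triangle inequality for squares replaces Minkowski's
inequality throughout. -/
lemma sobolevEnergy_add_le (h : IsWeakDifferential n u α) :
    sobolevEnergy n (fun x => u x + v x) (fun x => α x + β x) ≤
      2 * sobolevEnergy n u α + 2 * sobolevEnergy n v β := by
  have h2 : (2 : ℝ≥0∞) ≠ ⊤ := by simp
  rw [sobolevEnergy, sobolevEnergy, sobolevEnergy, ← lintegral_const_mul' _ _ h2,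
    ← lintegral_const_mul' _ _ h2, ← lintegral_add_left' (h.aemeasurable_sobolev.const_mul 2)]
  refine lintegral_mono fun x => ?_
  have h3 := (α x).opNorm_add_le (β x)
  have h4 := (α x + β x).opNorm_nonneg
  have key : ∀ a b c : ℝ, 0 ≤ b → 0 ≤ c → a ≤ 2 * b + 2 * c →
      ENNReal.ofReal a ≤ 2 * ENNReal.ofReal b + 2 * ENNReal.ofReal c := by
    intro a b c hb hc h
    have h5 : (2 : ℝ≥0∞) = ENNReal.ofReal 2 := by simp
    rw [h5, ← ENNReal.ofReal_mul (by norm_num), ← ENNReal.ofReal_mul (by norm_num),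
      ← ENNReal.ofReal_add (by positivity) (by positivity)]
    exact ENNReal.ofReal_le_ofReal h
  refine key _ _ _ (by positivity) (by positivity) ?_
  nlinarith [sq_nonneg (u x - v x), sq_nonneg (‖α x‖ - ‖β x‖)]

lemma sobolevEnergy_const_smul_le (c : ℝ) :
    sobolevEnergy n (fun x => c * u x) (fun x => c • α x) ≤
      ENNReal.ofReal (c ^ 2) * sobolevEnergy n u α := by
  rw [sobolevEnergy, sobolevEnergy, ← lintegral_const_mul' _ _ ENNReal.ofReal_ne_top]
  refine lintegral_mono fun x => ?_
  have h3 : ‖c • α x‖ ≤ |c| * ‖α x‖ := (α x).opNorm_smul_le c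
  have h4 := pow_le_pow_left₀ (c • α x).opNorm_nonneg h3 2
  rw [mul_pow, sq_abs] at h4
  rw [← ENNReal.ofReal_mul (sq_nonneg c)]
  refine ENNReal.ofReal_le_ofReal ?_
  nlinarith

variable (n) in
/-- `w` has a weak differential and its Sobolev norm squared is smaller than `δ`. -/
def SobolevLt (w : M → ℝ) (δ : ℝ≥0∞) : Prop :=
  ∃ α, IsWeakDifferential n w α ∧ sobolevEnergy n w α < δ

lemma SobolevLt.congr {δ : ℝ≥0∞} (h : SobolevLt n u δ) (huv : u =ᵐ[vol n M] v) :
    SobolevLt n v δ := by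
  obtain ⟨α, hα, h⟩ := h
  exact ⟨α, hα.congr_ae huv, by rwa [← sobolevEnergy_congr huv]⟩

lemma SobolevLt.add {δ δ' : ℝ≥0∞} (h : SobolevLt n u δ) (h' : SobolevLt n v δ') :
    SobolevLt n (fun x => u x + v x) (2 * δ + 2 * δ') := by
  obtain ⟨α, hα, h⟩ := h
  obtain ⟨β, hβ, h'⟩ := h'
  refine ⟨_, hα.add hβ, (sobolevEnergy_add_le hα).trans_lt ?_⟩
  have := fun {a b : ℝ≥0∞} (h : a < b) => ENNReal.mul_lt_mul_right (a := 2) (by simp) (by simp) h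
  exact ENNReal.add_lt_add (this h) (this h')

/-- A strict upper bound on an infimum is an existence statement, so the topology can be handled
with one chosen differential at a time. -/
lemma h1Norm_lt_iff {w : Lp ℝ 2 (vol n M)} {r : ℝ≥0∞} :
    h1Norm n w < r ↔ SobolevLt n (fun x => w x) (r ^ 2) := by
  have : r = (r ^ 2) ^ (1 / 2 : ℝ) := by
    rw [← ENNReal.rpow_natCast, ← ENNReal.rpow_mul]
    norm_num
  rw [h1Norm]
  nth_rewrite 1 [this]
  rw [ENNReal.rpow_lt_rpow_iff (by norm_num), iInf_lt_iff]
  simp only [iInf_lt_iff, exists_prop, SobolevLt, sobolevEnergy]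

namespace H1

/-- The topology is given by its open sets, so balls must still be shown to be neighbourhoods of
their centres. -/
lemma mem_nhds_iff {u : H1 n M} {N : Set (H1 n M)} :
    N ∈ 𝓝 u ↔ ∃ δ : ℝ≥0∞, 0 < δ ∧
      ∀ v : H1 n M, SobolevLt n (fun x => v.1 x - u.1 x) δ → v ∈ N := by
  constructor
  · intro h
    obtain ⟨U, hUN, hU, hu⟩ := _root_.mem_nhds_iff.1 h
    obtain ⟨r, hr, h⟩ := hU u hu
    refine ⟨r ^ 2, by positivity, fun v hv => hUN (h v (h1Norm_lt_iff.2 (hv.congr ?_)))⟩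
    exact (Lp.coeFn_sub v.1 u.1).symm
  · rintro ⟨δ, hδ, h⟩
    -- The set of centres of balls contained in `N` is open: by the weak triangle inequality a ball
    -- of squared radius `δ' / 4` around a point of the `δ' / 4` ball lies in the `δ'` ball, as `2 ·
    -- δ'/4 + 2 · δ'/4 = δ'`.
    refine _root_.mem_nhds_iff.2 ⟨{v | ∃ δ : ℝ≥0∞, 0 < δ ∧
      ∀ w : H1 n M, SobolevLt n (fun x => w.1 x - v.1 x) δ → w ∈ N}, ?_, ?_, δ, hδ, h⟩
    · rintro v ⟨δ', hδ', h'⟩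
      refine h' v ⟨fun _ => 0, ?_, ?_⟩
      · obtain ⟨α, hα, -⟩ := v.2
        convert hα.sub hα using 2
        simp
      · have : sobolevEnergy n (fun x => v.1 x - v.1 x)
            (fun x => (0 : TangentSpace (𝓡 (n + 1)) x →L[ℝ] ℝ)) = 0 := by
          have h0 : ∀ x : M, ‖(0 : TangentSpace (𝓡 (n + 1)) x →L[ℝ] ℝ)‖ = 0 := fun x =>
            ContinuousLinearMap.opNorm_zero
          simp [sobolevEnergy, h0]
        rwa [this]
    · rintro v ⟨δ', hδ', h'⟩
      obtain ⟨r, hr, hr'⟩ : ∃ r : ℝ≥0∞, 0 < r ∧ r ^ 2 = δ' / 4 := by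
        refine ⟨(δ' / 4) ^ (1 / 2 : ℝ), ?_, ?_⟩
        · rcases eq_or_ne δ' ⊤ with rfl | hne
          · simp [ENNReal.top_div]
          · exact ENNReal.rpow_pos (ENNReal.div_pos hδ'.ne' (by simp))
              (ENNReal.div_lt_top hne (by simp)).ne
        · rw [← ENNReal.rpow_natCast, ← ENNReal.rpow_mul]
          norm_num
      refine ⟨r, hr, fun w hw => ⟨δ' / 4, by rw [← hr']; positivity, fun z hz => h' z ?_⟩⟩
      rw [h1Norm_lt_iff, hr'] at hw
      have h4 : 2 * (δ' / 4) + 2 * (δ' / 4) = δ' := by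
        rw [← two_mul, ← mul_assoc]
        norm_num
        exact ENNReal.mul_div_cancel (by simp) (by simp)
      have := hz.add (hw.congr (Lp.coeFn_sub w.1 v.1))
      rw [h4] at this
      simpa using this

lemma tendsto_nhds_iff {ι : Type*} {l : Filter ι} {f : ι → H1 n M} {u : H1 n M} :
    Tendsto f l (𝓝 u) ↔ ∀ δ : ℝ≥0∞, 0 < δ →
      ∀ᶠ i in l, SobolevLt n (fun x => (f i).1 x - u.1 x) δ := by
  constructor
  · intro h δ hδ
    exact h.eventually (mem_nhds_iff.2 ⟨δ, hδ, fun v hv => hv⟩)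
  · intro h N hN
    obtain ⟨δ, hδ, h'⟩ := mem_nhds_iff.1 hN
    exact (h δ hδ).mono fun i hi => h' _ hi

/-- Elements of `H¹` have weak differentials and finite Sobolev norm. -/
lemma exists_isWeakDifferential (u : H1 n M) :
    ∃ α, IsWeakDifferential n (fun x => u.1 x) α ∧ sobolevEnergy n (fun x => u.1 x) α < ⊤ := by
  obtain ⟨α, hα, h⟩ := u.2
  refine ⟨α, hα, ?_⟩
  have h1 : ∀ x, ENNReal.ofReal (u.1 x ^ 2 + ‖α x‖ ^ 2) =
      ENNReal.ofReal (u.1 x ^ 2) + ENNReal.ofReal (‖α x‖ ^ 2) := fun x =>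
    ENNReal.ofReal_add (sq_nonneg _) (sq_nonneg _)
  simp_rw [sobolevEnergy, h1]
  rw [lintegral_add_right' _ (hα.aemeasurable_norm.pow_const 2).ennreal_ofReal]
  refine ENNReal.add_lt_top.2 ⟨?_, h⟩
  have h2 := (Lp.memLp u.1).integrable_sq.lintegral_lt_top
  exact h2

lemma lintegral_lt_top (h : sobolevEnergy n u α < ⊤) :
    ∫⁻ x, ENNReal.ofReal (‖α x‖ ^ 2) ∂(vol n M) < ⊤ := by
  refine lt_of_le_of_lt (lintegral_mono fun x => ?_) h
  exact ENNReal.ofReal_le_ofReal (le_add_of_nonneg_left (sq_nonneg _))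

noncomputable instance : Add (H1 n M) where
  add u v := ⟨u.1 + v.1, by
    obtain ⟨α, hα, h⟩ := u.exists_isWeakDifferential
    obtain ⟨β, hβ, h'⟩ := v.exists_isWeakDifferential
    refine ⟨_, (hα.add hβ).congr_ae (Lp.coeFn_add u.1 v.1).symm, ?_⟩
    refine lintegral_lt_top (n := n) (u := fun x => u.1 x + v.1 x) ?_
    refine (sobolevEnergy_add_le hα).trans_lt (ENNReal.add_lt_top.2 ⟨?_, ?_⟩)
    · exact ENNReal.mul_lt_top (by simp) h
    · exact ENNReal.mul_lt_top (by simp) h'⟩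

noncomputable instance : SMul ℝ (H1 n M) where
  smul c u := ⟨c • u.1, by
    obtain ⟨α, hα, h⟩ := u.exists_isWeakDifferential
    refine ⟨_, (hα.const_smul c).congr_ae (Lp.coeFn_smul c u.1).symm, ?_⟩
    refine lintegral_lt_top (n := n) (u := fun x => c * u.1 x) ?_
    exact (sobolevEnergy_const_smul_le c).trans_lt (ENNReal.mul_lt_top ENNReal.ofReal_lt_top h)⟩

/-- The absolute value of an element of `H¹`. -/
protected noncomputable def abs (u : H1 n M) : H1 n M :=
  ⟨|u.1|, by
    obtain ⟨α, hα, h⟩ := u.2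
    refine ⟨_, hα.abs.congr_ae (Lp.coeFn_abs u.1).symm, lt_of_le_of_lt (lintegral_mono fun x => ?_) h⟩
    refine ENNReal.ofReal_le_ofReal ?_
    have h1 : ‖((SignType.sign (u.1 x) : SignType) : ℝ) • α x‖ ≤
      ‖((SignType.sign (u.1 x) : SignType) : ℝ)‖ * ‖α x‖ := (α x).opNorm_smul_le _
    have h2 : ‖((SignType.sign (u.1 x) : SignType) : ℝ)‖ ≤ 1 := by
      rcases lt_trichotomy (u.1 x) 0 with h | h | h <;> simp [h]
    have h3 := (((SignType.sign (u.1 x) : SignType) : ℝ) • α x).opNorm_nonneg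
    have h4 := (α x).opNorm_nonneg
    exact pow_le_pow_left₀ h3 (h1.trans (mul_le_of_le_one_left h4 h2)) 2⟩

lemma coe_add (u v : H1 n M) : (u + v).1 = u.1 + v.1 := rfl
lemma coe_smul (c : ℝ) (u : H1 n M) : (c • u).1 = c • u.1 := rfl
lemma coe_abs (u : H1 n M) : u.abs.1 = |u.1| := rfl

instance : ContinuousAdd (H1 n M) where
  continuous_add := by
    rw [continuous_iff_continuousAt]
    rintro ⟨u, v⟩
    refine tendsto_nhds_iff.2 fun δ hδ => ?_
    have h4 : 2 * (δ / 4) + 2 * (δ / 4) = δ := by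
      rw [← two_mul, ← mul_assoc]
      norm_num
      exact ENNReal.mul_div_cancel (by simp) (by simp)
    have h5 : 0 < δ / 4 := ENNReal.div_pos hδ.ne' (by simp)
    have h1 := tendsto_nhds_iff.1 (continuous_fst.continuousAt (x := (u, v))) _ h5
    have h2 := tendsto_nhds_iff.1 (continuous_snd.continuousAt (x := (u, v))) _ h5
    filter_upwards [h1, h2] with p hp hp'
    have := hp.add hp'
    rw [h4] at this
    refine this.congr ?_
    filter_upwards [Lp.coeFn_add p.1.1 p.2.1, Lp.coeFn_add u.1 v.1] with x hx hx'
    rw [coe_add, coe_add, hx, hx', Pi.add_apply, Pi.add_apply]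
    ring

lemma _root_.AllenCahn.SobolevLt.const_smul {δ : ℝ≥0∞} (h : SobolevLt n u δ) {c C : ℝ} (hC : c ^ 2 < C) :
    SobolevLt n (fun x => c * u x) (ENNReal.ofReal C * δ) := by
  obtain ⟨α, hα, h⟩ := h
  refine ⟨_, hα.const_smul c, ?_⟩
  refine (sobolevEnergy_const_smul_le c).trans_lt ?_
  exact ENNReal.mul_lt_mul ((ENNReal.ofReal_lt_ofReal_iff ((sq_nonneg c).trans_lt hC)).2 hC) h

lemma _root_.AllenCahn.SobolevLt.mono {δ δ' : ℝ≥0∞} (h : SobolevLt n u δ) (hδ : δ ≤ δ') :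
    SobolevLt n u δ' :=
  let ⟨α, hα, h⟩ := h
  ⟨α, hα, h.trans_le hδ⟩

instance : ContinuousSMul ℝ (H1 n M) where
  continuous_smul := by
    rw [continuous_iff_continuousAt]
    rintro ⟨c, u⟩
    refine tendsto_nhds_iff.2 fun δ hδ => ?_
    obtain ⟨δ₀, hδ₀, hδ₀'⟩ : ∃ δ₀ : ℝ≥0∞, 0 < δ₀ ∧ δ₀ < δ / 4 :=
      exists_between (ENNReal.div_pos hδ.ne' (by simp))
    have h4 : 2 * (δ / 4) + 2 * (δ / 4) = δ := by
      rw [← two_mul, ← mul_assoc]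
      norm_num
      exact ENNReal.mul_div_cancel (by simp) (by simp)
    obtain ⟨α, hα, hu⟩ := u.exists_isWeakDifferential
    set C := c ^ 2 + 1 with hC
    have hC0 : 0 < C := by positivity
    have hlt : 0 < δ₀ / ENNReal.ofReal C := ENNReal.div_pos hδ₀.ne' ENNReal.ofReal_ne_top
    have h1 := tendsto_nhds_iff.1 (continuous_snd.continuousAt (x := (c, u))) _ hlt
    have h2 : ∀ᶠ p : ℝ × H1 n M in 𝓝 (c, u), p.1 ^ 2 < C :=
      (continuous_fst.pow 2).continuousAt.eventually_lt continuousAt_const (by simp [hC])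
    have h3 : ∀ᶠ p : ℝ × H1 n M in 𝓝 (c, u),
        ENNReal.ofReal ((p.1 - c) ^ 2) * sobolevEnergy n (fun x => u.1 x) α < δ / 4 := by
      have h31 : Tendsto (fun p : ℝ × H1 n M => ENNReal.ofReal ((p.1 - c) ^ 2) *
          sobolevEnergy n (fun x => u.1 x) α) (𝓝 (c, u)) (𝓝 (ENNReal.ofReal ((c - c) ^ 2) *
          sobolevEnergy n (fun x => u.1 x) α)) := by
        refine ENNReal.Tendsto.mul_const ?_ (Or.inr hu.ne)
        exact (ENNReal.continuous_ofReal.comp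
          ((continuous_fst.sub continuous_const).pow 2)).continuousAt
      refine h31.eventually_lt_const ?_
      simpa using ENNReal.div_pos hδ.ne' (show (4 : ℝ≥0∞) ≠ ⊤ by simp)
    filter_upwards [h1, h2, h3] with p hp hp2 hp3
    -- The difference of products is `p₁ (p₂ - u) + (p₁ - c) u`.
    have h5 := hp.const_smul hp2
    have h6 : SobolevLt n (fun x => (p.1 - c) * u.1 x) (δ / 4) :=
      ⟨_, hα.const_smul _, (sobolevEnergy_const_smul_le _).trans_lt hp3⟩
    have h7 : ENNReal.ofReal C * (δ₀ / ENNReal.ofReal C) ≤ δ / 4 :=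
      ENNReal.mul_div_le.trans hδ₀'.le
    have := (h5.mono h7).add h6
    rw [h4] at this
    refine this.congr ?_
    filter_upwards [Lp.coeFn_smul p.1 p.2.1, Lp.coeFn_smul c u.1] with x hx hx'
    rw [coe_smul, coe_smul, hx, hx', Pi.smul_apply, Pi.smul_apply, smul_eq_mul, smul_eq_mul]
    ring

/-- One has `d|v| - d|u| = sign v · d(v - u) + (sign v - sign u) · du`. The first term is small with
`v - u`. The second is supported where the signs differ and `du ≠ 0`; as `du = 0` almost everywhere
on `{u = 0}`, there either `0 < |u| < ρ` or `|v - u| ≥ ρ`. Both sets have small measure, so `∫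
|du|²` over them is small. -/
lemma sobolevLt_abs_sub_abs (u : H1 n M) {δ : ℝ≥0∞} (hδ : 0 < δ) :
    ∃ δ' : ℝ≥0∞, 0 < δ' ∧ ∀ v : H1 n M, SobolevLt n (fun x => v.1 x - u.1 x) δ' →
      SobolevLt n (fun x => |v.1 x| - |u.1 x|) δ := by
  obtain ⟨α, hα, hu⟩ := u.exists_isWeakDifferential
  -- Absolute continuity of the integral of `|du|²`. The constant `64` leaves room in the final
  -- bound `2 · δ/64 + 8 (δ/64 + δ/64) ≤ δ`.
  obtain ⟨κ, hκ, hκ'⟩ := exists_pos_setLIntegral_lt_of_measure_lt (lintegral_lt_top hu).ne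
    (ε := δ / 64) (ENNReal.div_pos hδ.ne' (by simp)).ne'
  have hum : Measurable fun x => |u.1 x| := (Lp.stronglyMeasurable u.1).measurable.norm
  obtain ⟨ρ, hρ, hρκ⟩ : ∃ ρ : ℝ, 0 < ρ ∧ vol n M {x | 0 < |u.1 x| ∧ |u.1 x| < ρ} < κ := by
    have h1 : Tendsto (vol n M ∘ fun k : ℕ => {x | 0 < |u.1 x| ∧ |u.1 x| < 1 / ((k : ℝ) + 1)})
        atTop (𝓝 (vol n M (⋂ k : ℕ, {x | 0 < |u.1 x| ∧ |u.1 x| < 1 / ((k : ℝ) + 1)}))) := by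
      refine tendsto_measure_iInter_atTop (fun k => ?_) (fun i j hij x hx => ⟨hx.1, ?_⟩)
        ⟨0, measure_ne_top _ _⟩
      · exact ((measurableSet_lt measurable_const hum).inter
          (measurableSet_lt hum measurable_const)).nullMeasurableSet
      · exact hx.2.trans_le (one_div_le_one_div_of_le (by positivity) (by simpa using hij))
    have h2 : (⋂ k : ℕ, {x | 0 < |u.1 x| ∧ |u.1 x| < 1 / ((k : ℝ) + 1)}) = ∅ := by
      refine eq_empty_of_forall_notMem fun x hx => ?_
      rw [mem_iInter] at hx
      obtain ⟨k, hk⟩ := exists_nat_one_div_lt (hx 0).1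
      exact lt_asymm hk (hx k).2
    rw [h2, measure_empty] at h1
    obtain ⟨k, hk⟩ := (h1.eventually_lt_const hκ).exists
    exact ⟨1 / ((k : ℝ) + 1), by positivity, hk⟩
  -- The second entry of the minimum is what Chebyshev's inequality needs to make the measure of the
  -- set `B` below smaller than `κ`.
  refine ⟨min (δ / 64) (ENNReal.ofReal (ρ ^ 2) * κ), lt_min (ENNReal.div_pos hδ.ne' (by simp))
    (ENNReal.mul_pos (by simp; positivity) hκ.ne'), fun v ⟨β, hβ, h⟩ => ?_⟩
  have hv : IsWeakDifferential n (fun x => v.1 x) (fun x => β x + α x) := by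
    convert hβ.add hα using 2
    simp
  refine ⟨_, hv.abs.sub hα.abs, ?_⟩
  set A : Set M := {x | 0 < |u.1 x| ∧ |u.1 x| < ρ}
  set B : Set M := {x | ENNReal.ofReal (ρ ^ 2) ≤
    ENNReal.ofReal ((v.1 x - u.1 x) ^ 2 + ‖β x‖ ^ 2)}
  have hA : MeasurableSet A := (measurableSet_lt measurable_const hum).inter (measurableSet_lt hum measurable_const)
  have hB : NullMeasurableSet B (vol n M) :=
    nullMeasurableSet_le aemeasurable_const hβ.aemeasurable_sobolev
  have hBκ : vol n M B < κ := by
    have h1 := (mul_meas_ge_le_lintegral₀ hβ.aemeasurable_sobolev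
      (ENNReal.ofReal (ρ ^ 2))).trans_lt (h.trans_le (min_le_right _ _))
    exact lt_of_mul_lt_mul_left' h1
  have hfm : AEMeasurable (fun x => ENNReal.ofReal (‖α x‖ ^ 2)) (vol n M) :=
    (hα.aemeasurable_norm.pow_const 2).ennreal_ofReal
  have hle : sobolevEnergy n (fun x => |v.1 x| - |u.1 x|)
      (fun x => ((SignType.sign (v.1 x) : SignType) : ℝ) • (β x + α x) -
        ((SignType.sign (u.1 x) : SignType) : ℝ) • α x) ≤
      2 * sobolevEnergy n (fun x => v.1 x - u.1 x) β + 8 *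
        (∫⁻ x, A.indicator (fun x => ENNReal.ofReal (‖α x‖ ^ 2)) x ∂(vol n M) +
        ∫⁻ x, B.indicator (fun x => ENNReal.ofReal (‖α x‖ ^ 2)) x ∂(vol n M)) := by
    rw [sobolevEnergy, sobolevEnergy, ← lintegral_const_mul' _ _ (by simp),
      ← lintegral_add_left' (hfm.indicator hA), ← lintegral_const_mul' _ _ (by simp),
      ← lintegral_add_left' (hβ.aemeasurable_sobolev.const_mul 2)]
    refine lintegral_mono_ae ?_
    filter_upwards [hα.ae_eq_zero] with x hx
    set s : ℝ := ((SignType.sign (v.1 x) : SignType) : ℝ)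
    set t : ℝ := ((SignType.sign (u.1 x) : SignType) : ℝ)
    have hs : |s| ≤ 1 := by
      rcases lt_trichotomy (v.1 x) 0 with h | h | h <;> simp [s, h]
    have ht : |t| ≤ 1 := by
      rcases lt_trichotomy (u.1 x) 0 with h | h | h <;> simp [t, h]
    have h1 : s • (β x + α x) - t • α x = s • β x + (s - t) • α x := by
      ext w
      simp
      ring
    have h2 : ‖s • (β x + α x) - t • α x‖ ≤ ‖β x‖ + |s - t| * ‖α x‖ := by
      rw [h1]
      refine ((s • β x).opNorm_add_le _).trans (add_le_add ?_ ((α x).opNorm_smul_le _))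
      exact ((β x).opNorm_smul_le _).trans (mul_le_of_le_one_left (β x).opNorm_nonneg hs)
    have h3 : (|v.1 x| - |u.1 x|) ^ 2 ≤ (v.1 x - u.1 x) ^ 2 :=
      sq_le_sq.2 (abs_abs_sub_abs_le _ _)
    have h4 := (s • (β x + α x) - t • α x).opNorm_nonneg
    have hb := (β x).opNorm_nonneg
    have ha := (α x).opNorm_nonneg
    have key : ∀ a b c : ℝ, 0 ≤ b → 0 ≤ c → a ≤ 2 * b + 8 * c →
        ENNReal.ofReal a ≤ 2 * ENNReal.ofReal b + 8 * ENNReal.ofReal c := by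
      intro a b c hb hc h
      have h5 : (2 : ℝ≥0∞) = ENNReal.ofReal 2 := by simp
      have h6 : (8 : ℝ≥0∞) = ENNReal.ofReal 8 := by simp
      rw [h5, h6, ← ENNReal.ofReal_mul (by norm_num), ← ENNReal.ofReal_mul (by norm_num),
        ← ENNReal.ofReal_add (by positivity) (by positivity)]
      exact ENNReal.ofReal_le_ofReal h
    have hsame : (s - t) * ‖α x‖ = 0 →
        ENNReal.ofReal ((|v.1 x| - |u.1 x|) ^ 2 + ‖s • (β x + α x) - t • α x‖ ^ 2) ≤
        2 * ENNReal.ofReal ((v.1 x - u.1 x) ^ 2 + ‖β x‖ ^ 2) := by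
      intro h0
      have h5 : |s - t| * ‖α x‖ = 0 := by
        rcases mul_eq_zero.1 h0 with h | h <;> simp [h]
      rw [h5, add_zero] at h2
      refine (key _ ((v.1 x - u.1 x) ^ 2 + ‖β x‖ ^ 2) 0 (by positivity) le_rfl ?_).trans (by simp)
      nlinarith
    -- The factor `8` is `2 · 2²`, since two signs differ by at most `2`.
    have hdiff : ENNReal.ofReal ((|v.1 x| - |u.1 x|) ^ 2 + ‖s • (β x + α x) - t • α x‖ ^ 2) ≤
        2 * ENNReal.ofReal ((v.1 x - u.1 x) ^ 2 + ‖β x‖ ^ 2) + 8 * ENNReal.ofReal (‖α x‖ ^ 2) := by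
      refine key _ _ _ (by positivity) (by positivity) ?_
      have h5 : |s - t| ≤ 2 := (abs_sub s t).trans (by linarith)
      have h6 : ‖s • (β x + α x) - t • α x‖ ≤ ‖β x‖ + 2 * ‖α x‖ :=
        h2.trans (by gcongr)
      nlinarith [sq_nonneg (‖β x‖ - 2 * ‖α x‖)]
    by_cases hxA : x ∈ A
    · refine hdiff.trans ?_
      gcongr
      rw [indicator_of_mem hxA]
      exact le_self_add
    by_cases hxB : x ∈ B
    · refine hdiff.trans ?_
      gcongr
      rw [indicator_of_mem hxB]
      exact le_add_self
    refine (hsame ?_).trans le_self_add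
    rcases eq_or_ne (u.1 x) 0 with h0 | h0
    · rw [hx h0]
      have : ‖(0 : TangentSpace (𝓡 (n + 1)) x →L[ℝ] ℝ)‖ = 0 := ContinuousLinearMap.opNorm_zero
      rw [this, mul_zero]
    · have h5 : ρ ≤ |u.1 x| := not_lt.1 fun h => hxA ⟨abs_pos.2 h0, h⟩
      have h6 : (v.1 x - u.1 x) ^ 2 < ρ ^ 2 := by
        have : ENNReal.ofReal ((v.1 x - u.1 x) ^ 2 + ‖β x‖ ^ 2) < ENNReal.ofReal (ρ ^ 2) :=
          not_le.1 hxB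
        rw [ENNReal.ofReal_lt_ofReal_iff (by positivity)] at this
        nlinarith
      have h7 : |v.1 x - u.1 x| < ρ := abs_lt_of_sq_lt_sq h6 hρ.le
      have h8 : s = t := by
        rcases lt_or_gt_of_ne h0 with h | h
        · have : v.1 x < 0 := by
            rw [abs_of_neg h] at h5
            linarith [(abs_lt.1 h7).2]
          simp [s, t, h, this]
        · have : 0 < v.1 x := by
            rw [abs_of_pos h] at h5
            linarith [(abs_lt.1 h7).1]
          simp [s, t, h, this]
      rw [h8, sub_self, zero_mul]
  rw [lintegral_indicator hA, lintegral_indicator₀ hB] at hle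
  refine hle.trans_lt ?_
  have h8 : 2 * (δ / 64) + 8 * (δ / 64 + δ / 64) ≤ δ := by
    calc 2 * (δ / 64) + 8 * (δ / 64 + δ / 64) = 18 * (δ / 64) := by ring
      _ ≤ 64 * (δ / 64) := by gcongr; norm_num
      _ = δ := ENNReal.mul_div_cancel (by simp) (by simp)
  refine lt_of_lt_of_le (ENNReal.add_lt_add (ENNReal.mul_lt_mul_right (by simp) (by simp)
    (h.trans_le (min_le_left _ _))) (ENNReal.mul_lt_mul_right (by simp) (by simp)
    (ENNReal.add_lt_add (hκ' _ hρκ) (hκ' _ hBκ)))) h8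

lemma continuous_abs : Continuous (H1.abs : H1 n M → H1 n M) := by
  rw [continuous_iff_continuousAt]
  intro u
  refine tendsto_nhds_iff.2 fun δ hδ => ?_
  obtain ⟨δ', hδ', h⟩ := sobolevLt_abs_sub_abs u hδ
  filter_upwards [tendsto_nhds_iff.1 (continuousAt_id (x := u)) δ' hδ'] with v hv
  refine (h v hv).congr ?_
  filter_upwards [Lp.coeFn_abs v.1, Lp.coeFn_abs u.1] with x hx hx'
  rw [coe_abs, coe_abs, hx, hx']

end H1

end AllenCahn

end Sobolev


/-! ### Smooth functions are in `H¹` -/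

section SmoothFunctions

open Manifold Metric Set

variable {n : ℕ} {M : Type*} [EMetricSpace M] [MeasurableSpace M] [BorelSpace M]
  [ChartedSpace (EuclideanSpace ℝ (Fin (n + 1))) M] [IsManifold (𝓡 (n + 1)) ∞ M]
  [RiemannianBundle (fun x : M => TangentSpace (𝓡 (n + 1)) x)]
  [IsContMDiffRiemannianBundle (𝓡 (n + 1)) ∞ (EuclideanSpace ℝ (Fin (n + 1)))
    (fun x : M => TangentSpace (𝓡 (n + 1)) x)]
  [IsRiemannianManifold (𝓡 (n + 1)) M] [CompactSpace M] {φ : M → ℝ}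

namespace AllenCahn

variable (n) in
/-- The differential of a real-valued function on a manifold. -/
noncomputable def differential (φ : M → ℝ) (x : M) : TangentSpace (𝓡 (n + 1)) x →L[ℝ] ℝ :=
  mfderiv (𝓡 (n + 1)) 𝓘(ℝ, ℝ) φ x

lemma fderiv_comp_symm_of_mem_atlas (hφ : ContMDiff (𝓡 (n + 1)) 𝓘(ℝ, ℝ) ∞ φ)
    {e : OpenPartialHomeomorph M (EuclideanSpace ℝ (Fin (n + 1)))}
    (he : e ∈ atlas (EuclideanSpace ℝ (Fin (n + 1))) M) {y : EuclideanSpace ℝ (Fin (n + 1))}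
    (hy : y ∈ e.target) (v : EuclideanSpace ℝ (Fin (n + 1))) :
    fderiv ℝ (fun y => φ (e.symm y)) y v =
      differential n φ (e.symm y) (mfderiv (𝓡 (n + 1)) (𝓡 (n + 1)) e.symm y v) := by
  have h1 := mfderiv_comp (I := 𝓡 (n + 1)) (I' := 𝓡 (n + 1)) (I'' := 𝓘(ℝ, ℝ)) y
    (hφ.mdifferentiable (by simp) (e.symm y))
    ((mdifferentiable_of_mem_atlas (I := 𝓡 (n + 1)) he).symm.mdifferentiableAt hy)
  rw [← mfderiv_eq_fderiv]
  exact congr($h1 v)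

lemma contDiffOn_comp_symm_of_mem_atlas (hφ : ContMDiff (𝓡 (n + 1)) 𝓘(ℝ, ℝ) ∞ φ)
    {e : OpenPartialHomeomorph M (EuclideanSpace ℝ (Fin (n + 1)))}
    (he : e ∈ atlas (EuclideanSpace ℝ (Fin (n + 1))) M) :
    ContDiffOn ℝ ∞ (fun y => φ (e.symm y)) e.target := by
  rw [← contMDiffOn_iff_contDiffOn]
  exact hφ.comp_contMDiffOn (contMDiffOn_symm_of_mem_maximalAtlas (I := 𝓡 (n + 1)) (n := ∞)
    (IsManifold.subset_maximalAtlas he))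

lemma isWeakDifferential_of_contMDiff (hφ : ContMDiff (𝓡 (n + 1)) 𝓘(ℝ, ℝ) ∞ φ) :
    IsWeakDifferential n φ (differential n φ) := by
  have hc : ∀ e ∈ atlas (EuclideanSpace ℝ (Fin (n + 1))) M,
      ∀ v : EuclideanSpace ℝ (Fin (n + 1)),
      ContinuousOn (fun y => fderiv ℝ (fun y => φ (e.symm y)) y v) e.target := fun e he v =>
    ((contDiffOn_comp_symm_of_mem_atlas hφ he).continuousOn_fderiv_of_isOpen e.open_target
      (by simp)).clm_apply continuousOn_const
  have h1 : ∀ e ∈ atlas (EuclideanSpace ℝ (Fin (n + 1))) M,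
      LocallyIntegrableOn (fun y => φ (e.symm y)) e.target volume := fun e he =>
    (contDiffOn_comp_symm_of_mem_atlas hφ he).continuousOn.locallyIntegrableOn
      e.open_target.measurableSet
  have h2 : ∀ e ∈ atlas (EuclideanSpace ℝ (Fin (n + 1))) M,
      ∀ v : EuclideanSpace ℝ (Fin (n + 1)),
      LocallyIntegrableOn (fun y => fderiv ℝ (fun y => φ (e.symm y)) y v) e.target volume :=
    fun e he v => (hc e he v).locallyIntegrableOn e.open_target.measurableSet
  refine ⟨h1, fun e he v => ?_, fun e he η hη hηc hηs v => ?_⟩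
  · refine ((hc e he v).congr fun y hy => ?_).locallyIntegrableOn e.open_target.measurableSet
    exact (fderiv_comp_symm_of_mem_atlas hφ he hy v).symm
  · have h3 : ∀ y ∈ e.target, fderiv ℝ (fun y => φ (e.symm y)) y v * η y =
        differential n φ (e.symm y) (mfderiv (𝓡 (n + 1)) (𝓡 (n + 1)) e.symm y v) * η y :=
      fun y hy => by rw [fderiv_comp_symm_of_mem_atlas hφ he hy v]
    have hs := (tsupport_fderiv_apply_subset (f := η) ℝ v).trans hηs
    rw [← setIntegral_congr_fun e.open_target.measurableSet h3, setIntegral_mul_eq_integral hηs,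
      setIntegral_mul_eq_integral hs]
    refine integral_mul_fderiv_eq_neg_fderiv_mul_of_integrable
      ((h2 e he v).integrable_mul_of_tsupport_subset hη.continuous hηc hηs)
      ((h1 e he).integrable_mul_of_tsupport_subset
        ((hη.continuous_fderiv (by simp)).clm_apply continuous_const) (hηc.fderiv_apply ℝ v) hs)
      ((h1 e he).integrable_mul_of_tsupport_subset hη.continuous hηc hηs)
      (fun y hy => ?_) (fun y _ => hη.differentiable (by simp) y)
    exact ((contDiffOn_comp_symm_of_mem_atlas hφ he).differentiableOn (by simp)).differentiableAt
      (e.open_target.mem_nhds (hηs hy))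

/-- Near the centre of a chart the differential factors through the derivative of the coordinate
expression, which is continuous, and the differential of the chart, which is bounded there.
Compactness makes the bound global. -/
lemma exists_norm_differential_le (hφ : ContMDiff (𝓡 (n + 1)) 𝓘(ℝ, ℝ) ∞ φ) :
    ∃ C : ℝ, ∀ x, ‖differential n φ x‖ ≤ C := by
  have := isContinuousRiemannianBundle_tangentSpace n M
  have hloc : ∀ x : M, ∃ C : ℝ, ∀ᶠ y in 𝓝 x, ‖differential n φ y‖ ≤ C := by
    intro x
    obtain ⟨C, hC0, hC⟩ := eventually_norm_mfderiv_extChartAt_apply_le (𝓡 (n + 1)) x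
    set e := chartAt (EuclideanSpace ℝ (Fin (n + 1))) x
    have he : e ∈ atlas (EuclideanSpace ℝ (Fin (n + 1))) M := chart_mem_atlas _ x
    have hcont : ContinuousAt (fun y => ‖fderiv ℝ (fun z => φ (e.symm z)) (e y)‖) x := by
      have h1 := ((contDiffOn_comp_symm_of_mem_atlas hφ he).continuousOn_fderiv_of_isOpen
        e.open_target (by simp)).continuousAt
        (e.open_target.mem_nhds (e.map_source (mem_chart_source _ x)))
      exact (h1.comp (f := fun y => e y) (e.continuousAt (mem_chart_source _ x))).norm
    set A := ‖fderiv ℝ (fun z => φ (e.symm z)) (e x)‖ + 1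
    have hA : ∀ᶠ y in 𝓝 x, ‖fderiv ℝ (fun z => φ (e.symm z)) (e y)‖ < A :=
      hcont.eventually_lt continuousAt_const (lt_add_one _)
    refine ⟨A * C, ?_⟩
    filter_upwards [hC, hA, e.open_source.mem_nhds (mem_chart_source _ x)] with y hy hyA hye
    refine ContinuousLinearMap.opNorm_le_bound _ (by positivity) fun w => ?_
    obtain ⟨z, hz⟩ : ∃ z : EuclideanSpace ℝ (Fin (n + 1)), z = mfderiv (𝓡 (n + 1))
      𝓘(ℝ, EuclideanSpace ℝ (Fin (n + 1))) (extChartAt (𝓡 (n + 1)) x) y w := ⟨_, rfl⟩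
    have hw : ‖z‖ ≤ C * ‖w‖ := by
      rw [hz]
      exact hy w
    have hfun : differential n φ y w = fderiv ℝ (fun z => φ (e.symm z)) (e y) z := by
      rw [hz]
      have hd : MDifferentiableAt (𝓡 (n + 1)) 𝓘(ℝ, ℝ) (fun z => φ (e.symm z)) (e y) :=
        (((contDiffOn_comp_symm_of_mem_atlas hφ he).differentiableOn (by simp)).differentiableAt
          (e.open_target.mem_nhds (e.map_source hye))).mdifferentiableAt
      have h2 : MDifferentiableAt (𝓡 (n + 1)) 𝓘(ℝ, EuclideanSpace ℝ (Fin (n + 1)))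
        (extChartAt (𝓡 (n + 1)) x) y := mdifferentiableAt_extChartAt hye
      have h1 := mfderiv_comp (I := 𝓡 (n + 1)) (I' := 𝓡 (n + 1)) (I'' := 𝓘(ℝ, ℝ)) y
        (g := fun z => φ (e.symm z)) (f := extChartAt (𝓡 (n + 1)) x) hd h2
      have h3 : (fun z => φ (e.symm z)) ∘ (extChartAt (𝓡 (n + 1)) x) =ᶠ[𝓝 y] φ := by
        filter_upwards [e.open_source.mem_nhds hye] with z hz
        simp [e, e.left_inv hz]
      rw [h3.mfderiv_eq, mfderiv_eq_fderiv] at h1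
      exact congr($h1 w)
    rw [hfun]
    calc _ ≤ ‖fderiv ℝ (fun z => φ (e.symm z)) (e y)‖ * ‖z‖ := ContinuousLinearMap.le_opNorm _ _
      _ ≤ A * (C * ‖w‖) := by gcongr
      _ = _ := by ring
  choose C hC using hloc
  obtain ⟨t, ht⟩ := CompactSpace.elim_nhds_subcover _ hC
  refine ⟨∑ x ∈ t, |C x|, fun x => ?_⟩
  have hx : x ∈ ⋃ x ∈ t, {y | ‖differential n φ y‖ ≤ C x} := ht ▸ mem_univ x
  obtain ⟨y, hy, hxy⟩ := mem_iUnion₂.1 hx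
  exact (hxy.trans (le_abs_self _)).trans
    (Finset.single_le_sum (f := fun x => |C x|) (fun _ _ => abs_nonneg _) hy)

omit [IsManifold (𝓡 (n + 1)) ∞ M]
  [IsContMDiffRiemannianBundle (𝓡 (n + 1)) ∞ (EuclideanSpace ℝ (Fin (n + 1)))
    (fun x : M => TangentSpace (𝓡 (n + 1)) x)]
  [IsRiemannianManifold (𝓡 (n + 1)) M] [CompactSpace M] in
lemma sobolevEnergy_le {f : M → ℝ} {α : (x : M) → TangentSpace (𝓡 (n + 1)) x →L[ℝ] ℝ} {C : ℝ}
    (hf : ∀ x, |f x| ≤ C) (hα : ∀ x, ‖α x‖ ≤ C) :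
    sobolevEnergy n f α ≤ ENNReal.ofReal (2 * C ^ 2) * vol n M univ := by
  rw [← lintegral_const]
  refine lintegral_mono fun x => ENNReal.ofReal_le_ofReal ?_
  have h1 := pow_le_pow_left₀ (abs_nonneg _) (hf x) 2
  have h2 := pow_le_pow_left₀ (α x).opNorm_nonneg (hα x) 2
  rw [sq_abs] at h1
  linarith

lemma IsWeakDifferential.memLp_of_bound {f : M → ℝ}
    {α : (x : M) → TangentSpace (𝓡 (n + 1)) x →L[ℝ] ℝ} (h : IsWeakDifferential n f α) {C : ℝ}
    (hf : ∀ x, |f x| ≤ C) : MemLp f 2 (vol n M) :=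
  MemLp.of_bound h.aemeasurable_fun.aestronglyMeasurable C (.of_forall hf)

/-- The element of `H¹` given by a bounded function with a bounded weak differential. -/
noncomputable def H1.ofBounded (f : M → ℝ)
    (α : (x : M) → TangentSpace (𝓡 (n + 1)) x →L[ℝ] ℝ) (h : IsWeakDifferential n f α) {C : ℝ}
    (hf : ∀ x, |f x| ≤ C) (hα : ∀ x, ‖α x‖ ≤ C) : H1 n M :=
  ⟨(h.memLp_of_bound hf).toLp f, α, h.congr_ae (MemLp.coeFn_toLp (h.memLp_of_bound hf)).symm,
    H1.lintegral_lt_top ((sobolevEnergy_le hf hα).trans_lt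
      (ENNReal.mul_lt_top ENNReal.ofReal_lt_top (measure_lt_top _ _)))⟩

lemma H1.ofBounded_ae_eq {f : M → ℝ}
    {α : (x : M) → TangentSpace (𝓡 (n + 1)) x →L[ℝ] ℝ} (h : IsWeakDifferential n f α) {C : ℝ}
    (hf : ∀ x, |f x| ≤ C) (hα : ∀ x, ‖α x‖ ≤ C) :
    (H1.ofBounded f α h hf hα).1 =ᵐ[vol n M] f :=
  MemLp.coeFn_toLp (h.memLp_of_bound hf)

lemma isWeakDifferential_const (c : ℝ) : IsWeakDifferential n (fun _ : M => c) (fun _ => 0) := by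
  have h := isWeakDifferential_of_contMDiff (n := n) (M := M) (φ := fun _ => c) contMDiff_const
  have h0 : differential n (fun _ : M => c) = fun _ => 0 := by
    ext1 x
    exact mfderiv_const
  rwa [h0] at h

omit [MeasurableSpace M] [BorelSpace M] [IsManifold (𝓡 (n + 1)) ∞ M]
  [IsContMDiffRiemannianBundle (𝓡 (n + 1)) ∞ (EuclideanSpace ℝ (Fin (n + 1)))
    (fun x : M => TangentSpace (𝓡 (n + 1)) x)]
  [IsRiemannianManifold (𝓡 (n + 1)) M] [CompactSpace M] in
lemma norm_zero_covector (x : M) : ‖(0 : TangentSpace (𝓡 (n + 1)) x →L[ℝ] ℝ)‖ = 0 :=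
  ContinuousLinearMap.opNorm_zero

variable (n M) in
/-- The constant functions. -/
noncomputable def H1.const (c : ℝ) : H1 n M :=
  H1.ofBounded (fun _ => c) (fun _ => 0) (isWeakDifferential_const c) (C := |c|) (fun _ => le_rfl)
    fun x => by rw [norm_zero_covector]; exact abs_nonneg _

lemma H1.const_ae_eq (c : ℝ) : (H1.const n M c).1 =ᵐ[vol n M] fun _ => c :=
  H1.ofBounded_ae_eq _ _ _

lemma isWeakDifferential_sum {ι : Type*} (s : Finset ι) {f : ι → M → ℝ}
    {α : ι → (x : M) → TangentSpace (𝓡 (n + 1)) x →L[ℝ] ℝ}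
    (h : ∀ i, IsWeakDifferential n (f i) (α i)) (a : ι → ℝ) :
    IsWeakDifferential n (fun x => ∑ i ∈ s, a i * f i x) (fun x => ∑ i ∈ s, a i • α i x) := by
  classical
  induction s using Finset.induction_on with
  | empty => simpa using isWeakDifferential_const (n := n) (M := M) 0
  | insert i s hi ih => simpa only [Finset.sum_insert hi] using ((h i).const_smul (a i)).add ih

/-- There is a smooth function with infinitely many values. -/
lemma exists_contMDiff_infinite_range [Nonempty M] :
    ∃ φ : M → ℝ, ContMDiff (𝓡 (n + 1)) 𝓘(ℝ, ℝ) ∞ φ ∧ (range φ).Infinite := by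
  obtain ⟨c⟩ := ‹Nonempty M›
  obtain ⟨f⟩ : Nonempty (SmoothBumpFunction (𝓡 (n + 1)) c) := inferInstance
  refine ⟨f, f.contMDiff, ?_⟩
  -- Such a vector exists because the dimension is at least one. Along the radius in its direction
  -- the bump function goes from `1` to `0` and takes all values in between.
  obtain ⟨v, hv⟩ : ∃ v : EuclideanSpace ℝ (Fin (n + 1)), ‖v‖ = f.rOut :=
    ⟨EuclideanSpace.single 0 f.rOut, by simp [abs_of_pos f.rOut_pos]⟩
  set x₀ := extChartAt (𝓡 (n + 1)) c c
  have hmem : ∀ t ∈ Icc (0 : ℝ) 1, x₀ + t • v ∈ closedBall x₀ f.rOut := by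
    intro t ht
    rw [mem_closedBall, dist_eq_norm, add_sub_cancel_left, norm_smul, hv, Real.norm_of_nonneg ht.1]
    exact mul_le_of_le_one_left f.rOut_pos.le ht.2
  have hcont : ContinuousOn (fun t : ℝ => f.toContDiffBump (x₀ + t • v)) (Icc 0 1) :=
    (f.toContDiffBump.continuous.comp (by fun_prop)).continuousOn
  have hsub := intermediate_value_Icc' zero_le_one hcont
  have h0 : f.toContDiffBump (x₀ + (0 : ℝ) • v) = 1 := by
    refine f.toContDiffBump.one_of_mem_closedBall ?_
    simp [f.rIn_pos.le, x₀]
  have h1 : f.toContDiffBump (x₀ + (1 : ℝ) • v) = 0 := by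
    refine f.toContDiffBump.zero_of_le_dist ?_
    rw [dist_eq_norm, one_smul, add_sub_cancel_left, hv]
  rw [h0, h1] at hsub
  refine (Icc_infinite (zero_lt_one (α := ℝ))).mono fun y hy => ?_
  obtain ⟨t, ht, rfl⟩ := hsub hy
  have hT : x₀ + t • v ∈ (extChartAt (𝓡 (n + 1)) c).target :=
    f.closedBall_subset ⟨hmem t ht, by simp⟩
  refine ⟨(extChartAt (𝓡 (n + 1)) c).symm (x₀ + t • v), ?_⟩
  rw [f.eqOn_source (by simpa using (extChartAt (𝓡 (n + 1)) c).map_target hT)]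
  simp only [Function.comp_apply]
  rw [(extChartAt (𝓡 (n + 1)) c).right_inv hT]

/-- Linear combinations of powers of a function with infinitely many values do not vanish. -/
lemma eq_zero_of_sum_mul_pow_ae_eq_zero {N : ℕ} (hφ : Continuous φ) (hr : (range φ).Infinite)
    {a : Fin N → ℝ} (h : (fun x => ∑ i, a i * φ x ^ (i : ℕ)) =ᵐ[vol n M] fun _ => 0) : a = 0 := by
  have h1 : (fun x => ∑ i, a i * φ x ^ (i : ℕ)) = fun _ => 0 :=
    (Continuous.ae_eq_iff_eq (vol n M) (by fun_prop) continuous_const).1 h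
  set P : Polynomial ℝ := ∑ i, Polynomial.C (a i) * Polynomial.X ^ (i : ℕ)
  have hP : P = 0 := by
    refine Polynomial.eq_zero_of_infinite_isRoot P (hr.mono ?_)
    rintro _ ⟨x, rfl⟩
    have := congr_fun h1 x
    simpa [P, Polynomial.IsRoot, Polynomial.eval_finsetSum] using this
  ext i
  have := congr_arg (fun p => Polynomial.coeff p (i : ℕ)) hP
  simpa [P, Polynomial.finsetSum_coeff, Polynomial.coeff_C_mul, Polynomial.coeff_X_pow,
    Fin.val_inj] using this

end AllenCahn

end SmoothFunctions


/-! ### The Allen-Cahn energy -/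

section Energy

open Manifold Metric Set

variable {n : ℕ} {M : Type*} [EMetricSpace M] [MeasurableSpace M] [BorelSpace M]
  [ChartedSpace (EuclideanSpace ℝ (Fin (n + 1))) M] [IsManifold (𝓡 (n + 1)) ∞ M]
  [RiemannianBundle (fun x : M => TangentSpace (𝓡 (n + 1)) x)]
  [IsContMDiffRiemannianBundle (𝓡 (n + 1)) ∞ (EuclideanSpace ℝ (Fin (n + 1)))
    (fun x : M => TangentSpace (𝓡 (n + 1)) x)]
  [IsRiemannianManifold (𝓡 (n + 1)) M] [CompactSpace M]
  {α β : (x : M) → TangentSpace (𝓡 (n + 1)) x →L[ℝ] ℝ} {W : ℝ → ℝ} {ε : ℝ}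

namespace AllenCahn

variable (n) in
/-- The Allen-Cahn functional of a function `u` with differential `α`. -/
noncomputable def energyIntegral (W : ℝ → ℝ) (ε : ℝ) (u : M → ℝ)
    (α : (x : M) → TangentSpace (𝓡 (n + 1)) x →L[ℝ] ℝ) : ℝ≥0∞ :=
  ∫⁻ x, ENNReal.ofReal (ε * ‖α x‖ ^ 2 / 2 + W (u x) / ε) ∂(vol n M)

lemma energyIntegral_congr {u v : M → ℝ} (h : u =ᵐ[vol n M] v)
    (h' : ∀ᵐ x ∂(vol n M), α x = β x) :
    energyIntegral n W ε u α = energyIntegral n W ε v β := by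
  refine lintegral_congr_ae ?_
  filter_upwards [h, h'] with x hx hx'
  rw [hx, hx']

/-- The energy can be computed with any weak differential. -/
lemma energy_eq (u : H1 n M) (h : IsWeakDifferential n (fun x => u.1 x) α) :
    energy n W ε u = energyIntegral n W ε (fun x => u.1 x) α := by
  refine le_antisymm (iInf₂_le _ h) (le_iInf₂ fun β hβ => (energyIntegral_congr ae_eq_rfl ?_).le)
  filter_upwards [h.ae_eq_of_eq hβ] with x hx
  exact hx rfl

lemma energy_ofBounded {f : M → ℝ} (h : IsWeakDifferential n f α) {C : ℝ}
    (hf : ∀ x, |f x| ≤ C) (hα : ∀ x, ‖α x‖ ≤ C) :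
    energy n W ε (H1.ofBounded f α h hf hα) = energyIntegral n W ε f α := by
  have h1 := H1.ofBounded_ae_eq h hf hα
  rw [energy_eq _ (h.congr_ae h1.symm)]
  exact energyIntegral_congr h1 (.of_forall fun _ => rfl)

lemma energy_const (c : ℝ) :
    energy n W ε (H1.const n M c) = ENNReal.ofReal (W c / ε) * vol n M univ := by
  rw [H1.const, energy_ofBounded, energyIntegral, ← lintegral_const]
  refine lintegral_congr fun x => ?_
  rw [norm_zero_covector]
  simp

lemma energy_congr {u v : H1 n M} (h : u.1 = v.1) : energy n W ε u = energy n W ε v := by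
  rw [Subtype.ext h]

lemma IsWeakDifferential.aemeasurable_energy {u : M → ℝ} (hWc : Continuous W)
    (h : IsWeakDifferential n u α) :
    AEMeasurable (fun x => ENNReal.ofReal (ε * ‖α x‖ ^ 2 / 2 + W (u x) / ε)) (vol n M) :=
  (((h.aemeasurable_norm.pow_const 2).const_mul ε |>.div_const 2).add
    ((hWc.measurable.comp_aemeasurable h.aemeasurable_fun).div_const ε)).ennreal_ofReal

/-- If a function agrees at almost every point with one of three given functions up to sign,
then its energy is at most the sum of their energies. -/
lemma energy_le_add_add (hWe : ∀ t, W (-t) = W t) (hWc : Continuous W) {F u v w : H1 n M}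
    (h : ∀ᵐ x ∂(vol n M), F.1 x = u.1 x ∨ F.1 x = v.1 x ∨ F.1 x = w.1 x ∨ F.1 x = -w.1 x) :
    energy n W ε F ≤ energy n W ε u + energy n W ε v + energy n W ε w := by
  obtain ⟨φ, hφ, -⟩ := F.2
  obtain ⟨α, hα, -⟩ := u.2
  obtain ⟨β, hβ, -⟩ := v.2
  obtain ⟨τ, hτ, -⟩ := w.2
  rw [energy_eq F hφ, energy_eq u hα, energy_eq v hβ, energy_eq w hτ, energyIntegral,
    energyIntegral, energyIntegral, energyIntegral,
    ← lintegral_add_left' (hα.aemeasurable_energy hWc),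
    ← lintegral_add_right' _ (hτ.aemeasurable_energy hWc)]
  refine lintegral_mono_ae ?_
  -- On each coincidence set the differential of `F` is that of the corresponding function, so the
  -- energy density of `F` is one of the three densities; for `-w` evenness of `W` is used.
  filter_upwards [h, hφ.ae_eq_of_eq hα, hφ.ae_eq_of_eq hβ, hφ.ae_eq_of_eq hτ,
    hφ.ae_eq_of_eq (hτ.const_smul (-1))] with x hx h1 h2 h3 h4
  rcases hx with hx | hx | hx | hx
  · rw [h1 hx, hx, add_assoc]
    exact le_self_add
  · rw [h2 hx, hx]
    exact le_add_self.trans le_self_add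
  · rw [h3 hx, hx]
    exact le_add_self
  · rw [h4 (by rw [hx, neg_one_mul]), hx, hWe, show (-1 : ℝ) • τ x = -τ x by ext; simp,
      (τ x).opNorm_neg]
    exact le_add_self

/-! ### Truncation and merging of functions in `H¹` -/

namespace H1

lemma add_ae_eq {U V : H1 n M} {f g : M → ℝ} (hU : U.1 =ᵐ[vol n M] f) (hV : V.1 =ᵐ[vol n M] g) :
    (U + V).1 =ᵐ[vol n M] fun x => f x + g x :=
  (Lp.coeFn_add U.1 V.1).trans (hU.add hV)

lemma smul_ae_eq (c : ℝ) {U : H1 n M} {f : M → ℝ} (hU : U.1 =ᵐ[vol n M] f) :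
    (c • U).1 =ᵐ[vol n M] fun x => c * f x :=
  (Lp.coeFn_smul c U.1).trans (hU.const_smul c)

lemma abs_ae_eq {U : H1 n M} {f : M → ℝ} (hU : U.1 =ᵐ[vol n M] f) :
    U.abs.1 =ᵐ[vol n M] fun x => |f x| := by
  filter_upwards [Lp.coeFn_abs U.1, hU] with x h1 h2
  rw [coe_abs, h1, h2]

lemma neg_ae_eq {U V : H1 n M} (h : V.1 = -U.1) : V.1 =ᵐ[vol n M] fun x => -U.1 x := by
  rw [h]
  exact Lp.coeFn_neg U.1

/-- Sum of two truncations: of `u` at height `w⁺` and of `v` at height `w⁻`. -/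
protected noncomputable def merge (u v w : H1 n M) : H1 n M :=
  let p := (1 / 2 : ℝ) • (w.abs + w)
  let m := (1 / 2 : ℝ) • (w.abs + (-1 : ℝ) • w)
  (1 / 2 : ℝ) • (((u + p).abs + (-1 : ℝ) • (u + (-1 : ℝ) • p).abs) +
    ((v + m).abs + (-1 : ℝ) • (v + (-1 : ℝ) • m).abs))

/-- The pointwise version of `H1.merge`. -/
noncomputable def mergeFun (a b c : ℝ) : ℝ :=
  1 / 2 * ((|a + 1 / 2 * (|c| + c)| + -1 * |a + -1 * (1 / 2 * (|c| + c))|) +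
    (|b + 1 / 2 * (|c| + -1 * c)| + -1 * |b + -1 * (1 / 2 * (|c| + -1 * c))|))

lemma mergeFun_neg (a b c : ℝ) : mergeFun (-a) (-b) c = -mergeFun a b c := by
  have h : ∀ s t : ℝ, |-s + -1 * t| = |s + t| := fun s t => by
    rw [← abs_neg]
    congr 1
    ring
  have h' : ∀ s t : ℝ, |-s + t| = |s + -1 * t| := fun s t => by
    rw [← abs_neg]
    congr 1
    ring
  rw [mergeFun, mergeFun, h, h', h, h']
  ring

/-- At `c = 1` the negative part of `c` is `0`, and truncation at height `0` erases `b`. -/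
lemma mergeFun_one (a b : ℝ) : mergeFun a b 1 = mergeFun a 0 1 := by
  norm_num [mergeFun]

lemma mergeFun_neg_one (a b : ℝ) : mergeFun a b (-1) = mergeFun 0 b (-1) := by
  norm_num [mergeFun]

/-- The expression `(|a + c| - |a - c|) / 2` is the truncation of `a` to `[-c, c]`, written with
absolute values only. -/
lemma clip_mem (a : ℝ) {c : ℝ} (hc : 0 ≤ c) :
    1 / 2 * (|a + c| - |a - c|) = a ∨ 1 / 2 * (|a + c| - |a - c|) = c ∨
      1 / 2 * (|a + c| - |a - c|) = -c := by
  rcases abs_cases (a + c) with ⟨h1, h1'⟩ | ⟨h1, h1'⟩ <;>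
    rcases abs_cases (a - c) with ⟨h2, h2'⟩ | ⟨h2, h2'⟩ <;> rw [h1, h2]
  · right; left; ring
  · left; ring
  · left; linarith
  · right; right; ring

/-- One of `c⁺`, `c⁻` is zero, so only one of the two truncations survives. This pointwise
alternative is the source of the energy bound. -/
lemma mergeFun_mem (a b c : ℝ) : mergeFun a b c = a ∨ mergeFun a b c = b ∨ mergeFun a b c = c ∨
    mergeFun a b c = -c := by
  rcases le_total 0 c with hc | hc
  · have h : mergeFun a b c = 1 / 2 * (|a + c| - |a - c|) := by
      rw [mergeFun, abs_of_nonneg hc]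
      ring_nf
    rw [h]
    rcases clip_mem a hc with h | h | h <;> simp only [h, true_or, or_true]
  · have h : mergeFun a b c = 1 / 2 * (|b + -c| - |b - -c|) := by
      rw [mergeFun, abs_of_nonpos hc]
      ring_nf
    rw [h]
    rcases clip_mem b (neg_nonneg.2 hc) with h | h | h <;>
      simp only [h, neg_neg, true_or, or_true]

lemma merge_ae_eq {U V Z : H1 n M} {f g h : M → ℝ} (hU : U.1 =ᵐ[vol n M] f)
    (hV : V.1 =ᵐ[vol n M] g) (hZ : Z.1 =ᵐ[vol n M] h) :
    (H1.merge U V Z).1 =ᵐ[vol n M] fun x => mergeFun (f x) (g x) (h x) :=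
  have hp := smul_ae_eq (1 / 2) (add_ae_eq (abs_ae_eq hZ) hZ)
  have hm := smul_ae_eq (1 / 2) (add_ae_eq (abs_ae_eq hZ) (smul_ae_eq (-1) hZ))
  smul_ae_eq _ (add_ae_eq
    (add_ae_eq (abs_ae_eq (add_ae_eq hU hp))
      (smul_ae_eq _ (abs_ae_eq (add_ae_eq hU (smul_ae_eq _ hp)))))
    (add_ae_eq (abs_ae_eq (add_ae_eq hV hm))
      (smul_ae_eq _ (abs_ae_eq (add_ae_eq hV (smul_ae_eq _ hm))))))

/-- Merging is composed of linear operations and absolute values, so continuity of `u ↦ |u|` on `H¹`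
is the only analytic ingredient. -/
lemma continuous_merge {X : Type*} [TopologicalSpace X] {f g h : X → H1 n M} (hf : Continuous f)
    (hg : Continuous g) (hh : Continuous h) : Continuous fun x => H1.merge (f x) (g x) (h x) := by
  have ha {k : X → H1 n M} (hk : Continuous k) : Continuous fun x => (k x).abs :=
    continuous_abs.comp hk
  have hc {c : ℝ} {k : X → H1 n M} (hk : Continuous k) : Continuous fun x => c • k x :=
    (continuous_const (y := c)).smul hk
  have hp : Continuous fun x => (1 / 2 : ℝ) • ((h x).abs + h x) := hc ((ha hh).add hh)
  have hm : Continuous fun x => (1 / 2 : ℝ) • ((h x).abs + (-1 : ℝ) • h x) :=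
    hc ((ha hh).add (hc hh))
  exact hc (((ha (hf.add hp)).add (hc (ha (hf.add (hc hp))))).add
    ((ha (hg.add hm)).add (hc (ha (hg.add (hc hm))))))

lemma merge_neg {u u' v v' w : H1 n M} (hu : u'.1 = -u.1) (hv : v'.1 = -v.1) :
    (H1.merge u' v' w).1 = -(H1.merge u v w).1 := by
  refine Lp.ext ?_
  filter_upwards [merge_ae_eq (neg_ae_eq hu) (neg_ae_eq hv) (ae_eq_refl w.1),
    merge_ae_eq (ae_eq_refl u.1) (ae_eq_refl v.1) (ae_eq_refl w.1),
    Lp.coeFn_neg (H1.merge u v w).1] with x h1 h2 h3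
  rw [h1, h3, Pi.neg_apply, h2, mergeFun_neg]

/-- This independence, with its counterpart at `-1`, lets the merged family be defined at the ends
of a join, where one of the two points is lost. -/
lemma merge_eq_of_one {u v v' w : H1 n M} (hw : ∀ᵐ x ∂(vol n M), w.1 x = 1) :
    H1.merge u v w = H1.merge u v' w := by
  refine Subtype.ext (Lp.ext ?_)
  filter_upwards [merge_ae_eq (ae_eq_refl u.1) (ae_eq_refl v.1) (ae_eq_refl w.1),
    merge_ae_eq (ae_eq_refl u.1) (ae_eq_refl v'.1) (ae_eq_refl w.1), hw] with x h1 h2 h3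
  rw [h1, h2, h3, mergeFun_one, ← mergeFun_one]

lemma merge_eq_of_neg_one {u u' v w : H1 n M} (hw : ∀ᵐ x ∂(vol n M), w.1 x = -1) :
    H1.merge u v w = H1.merge u' v w := by
  refine Subtype.ext (Lp.ext ?_)
  filter_upwards [merge_ae_eq (ae_eq_refl u.1) (ae_eq_refl v.1) (ae_eq_refl w.1),
    merge_ae_eq (ae_eq_refl u'.1) (ae_eq_refl v.1) (ae_eq_refl w.1), hw] with x h1 h2 h3
  rw [h1, h2, h3, mergeFun_neg_one, ← mergeFun_neg_one]

end H1

lemma energy_merge_le (hWe : ∀ t, W (-t) = W t) (hWc : Continuous W) (u v w : H1 n M) :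
    energy n W ε (H1.merge u v w) ≤ energy n W ε u + energy n W ε v + energy n W ε w := by
  refine energy_le_add_add hWe hWc ?_
  filter_upwards [H1.merge_ae_eq (ae_eq_refl u.1) (ae_eq_refl v.1) (ae_eq_refl w.1)] with x hx
  rw [hx]
  exact H1.mergeFun_mem _ _ _

/-- The threshold of the whole argument: a family with energies below this value avoids the zero
function automatically. -/
lemma energy_of_eq_zero {u : H1 n M} (hu : u.1 = 0) :
    energy n W ε u = ENNReal.ofReal (W 0 / ε) * vol n M univ := by
  rw [← energy_const]
  refine energy_congr (hu.trans (Lp.ext ?_))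
  exact (Lp.coeFn_zero _ _ _).trans (H1.const_ae_eq 0).symm

/-! ### Finite-dimensional families of functions -/

section Combination

variable {ι : Type*} [Fintype ι] {f : ι → M → ℝ}
  {τ : ι → (x : M) → TangentSpace (𝓡 (n + 1)) x →L[ℝ] ℝ} {B : ℝ}

omit [MeasurableSpace M] [BorelSpace M] [EMetricSpace M]
  [ChartedSpace (EuclideanSpace ℝ (Fin (n + 1))) M] [IsManifold (𝓡 (n + 1)) ∞ M]
  [RiemannianBundle (fun x : M => TangentSpace (𝓡 (n + 1)) x)]
  [IsContMDiffRiemannianBundle (𝓡 (n + 1)) ∞ (EuclideanSpace ℝ (Fin (n + 1)))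
    (fun x : M => TangentSpace (𝓡 (n + 1)) x)]
  [IsRiemannianManifold (𝓡 (n + 1)) M] [CompactSpace M] in
lemma abs_sum_mul_le (hf : ∀ i x, |f i x| ≤ B) (a : ι → ℝ) (x : M) :
    |∑ i, a i * f i x| ≤ (∑ i, |a i|) * B := by
  rw [Finset.sum_mul]
  refine (Finset.abs_sum_le_sum_abs _ _).trans (Finset.sum_le_sum fun i _ => ?_)
  rw [abs_mul]
  exact mul_le_mul_of_nonneg_left (hf i x) (abs_nonneg _)

lemma norm_sum_smul_le (hτ : ∀ i x, ‖τ i x‖ ≤ B) (a : ι → ℝ) (x : M) :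
    ‖∑ i, a i • τ i x‖ ≤ (∑ i, |a i|) * B := by
  refine ContinuousLinearMap.opNorm_le_bound _ ?_ fun w => ?_
  · rw [Finset.sum_mul]
    exact Finset.sum_nonneg fun i _ => mul_nonneg (abs_nonneg _)
      ((τ i x).opNorm_nonneg.trans (hτ i x))
  · have h1 : (∑ i, a i • τ i x) w = ∑ i, a i * τ i x w := by
      simp
    rw [h1, Finset.sum_mul, Finset.sum_mul]
    refine (Finset.abs_sum_le_sum_abs _ _).trans (Finset.sum_le_sum fun i _ => ?_)
    rw [abs_mul, mul_assoc]
    refine mul_le_mul_of_nonneg_left ?_ (abs_nonneg _)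
    exact (τ i x).le_of_opNorm_le (hτ i x) w

/-- Linear combinations of bounded functions with bounded differentials. -/
noncomputable def H1.combination (h : ∀ i, IsWeakDifferential n (f i) (τ i))
    (hf : ∀ i x, |f i x| ≤ B) (hτ : ∀ i x, ‖τ i x‖ ≤ B) (a : ι → ℝ) : H1 n M :=
  H1.ofBounded _ _ (isWeakDifferential_sum Finset.univ h a) (abs_sum_mul_le hf a)
    (norm_sum_smul_le hτ a)

lemma H1.combination_ae_eq (h : ∀ i, IsWeakDifferential n (f i) (τ i))
    (hf : ∀ i x, |f i x| ≤ B) (hτ : ∀ i x, ‖τ i x‖ ≤ B) (a : ι → ℝ) :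
    (H1.combination h hf hτ a).1 =ᵐ[vol n M] fun x => ∑ i, a i * f i x :=
  H1.ofBounded_ae_eq _ _ _

lemma H1.continuous_combination (h : ∀ i, IsWeakDifferential n (f i) (τ i))
    (hf : ∀ i x, |f i x| ≤ B) (hτ : ∀ i x, ‖τ i x‖ ≤ B) :
    Continuous (H1.combination h hf hτ) := by
  rw [continuous_iff_continuousAt]
  intro b
  refine H1.tendsto_nhds_iff.2 fun δ hδ => ?_
  have h1 : Tendsto (fun a : ι → ℝ => ENNReal.ofReal (2 * ((∑ i, |a i - b i|) * B) ^ 2) *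
      vol n M univ) (𝓝 b) (𝓝 (ENNReal.ofReal (2 * ((∑ i, |b i - b i|) * B) ^ 2) *
      vol n M univ)) := by
    refine ENNReal.Tendsto.mul_const (Continuous.tendsto (f := fun a : ι → ℝ =>
      ENNReal.ofReal (2 * ((∑ i, |a i - b i|) * B) ^ 2)) ?_ b) (Or.inr (measure_ne_top _ _))
    exact ENNReal.continuous_ofReal.comp (by fun_prop)
  have h2 := h1.eventually_lt_const (u := δ) (by simpa using hδ)
  filter_upwards [h2] with a ha
  have h3 : SobolevLt n (fun x => ∑ i, (a i - b i) * f i x) δ :=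
    ⟨_, isWeakDifferential_sum Finset.univ h _,
      (sobolevEnergy_le (abs_sum_mul_le hf _) (norm_sum_smul_le hτ _)).trans_lt ha⟩
  refine h3.congr ?_
  filter_upwards [H1.combination_ae_eq h hf hτ a, H1.combination_ae_eq h hf hτ b] with x hx hx'
  rw [hx, hx', ← Finset.sum_sub_distrib]
  exact Finset.sum_congr rfl fun i _ => sub_mul _ _ _

lemma H1.combination_neg (h : ∀ i, IsWeakDifferential n (f i) (τ i))
    (hf : ∀ i x, |f i x| ≤ B) (hτ : ∀ i x, ‖τ i x‖ ≤ B) (a : ι → ℝ) :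
    (H1.combination h hf hτ (-a)).1 = -(H1.combination h hf hτ a).1 := by
  refine Lp.ext ?_
  filter_upwards [H1.combination_ae_eq h hf hτ a, H1.combination_ae_eq h hf hτ (-a),
    Lp.coeFn_neg (H1.combination h hf hτ a).1] with x h1 h2 h3
  rw [h2, h3, Pi.neg_apply, h1]
  simp

lemma energy_combination_le (h : ∀ i, IsWeakDifferential n (f i) (τ i))
    (hf : ∀ i x, |f i x| ≤ B) (hτ : ∀ i x, ‖τ i x‖ ≤ B) (hε : 0 < ε) {s : ℝ}
    (hs : ∀ t, |t| ≤ s → W t ≤ W 0) {a : ι → ℝ} (ha : (∑ i, |a i|) * B ≤ s) :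
    energy n W ε (H1.combination h hf hτ a) ≤
      ENNReal.ofReal (ε * s ^ 2 / 2 + W 0 / ε) * vol n M univ := by
  rw [H1.combination, energy_ofBounded, energyIntegral, ← lintegral_const]
  refine lintegral_mono fun x => ENNReal.ofReal_le_ofReal ?_
  have h1 := (norm_sum_smul_le hτ a x).trans ha
  have h2 := hs _ ((abs_sum_mul_le hf a x).trans ha)
  have h3 := pow_le_pow_left₀ (ContinuousLinearMap.opNorm_nonneg _) h1 2
  gcongr

end Combination

/-- Every free complex has equivariant maps to `H¹ ∖ {0}` with energy close to that of `0`. -/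
lemma exists_equivariantMap_energy_le [Nonempty M] (K : FreeZ2Complex) (hε : 0 < ε) {s : ℝ}
    (hs0 : 0 < s) (hs : ∀ t, |t| ≤ s → W t ≤ W 0) :
    ∃ h ∈ equivariantMaps n M K, ∀ x, energy n W ε (h x) ≤
      ENNReal.ofReal (ε * s ^ 2 / 2 + W 0 / ε) * vol n M univ := by
  -- The powers of `φ` are linearly independent in `L²`, and one of them is assigned to each vertex
  -- of the complex.
  obtain ⟨φ, hφ, hr⟩ := exists_contMDiff_infinite_range (n := n) (M := M)
  let e := Fintype.equivFin K.V
  have hpow : ∀ i : Fin (Fintype.card K.V),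
      ContMDiff (𝓡 (n + 1)) 𝓘(ℝ, ℝ) ∞ fun x => φ x ^ (i : ℕ) := fun i => hφ.pow _
  have hbd : ∀ i : Fin (Fintype.card K.V), ∃ B : ℝ, (∀ x, |φ x ^ (i : ℕ)| ≤ B) ∧
      ∀ x, ‖differential n (fun x => φ x ^ (i : ℕ)) x‖ ≤ B := by
    intro i
    obtain ⟨B₁, h1⟩ := isCompact_univ.exists_bound_of_continuousOn (hpow i).continuous.continuousOn
    obtain ⟨B₂, h2⟩ := exists_norm_differential_le (hpow i)
    exact ⟨max B₁ B₂, fun x => (h1 x trivial).trans (le_max_left _ _),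
      fun x => (h2 x).trans (le_max_right _ _)⟩
  choose B hB hB' using hbd
  set D := ∑ i, |B i|
  have hBD : ∀ i, B i ≤ D := fun i => (le_abs_self _).trans
    (Finset.single_le_sum (f := fun i => |B i|) (fun _ _ => abs_nonneg _) (Finset.mem_univ i))
  have hD : 0 ≤ D := Finset.sum_nonneg fun _ _ => abs_nonneg _
  have hf : ∀ (i : Fin (Fintype.card K.V)) x, |φ x ^ (i : ℕ)| ≤ D := fun i x => (hB i x).trans (hBD i)
  have hτ : ∀ (i : Fin (Fintype.card K.V)) x, ‖differential n (fun x => φ x ^ (i : ℕ)) x‖ ≤ D := fun i x =>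
    (hB' i x).trans (hBD i)
  have hwd := fun i => isWeakDifferential_of_contMDiff (hpow i)
  set N := Fintype.card K.V
  -- With `N` coefficients of size at most `t` and functions and differentials bounded by `D`, all
  -- values and differentials are bounded by `s`.
  obtain ⟨t, ht0, ht⟩ : ∃ t : ℝ, 0 < t ∧ N * t * D ≤ s := by
    refine ⟨s / (N * D + 1), by positivity, ?_⟩
    rw [mul_right_comm, mul_div_assoc', div_le_iff₀ (by positivity)]
    nlinarith
  -- Antisymmetrized barycentric coordinates: they change sign under the action and vanish
  -- simultaneously only at a fixed point, of which there is none.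
  let a : K.Space → Fin N → ℝ := fun x i => t * (x.1 (e.symm i) - x.1 (K.swap (e.symm i)))
  have ha : Continuous a := by
    refine continuous_pi fun i => continuous_const.mul (Continuous.sub ?_ ?_)
    · exact (continuous_apply _).comp continuous_subtype_val
    · exact (continuous_apply _).comp continuous_subtype_val
  refine ⟨⟨fun x => H1.combination hwd hf hτ (a x),
    (H1.continuous_combination hwd hf hτ).comp ha⟩, ⟨fun x h0 => ?_, fun x => ?_⟩, fun x => ?_⟩
  · have h1 := H1.combination_ae_eq hwd hf hτ (a x)
    have h2 : (H1.combination hwd hf hτ (a x)).1 = 0 := h0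
    rw [h2] at h1
    have h3 := eq_zero_of_sum_mul_pow_ae_eq_zero (n := n) hφ.continuous hr
      (h1.symm.trans (Lp.coeFn_zero _ _ _))
    refine K.free x.1 x.2 (funext fun v => ?_)
    have h4 := congr_fun h3 (e v)
    simp only [a, Equiv.symm_apply_apply, Pi.zero_apply, mul_eq_zero, ht0.ne', false_or] at h4
    linarith
  · have h1 : a (K.T x) = -a x := by
      ext i
      simp only [a, FreeZ2Complex.T, K.swap_swap, Pi.neg_apply]
      ring
    change (H1.combination hwd hf hτ (a (K.T x))).1 = _
    rw [h1]
    exact H1.combination_neg hwd hf hτ (a x)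
  · refine energy_combination_le hwd hf hτ hε hs (le_trans ?_ ht)
    gcongr
    have h1 : ∀ v, |x.1 v - x.1 (K.swap v)| ≤ 1 := by
      intro v
      have h0 := x.2.1
      have hle : ∀ v, x.1 v ≤ 1 := fun v => h0.2 ▸
        Finset.single_le_sum (f := x.1) (fun v _ => h0.1 v) (Finset.mem_univ v)
      rw [abs_le]
      constructor <;> linarith [h0.1 v, h0.1 (K.swap v), hle v, hle (K.swap v)]
    calc ∑ i, |a x i| ≤ ∑ i : Fin N, t := by
          refine Finset.sum_le_sum fun i _ => ?_
          rw [abs_mul, abs_of_pos ht0]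
          exact mul_le_of_le_one_right ht0.le (h1 _)
      _ = N * t := by simp

/-- The family of the preceding lemma is shrunk to zero by letting `s → 0`; this is where the local
maximum of `W` at `0` is used. -/
lemma cSpectrum_le_of_le_index [Nonempty M] (hW : IsDoubleWell W) (hε : 0 < ε) {p : ℕ}
    {K : FreeZ2Complex} (hK : (p : ℕ∞) + 1 ≤ K.index) :
    cSpectrum n M W ε p ≤ ENNReal.ofReal (W 0 / ε) * vol n M univ := by
  rw [cSpectrum]
  split_ifs with hp
  · exact zero_le
  obtain ⟨r, hr0, hr⟩ := Metric.eventually_nhds_iff.1 hW.localMax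
  have h1 : Tendsto (fun s : ℝ => ENNReal.ofReal (ε * s ^ 2 / 2 + W 0 / ε) * vol n M univ)
      (𝓝[>] 0) (𝓝 (ENNReal.ofReal (ε * 0 ^ 2 / 2 + W 0 / ε) * vol n M univ)) := by
    refine (ENNReal.Tendsto.mul_const (Continuous.tendsto (f := fun s : ℝ =>
      ENNReal.ofReal (ε * s ^ 2 / 2 + W 0 / ε)) ?_ 0)
      (Or.inr (measure_ne_top _ _))).mono_left nhdsWithin_le_nhds
    exact ENNReal.continuous_ofReal.comp (by fun_prop)
  simp only [ne_eq, OfNat.ofNat_ne_zero, not_false_eq_true, zero_pow, mul_zero, zero_div,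
    zero_add] at h1
  refine ge_of_tendsto h1 ?_
  filter_upwards [Ioo_mem_nhdsGT hr0] with s hs
  obtain ⟨h, hh, hle⟩ := exists_equivariantMap_energy_le (n := n) (M := M) (W := W) K hε hs.1
    (fun t ht => hr (y := t) (by simpa using ht.trans_lt hs.2))
  exact (iInf₂_le_of_le K hK (iInf₂_le_of_le h hh (iSup_le hle)))

lemma H1.continuous_const : Continuous (H1.const n M) := by
  have h : ∀ _ : Unit, IsWeakDifferential n (fun _ : M => (1 : ℝ)) (fun _ => 0) := fun _ =>
    isWeakDifferential_const 1
  have h1 := H1.continuous_combination h (B := 1) (fun _ _ => by simp)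
    (fun _ x => by rw [norm_zero_covector]; exact zero_le_one)
  have h2 : H1.const n M = fun c => H1.combination h (B := 1) (fun _ _ => by simp)
      (fun _ x => by rw [norm_zero_covector]; exact zero_le_one) (fun _ => c) := by
    ext1 c
    refine Subtype.ext (Lp.ext ((H1.const_ae_eq c).trans ?_))
    refine EventuallyEq.symm ((H1.combination_ae_eq h _ _ _).trans ?_)
    simp [EventuallyEq.refl]
  rw [h2]
  exact h1.comp (continuous_pi fun _ => continuous_id)

/-- The path of constants from `1` to `-1` has bounded energy. -/
lemma gammaWidth_ne_top (hW : IsDoubleWell W) (hε : 0 < ε) : gammaWidth n M W ε ≠ ⊤ := by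
  obtain ⟨C, hC⟩ := hW.bounded
  let h : C(unitInterval, H1 n M) :=
    ⟨fun t => H1.const n M (1 - 2 * (t : ℝ)), H1.continuous_const.comp (by fun_prop)⟩
  have hh : h ∈ connectingPaths n M := by
    constructor
    · filter_upwards [H1.const_ae_eq (n := n) (M := M) (1 - 2 * ((0 : unitInterval) : ℝ))] with x hx
      refine hx.trans ?_
      norm_num
    · filter_upwards [H1.const_ae_eq (n := n) (M := M) (1 - 2 * ((1 : unitInterval) : ℝ))] with x hx
      refine hx.trans ?_
      norm_num
  refine ((iInf₂_le h hh).trans_lt (b := ⨆ t, energy n W ε (h t)) ?_).ne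
  refine (iSup_le fun t => ?_).trans_lt (ENNReal.mul_lt_top ENNReal.ofReal_lt_top
    (measure_lt_top (vol n M) univ) : ENNReal.ofReal (C / ε) * vol n M univ < ⊤)
  refine (energy_const _).trans_le ?_
  gcongr
  exact (le_abs_self _).trans (hC _)

end AllenCahn

end Energy


/-! ### Orbit spaces of free involutions -/

section OrbitSpaces

open Topology

namespace AllenCahn

variable {X : Type*} [TopologicalSpace X] {T : X → X}

/-- A continuous involution without fixed points. -/
structure IsFreeInvolution (T : X → X) : Prop where
  continuous : Continuous T
  involutive : ∀ x, T (T x) = x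
  free : ∀ x, T x ≠ x

/-- The projection to the orbit space. -/
def orbitProj (T : X → X) : C(X, OrbitSpace T) := ⟨Quot.mk _, continuous_quot_mk⟩

lemma orbitProj_surjective : Function.Surjective (orbitProj T) := Quot.mk_surjective

lemma orbitProj_apply_map (x : X) : orbitProj T (T x) = orbitProj T x :=
  (Quot.sound (r := fun x y => y = T x) rfl).symm

namespace IsFreeInvolution

variable (hT : IsFreeInvolution T)
include hT

lemma orbitProj_eq_iff {x y : X} : orbitProj T x = orbitProj T y ↔ x = y ∨ x = T y := by
  constructor
  · intro h
    -- The quotient is by the generated equivalence relation; membership of `x` in an orbit is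
    -- respected by the generators, so it descends.
    let F : OrbitSpace T → Prop := Quot.lift (fun z => x = z ∨ x = T z) fun a b (hab : b = T a) => by
      rw [hab, hT.involutive, or_comm]
    have h1 : F (orbitProj T x) := Or.inl rfl
    rwa [h] at h1
  · rintro (rfl | rfl)
    · rfl
    · exact orbitProj_apply_map y

/-- A free involution of a Hausdorff space is a properly discontinuous action of the group `{1,
-1}`: disjoint neighbourhoods of `x` and `T x` yield one that is disjoint from its translate. -/
lemma isCoveringMap_orbitProj [T2Space X] : IsCoveringMap (orbitProj T) := by
  classical
  let _ : MulAction ℤˣ X :=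
    { smul := fun g x => if g = 1 then x else T x
      one_smul := fun x => if_pos rfl
      mul_smul := fun g h x => by
        change (if g * h = 1 then x else T x) =
          if g = 1 then (if h = 1 then x else T x) else T (if h = 1 then x else T x)
        rcases Int.units_eq_one_or g with rfl | rfl <;>
          rcases Int.units_eq_one_or h with rfl | rfl <;> simp [hT.involutive] }
  have hsmul : ∀ x : X, (-1 : ℤˣ) • x = T x := fun x => if_neg (by decide)
  have h : IsQuotientCoveringMap (orbitProj T) ℤˣ :=
    { toIsQuotientMap := isQuotientMap_quot_mk
      continuous_const_smul := fun g => by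
        rcases Int.units_eq_one_or g with rfl | rfl
        · exact continuous_id.congr fun x => (one_smul _ x).symm
        · exact hT.continuous.congr fun x => (hsmul x).symm
      apply_eq_iff_mem_orbit := fun {x y} => by
        rw [hT.orbitProj_eq_iff, MulAction.mem_orbit_iff]
        constructor
        · rintro (rfl | rfl)
          · exact ⟨1, one_smul _ _⟩
          · exact ⟨-1, hsmul _⟩
        · rintro ⟨g, rfl⟩
          rcases Int.units_eq_one_or g with rfl | rfl
          · exact Or.inl (one_smul _ _)
          · exact Or.inr (hsmul _)
      disjoint := fun x => by
        obtain ⟨U, V, hU, hV, hxU, hxV, hUV⟩ := t2_separation (hT.free x).symm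
        refine ⟨U ∩ T ⁻¹' V, (hU.inter (hV.preimage hT.continuous)).mem_nhds ⟨hxU, hxV⟩, ?_⟩
        rintro g ⟨_, ⟨y, hy, rfl⟩, hy'⟩
        rcases Int.units_eq_one_or g with rfl | rfl
        · rfl
        · simp only [hsmul] at hy'
          exact (Set.disjoint_left.1 hUV hy'.1 hy.2).elim }
  exact h.isCoveringMap

/-- Singular simplices lift to the total space. -/
lemma exists_lift [T2Space X] {p : ℕ} (σ : SingularSimplex (OrbitSpace T) p) :
    ∃ τ : SingularSimplex X p, (orbitProj T).comp τ = σ := by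
  have hconv := convex_stdSimplex ℝ (Fin (p + 1))
  have := hconv.locallyPathConnectedSpace
  have : ContractibleSpace (stdSimplex ℝ (Fin (p + 1))) :=
    hconv.contractibleSpace ⟨_, single_mem_stdSimplex ℝ 0⟩
  obtain ⟨x, hx⟩ := orbitProj_surjective (σ (stdSimplex.vertex 0))
  obtain ⟨τ, ⟨-, hτ⟩, -⟩ := hT.isCoveringMap_orbitProj.existsUnique_continuousMap_lifts σ
    (stdSimplex.vertex 0) x hx
  exact ⟨τ, ContinuousMap.ext fun y => congr_fun hτ y⟩

/-- The lifts of a connected space are unique up to the involution. -/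
lemma lift_unique [T2Space X] {A : Type*} [TopologicalSpace A] [PreconnectedSpace A] [Nonempty A]
    {σ τ : C(A, X)} (h : (orbitProj T).comp σ = (orbitProj T).comp τ) :
    σ = τ ∨ σ = (⟨T, hT.continuous⟩ : C(X, X)).comp τ := by
  obtain ⟨a⟩ := ‹Nonempty A›
  have hT' : ∀ y, orbitProj T (T y) = orbitProj T y := orbitProj_apply_map
  rcases hT.orbitProj_eq_iff.1 (congr($h a)) with ha | ha
  · left
    exact ContinuousMap.ext (congr_fun (hT.isCoveringMap_orbitProj.eq_of_comp_eq σ.continuous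
      τ.continuous (funext fun x => congr($h x)) a ha))
  · right
    refine ContinuousMap.ext (congr_fun (hT.isCoveringMap_orbitProj.eq_of_comp_eq σ.continuous
      (ContinuousMap.continuous _) (funext fun x => ?_) a ha))
    exact (congr($h x)).trans (hT' _).symm

end IsFreeInvolution

end AllenCahn

end OrbitSpaces

/-! ### Chains with coefficients in `ℤ/2` and invariant cochains -/

section Chains

open Topology

namespace AllenCahn

variable {X : Type*} [TopologicalSpace X] {T : X → X}

/-- Maps from the simplex with `p` vertices; for `p = 0` there is exactly one. -/
abbrev Simplex (X : Type*) [TopologicalSpace X] (p : ℕ) : Type _ := C(stdSimplex ℝ (Fin p), X)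

/-- The map of standard simplices which is given by `f` on the vertices. -/
noncomputable def vertexMap {p q : ℕ} (f : Fin p → Fin q) :
    C(stdSimplex ℝ (Fin p), stdSimplex ℝ (Fin q)) :=
  ⟨stdSimplex.map f, stdSimplex.continuous_map f⟩

lemma simplexMap_eq {p q : ℕ} (f : Fin (p + 1) → Fin (q + 1)) : simplexMap f = vertexMap f := rfl

/-- The faces of a simplex. -/
noncomputable def Simplex.face {p : ℕ} (σ : Simplex X (p + 1)) (i : Fin (p + 1)) : Simplex X p :=
  σ.comp (vertexMap i.succAbove)

/-- Chains with coefficients in `ℤ/2`. -/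
abbrev Chain (X : Type*) [TopologicalSpace X] (p : ℕ) : Type _ := Simplex X p →₀ ZMod 2

/-- The value of a cochain on a chain. -/
noncomputable def eval {p : ℕ} (a : Simplex X p → ZMod 2) : Chain X p →ₗ[ZMod 2] ZMod 2 :=
  Finsupp.linearCombination (ZMod 2) a

/-- The (augmented) boundary. -/
noncomputable def boundary (p : ℕ) : Chain X (p + 1) →ₗ[ZMod 2] Chain X p :=
  Finsupp.linearCombination (ZMod 2) fun σ => ∑ i, Finsupp.single (σ.face i) 1

/-- The map of chains induced by a continuous map. -/
noncomputable def chainMap {Y : Type*} [TopologicalSpace Y] (f : C(X, Y)) (p : ℕ) :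
    Chain X p →ₗ[ZMod 2] Chain Y p :=
  Finsupp.lmapDomain _ _ fun σ => f.comp σ

lemma eval_single {p : ℕ} (a : Simplex X p → ZMod 2) (σ : Simplex X p) :
    eval a (Finsupp.single σ 1) = a σ := by
  simp [eval]

lemma eval_boundary_single {p : ℕ} (b : Simplex X p → ZMod 2) (σ : Simplex X (p + 1)) :
    eval b (boundary p (Finsupp.single σ 1)) = ∑ i, b (σ.face i) := by
  simp [boundary, eval]

lemma chainMap_single {Y : Type*} [TopologicalSpace Y] (f : C(X, Y)) {p : ℕ} (σ : Simplex X p) :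
    chainMap f p (Finsupp.single σ 1) = Finsupp.single (f.comp σ) 1 := by
  simp [chainMap]

lemma boundary_chainMap {Y : Type*} [TopologicalSpace Y] (f : C(X, Y)) {p : ℕ}
    (c : Chain X (p + 1)) : boundary p (chainMap f (p + 1) c) = chainMap f p (boundary p c) := by
  induction c using Finsupp.induction_linear with
  | zero => simp
  | add c d hc hd => simp only [map_add, hc, hd]
  | single σ r =>
    rw [← mul_one r, ← smul_eq_mul, ← Finsupp.smul_single, map_smul, map_smul, map_smul, map_smul,
      chainMap_single]
    simp only [boundary, Finsupp.linearCombination_single, one_smul, map_sum, chainMap_single]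
    rfl

/-- A functional on a vector space which vanishes on the kernel of a linear map factors through
the linear map. -/
lemma exists_factor_of_ker_le {k V V' : Type*} [Field k] [AddCommGroup V] [Module k V]
    [AddCommGroup V'] [Module k V'] (L : V →ₗ[k] V') (a : V →ₗ[k] k)
    (h : ∀ v, L v = 0 → a v = 0) : ∃ β : V' →ₗ[k] k, ∀ v, a v = β (L v) := by
  have h1 : a ∈ LinearMap.range L.dualMap := by
    rw [LinearMap.range_dualMap_eq_dualAnnihilator_ker, Submodule.mem_dualAnnihilator]
    exact fun v hv => h v hv
  obtain ⟨β, hβ⟩ := h1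
  exact ⟨β, fun v => by rw [← hβ]; rfl⟩

namespace IsFreeInvolution

variable (hT : IsFreeInvolution T)
include hT

/-- If a cochain on the orbit space is not a coboundary, then there is a chain in the total space
whose boundary is invariant and on which the lifted cochain takes the value `1`. -/
lemma exists_chain [T2Space X] {p : ℕ} {a' : Cochain (OrbitSpace T) p} (ha' : ¬ IsCoboundary a')
    {a : SingularSimplex X p → ZMod 2} (ha : ∀ σ, a' ((orbitProj T).comp σ) = a σ) :
    ∃ c : Chain X (p + 1),
      chainMap ⟨T, hT.continuous⟩ p (boundary p c) = boundary p c ∧ eval a c = 1 := by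
  set t : C(X, X) := ⟨T, hT.continuous⟩ with ht
  have htt : ∀ {q : ℕ} (σ : Simplex X q), t.comp (t.comp σ) = σ := fun σ =>
    ContinuousMap.ext fun x => hT.involutive _
  by_contra! hcon
  have h2 : ∀ r : ZMod 2, r ≠ 1 → r = 0 := by decide
  -- By contradiction: if the cochain vanished on all chains killed by `(1 + T)∂`, it would factor
  -- through that map. It would then be the coboundary of `τ ↦ β(Tτ + τ)`, which is invariant and
  -- descends to the orbit space.
  obtain ⟨β, hβ⟩ := exists_factor_of_ker_le
    ((chainMap t p + LinearMap.id).comp (boundary p)) (eval a) fun c hc => by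
      refine h2 _ (hcon c ?_)
      simp only [LinearMap.comp_apply, LinearMap.add_apply, LinearMap.id_apply] at hc
      rwa [← sub_eq_zero, ZModModule.sub_eq_add]
  have hab : ∀ σ : Simplex X (p + 1),
      a σ = eval (fun τ => β (Finsupp.single (t.comp τ) 1 + Finsupp.single τ 1))
        (boundary p (Finsupp.single σ 1)) := by
    intro σ
    rw [← eval_single a σ, hβ, eval_boundary_single]
    simp [boundary, chainMap_single, Finset.sum_add_distrib]
  set b : Simplex X p → ZMod 2 := fun τ => β (Finsupp.single (t.comp τ) 1 + Finsupp.single τ 1)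
  have hbT : ∀ τ, b (t.comp τ) = b τ := by
    intro τ
    simp only [b, htt, add_comm]
  choose lift hlift using fun σ : SingularSimplex (OrbitSpace T) p => hT.exists_lift σ
  -- In degree `0` the boundary is augmented. The involution fixes the empty simplex, so the
  -- invariant cochain is twice `β`, that is `0`; this matches the convention that only `0` is a
  -- coboundary in degree `0`.
  rcases p with _ | p
  · refine ha' (funext fun σ => ?_)
    rw [← hlift σ, ha, hab, eval_boundary_single]
    have hb : ∀ τ, b τ = 0 := by
      intro τ
      have h3 : t.comp τ = τ := ContinuousMap.ext fun x => by
        have : IsEmpty (stdSimplex ℝ (Fin 0)) := by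
          rw [stdSimplex_of_isEmpty_index]
          infer_instance
        exact this.elim x
      simp only [b, h3, ZModModule.add_self, map_zero]
    simp [hb]
  · choose lift' hlift' using fun σ : SingularSimplex (OrbitSpace T) p => hT.exists_lift σ
    refine ha' ⟨fun σ => b (lift' σ), funext fun σ => ?_⟩
    obtain ⟨τ, rfl⟩ := hT.exists_lift σ
    rw [ha, hab, eval_boundary_single]
    refine Finset.sum_congr rfl fun i _ => ?_
    have h4 : (orbitProj T).comp (lift' (((orbitProj T).comp τ).comp (simplexMap i.succAbove))) =
        (orbitProj T).comp (Simplex.face τ i) := hlift' _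
    rcases hT.lift_unique h4 with h5 | h5
    · exact congr_arg b h5
    · exact (congr_arg b h5).trans (hbT _)

/-- The lift of a coboundary on the orbit space is the coboundary of an invariant cochain. -/
lemma exists_invariant_of_isCoboundary {p : ℕ} {a' : Cochain (OrbitSpace T) p}
    (ha' : IsCoboundary a') :
    ∃ b : Simplex X p → ZMod 2, (∀ σ, b ((⟨T, hT.continuous⟩ : C(X, X)).comp σ) = b σ) ∧
      ∀ σ : Simplex X (p + 1), a' ((orbitProj T).comp σ) = ∑ i, b (σ.face i) := by
  rcases p with _ | p
  · exact ⟨0, fun _ => rfl, fun σ => by rw [show a' = 0 from ha']; simp⟩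
  · obtain ⟨b', rfl⟩ := ha'
    refine ⟨fun σ => b' ((orbitProj T).comp σ), fun σ => ?_, fun σ => rfl⟩
    exact congr_arg b' (ContinuousMap.ext fun x => orbitProj_apply_map (σ x))

end IsFreeInvolution

end AllenCahn

end Chains


/-! ### One-dimensional cocycles -/

section OneCocycles

namespace AllenCahn

variable {X : Type*} [TopologicalSpace X]

lemma vertexMap_apply {p q : ℕ} (f : Fin p → Fin q) (y : stdSimplex ℝ (Fin p)) (k : Fin q) :
    vertexMap f y k = ∑ j with f j = k, y j :=
  FunOnFinite.linearMap_apply_apply ..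

lemma vertexMap_apply_of_iff {p q : ℕ} {f : Fin p → Fin q} {i : Fin p} {k : Fin q}
    (h : ∀ j, f j = k ↔ j = i) (y : stdSimplex ℝ (Fin p)) : vertexMap f y k = y i := by
  rw [vertexMap_apply, Finset.filter_congr fun j _ => h j, Finset.filter_eq', if_pos
    (Finset.mem_univ i), Finset.sum_singleton]

lemma vertexMap_apply_of_ne {p q : ℕ} {f : Fin p → Fin q} {k : Fin q}
    (h : ∀ j, f j ≠ k) (y : stdSimplex ℝ (Fin p)) : vertexMap f y k = 0 := by
  rw [vertexMap_apply, Finset.filter_false_of_mem fun j _ => h j, Finset.sum_empty]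

lemma vertexMap_comp {p q r : ℕ} (f : Fin p → Fin q) (g : Fin q → Fin r)
    (y : stdSimplex ℝ (Fin p)) : vertexMap g (vertexMap f y) = vertexMap (g ∘ f) y :=
  stdSimplex.map_comp_apply f g y

lemma vertexMap_vertex {p q : ℕ} (f : Fin p → Fin q) (i : Fin p) :
    vertexMap f (stdSimplex.vertex i) = stdSimplex.vertex (f i) :=
  stdSimplex.map_vertex f i

lemma vertexMap_const {p q : ℕ} (k : Fin q) (y : stdSimplex ℝ (Fin p)) :
    vertexMap (fun _ => k) y = stdSimplex.vertex k := by
  ext j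
  rw [vertexMap_apply, stdSimplex.vertex_coe]
  rcases eq_or_ne k j with rfl | h
  · simp
  · simp [h]

/-- A barycentric coordinate. -/
def coord {p : ℕ} (i : Fin p) : C(stdSimplex ℝ (Fin p), unitInterval) :=
  ⟨fun y => ⟨y i, stdSimplex.zero_le y i, stdSimplex.le_one y i⟩,
    ((continuous_apply i).comp continuous_subtype_val).subtype_mk _⟩

lemma coboundary_one {a : Cochain X 1} (τ : SingularSimplex X 2) :
    coboundary a τ = a (τ.comp (simplexMap (Fin.succAbove 0))) +
      a (τ.comp (simplexMap (Fin.succAbove 1))) + a (τ.comp (simplexMap (Fin.succAbove 2))) := by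
  simp [coboundary, Fin.sum_univ_three]

/-- The values of a `0`-cochain on the end points of a `1`-simplex. -/
def endpointSum (s : X → ZMod 2) (σ : SingularSimplex X 1) : ZMod 2 :=
  s (σ (stdSimplex.vertex 0)) + s (σ (stdSimplex.vertex 1))

section Contraction

variable {x₀ : X} (H : (ContinuousMap.id X).Homotopy (ContinuousMap.const X x₀))

/-- The trace of a point under a contraction. -/
def tracePath (x : X) : SingularSimplex X 1 :=
  ⟨fun y => H (coord 1 y, x), by fun_prop⟩

lemma tracePath_zero (x : X) : tracePath H x (stdSimplex.vertex 0) = x := by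
  have h : coord (1 : Fin 2) (stdSimplex.vertex 0) = 0 := Subtype.ext (by simp [coord])
  change H (coord (1 : Fin 2) (stdSimplex.vertex 0), x) = x
  rw [h]
  simp

lemma tracePath_one (x : X) : tracePath H x (stdSimplex.vertex 1) = x₀ := by
  have h : coord (1 : Fin 2) (stdSimplex.vertex 1) = 1 := Subtype.ext (by simp [coord])
  change H (coord (1 : Fin 2) (stdSimplex.vertex 1), x) = x₀
  rw [h]
  simp

/-- A `1`-cocycle on a contractible space is a coboundary. -/
lemma IsCocycle.eq_endpointSum {a : Cochain X 1} (ha : IsCocycle a) (σ : SingularSimplex X 1) :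
    a σ = endpointSum (fun x => a (tracePath H x)) σ := by
  -- The homotopy maps a square over `σ` to `X`. `D` is its diagonal and `t₁`, `t₂` are the two
  -- triangles; their remaining edges are `σ`, the traces of the two end points, and the constant
  -- edge at `x₀`.
  let D : SingularSimplex X 1 := ⟨fun y => H (coord 1 y, σ y), by fun_prop⟩
  let t₁ : SingularSimplex X 2 :=
    ⟨fun y => H (coord 2 y, σ (vertexMap ![0, 1, 1] y)), by fun_prop⟩
  let t₂ : SingularSimplex X 2 :=
    ⟨fun y => H (unitInterval.symm (coord 0 y), σ (vertexMap ![0, 0, 1] y)), by fun_prop⟩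
  let k : SingularSimplex X 1 := ContinuousMap.const _ x₀
  have hv01 : ∀ y : stdSimplex ℝ (Fin 2), vertexMap ![0, 1] y = y := fun y => by
    have : (![0, 1] : Fin 2 → Fin 2) = id := by decide
    rw [this]
    exact stdSimplex.map_id_apply y
  -- All three edges of the constant `2`-simplex are `k`, so the cocycle condition reads `3 a(k) =
  -- 0`.
  have hk : a k = 0 := by
    have h1 := congr_fun ha (ContinuousMap.const _ x₀)
    rw [coboundary_one] at h1
    have h2 : a k + a k + a k = 0 := h1
    rwa [CharTwo.add_self_eq_zero, zero_add] at h2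
  have e10 : t₁.comp (simplexMap (Fin.succAbove 0)) = tracePath H (σ (stdSimplex.vertex 1)) := by
    ext y
    change H (coord 2 (vertexMap (Fin.succAbove 0) y),
      σ (vertexMap ![0, 1, 1] (vertexMap (Fin.succAbove 0) y))) = H (coord 1 y, _)
    have h1 : coord 2 (vertexMap (Fin.succAbove (0 : Fin 3)) y) = coord 1 y := Subtype.ext <|
      vertexMap_apply_of_iff (by decide) y
    have h2 : (![0, 1, 1] : Fin 3 → Fin 2) ∘ Fin.succAbove (0 : Fin 3) = fun _ => 1 := by decide
    rw [h1, vertexMap_comp, h2, vertexMap_const]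
  have e11 : t₁.comp (simplexMap (Fin.succAbove 1)) = D := by
    ext y
    change H (coord 2 (vertexMap (Fin.succAbove 1) y),
      σ (vertexMap ![0, 1, 1] (vertexMap (Fin.succAbove 1) y))) = H (coord 1 y, σ y)
    have h1 : coord 2 (vertexMap (Fin.succAbove (1 : Fin 3)) y) = coord 1 y := Subtype.ext <|
      vertexMap_apply_of_iff (by decide) y
    have h2 : (![0, 1, 1] : Fin 3 → Fin 2) ∘ Fin.succAbove (1 : Fin 3) = ![0, 1] := by decide
    rw [h1, vertexMap_comp, h2, hv01]
  have e12 : t₁.comp (simplexMap (Fin.succAbove 2)) = σ := by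
    ext y
    change H (coord 2 (vertexMap (Fin.succAbove 2) y),
      σ (vertexMap ![0, 1, 1] (vertexMap (Fin.succAbove 2) y))) = σ y
    have h1 : coord 2 (vertexMap (Fin.succAbove (2 : Fin 3)) y) = 0 := Subtype.ext <|
      vertexMap_apply_of_ne (by decide) y
    have h2 : (![0, 1, 1] : Fin 3 → Fin 2) ∘ Fin.succAbove (2 : Fin 3) = ![0, 1] := by decide
    rw [h1, vertexMap_comp, h2, hv01]
    simp
  have e20 : t₂.comp (simplexMap (Fin.succAbove 0)) = k := by
    ext y
    change H (unitInterval.symm (coord 0 (vertexMap (Fin.succAbove 0) y)),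
      σ (vertexMap ![0, 0, 1] (vertexMap (Fin.succAbove 0) y))) = x₀
    have h1 : coord 0 (vertexMap (Fin.succAbove (0 : Fin 3)) y) = 0 := Subtype.ext <|
      vertexMap_apply_of_ne (by decide) y
    rw [h1]
    simp
  have e21 : t₂.comp (simplexMap (Fin.succAbove 1)) = D := by
    ext y
    change H (unitInterval.symm (coord 0 (vertexMap (Fin.succAbove 1) y)),
      σ (vertexMap ![0, 0, 1] (vertexMap (Fin.succAbove 1) y))) = H (coord 1 y, σ y)
    have h1 : unitInterval.symm (coord 0 (vertexMap (Fin.succAbove (1 : Fin 3)) y)) = coord 1 y := by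
      refine Subtype.ext ?_
      have h3 : ((coord 0 (vertexMap (Fin.succAbove (1 : Fin 3)) y) : unitInterval) : ℝ) = y 0 :=
        vertexMap_apply_of_iff (by decide) y
      rw [unitInterval.coe_symm_eq, h3]
      have := stdSimplex.add_eq_one y
      change 1 - y 0 = y 1
      linarith
    have h2 : (![0, 0, 1] : Fin 3 → Fin 2) ∘ Fin.succAbove (1 : Fin 3) = ![0, 1] := by decide
    rw [h1, vertexMap_comp, h2, hv01]
  have e22 : t₂.comp (simplexMap (Fin.succAbove 2)) = tracePath H (σ (stdSimplex.vertex 0)) := by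
    ext y
    change H (unitInterval.symm (coord 0 (vertexMap (Fin.succAbove 2) y)),
      σ (vertexMap ![0, 0, 1] (vertexMap (Fin.succAbove 2) y))) = H (coord 1 y, _)
    have h1 : unitInterval.symm (coord 0 (vertexMap (Fin.succAbove (2 : Fin 3)) y)) = coord 1 y := by
      refine Subtype.ext ?_
      have h3 : ((coord 0 (vertexMap (Fin.succAbove (2 : Fin 3)) y) : unitInterval) : ℝ) = y 0 :=
        vertexMap_apply_of_iff (by decide) y
      rw [unitInterval.coe_symm_eq, h3]
      have := stdSimplex.add_eq_one y
      change 1 - y 0 = y 1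
      linarith
    have h2 : (![0, 0, 1] : Fin 3 → Fin 2) ∘ Fin.succAbove (2 : Fin 3) = fun _ => 0 := by decide
    rw [h1, vertexMap_comp, h2, vertexMap_const]
  have h1 := congr_fun ha t₁
  have h2 := congr_fun ha t₂
  rw [coboundary_one, e10, e11, e12] at h1
  rw [coboundary_one, e20, e21, e22, hk, zero_add] at h2
  have h3 : ∀ p d q r : ZMod 2, p + d + q = 0 → d + r = 0 → q = r + p := by decide
  exact h3 _ _ _ _ h1 h2

end Contraction

/-- The cup powers of the cocycle `endpointSum s`. -/
def altPow (s : X → ZMod 2) (p : ℕ) (σ : SingularSimplex X p) : ZMod 2 :=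
  ∏ i : Fin p, (s (σ (stdSimplex.vertex i.castSucc)) + s (σ (stdSimplex.vertex i.succ)))

/-- Once the lift of `ξ` is the coboundary of `s`, its `p`-th power on a simplex is the product over
consecutive vertices: it is `1` exactly when `s` alternates along the vertices. -/
lemma cupPow_eq_altPow {Y : Type*} [TopologicalSpace Y] (f : C(X, Y)) {ξ : Cochain Y 1}
    {s : X → ZMod 2} (h : ∀ σ, ξ (f.comp σ) = endpointSum s σ) (p : ℕ) (σ : SingularSimplex X p) :
    cupPow ξ p (f.comp σ) = altPow s p σ := by
  induction p with
  | zero => simp [cupPow, altPow]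
  | succ p ih =>
    change cupPow ξ p (f.comp (σ.comp _)) * ξ (f.comp (σ.comp _)) = _
    rw [ih, h, altPow, altPow, Fin.prod_univ_castSucc, endpointSum]
    simp only [simplexMap_eq, ContinuousMap.comp_apply, vertexMap_vertex]
    rfl

end AllenCahn

end OneCocycles


/-! ### The infinite dimensional sphere -/

section InfiniteSphere

namespace AllenCahn

/-- Embedding of `ℓ²` into itself by an injective map of the indices. -/
noncomputable def reindex (j : ℕ → ℕ) (hj : Function.Injective j) :
    lp (fun _ : ℕ => ℝ) 2 →ₗᵢ[ℝ] lp (fun _ : ℕ => ℝ) 2 where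
  toFun x := ⟨Function.extend j x 0, by
    refine memℓp_gen ?_
    have h := (memℓp_gen_iff (p := 2) (by simp)).1 x.2
    rw [← summable_extend_zero hj] at h
    convert h using 2 with k
    by_cases hk : ∃ i, j i = k
    · obtain ⟨i, rfl⟩ := hk
      rw [hj.extend_apply, hj.extend_apply]
    · rw [Function.extend_apply' _ _ _ hk, Function.extend_apply' _ _ _ hk]
      simp⟩
  map_add' x y := by
    ext k
    change Function.extend j (x + y : lp (fun _ : ℕ => ℝ) 2) 0 k =
      Function.extend j x 0 k + Function.extend j y 0 k
    by_cases hk : ∃ i, j i = k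
    · obtain ⟨i, rfl⟩ := hk
      rw [hj.extend_apply, hj.extend_apply, hj.extend_apply]
      rfl
    · rw [Function.extend_apply' _ _ _ hk, Function.extend_apply' _ _ _ hk,
        Function.extend_apply' _ _ _ hk]
      simp
  map_smul' c x := by
    ext k
    change Function.extend j (c • x : lp (fun _ : ℕ => ℝ) 2) 0 k = c * Function.extend j x 0 k
    by_cases hk : ∃ i, j i = k
    · obtain ⟨i, rfl⟩ := hk
      simp [hj.extend_apply]
    · simp [Function.extend_apply' _ _ _ hk]
  norm_map' x := by
    rw [lp.norm_eq_tsum_rpow (by simp), lp.norm_eq_tsum_rpow (by simp)]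
    congr 1
    rw [← tsum_extend_zero hj fun i => ‖x i‖ ^ _]
    refine tsum_congr fun k => ?_
    change ‖Function.extend j x 0 k‖ ^ _ = _
    by_cases hk : ∃ i, j i = k
    · obtain ⟨i, rfl⟩ := hk
      rw [hj.extend_apply, hj.extend_apply]
    · rw [Function.extend_apply' _ _ _ hk, Function.extend_apply' _ _ _ hk]
      simp

lemma reindex_apply {j : ℕ → ℕ} (hj : Function.Injective j) (x : lp (fun _ : ℕ => ℝ) 2) (k : ℕ) :
    reindex j hj x (j k) = x k :=
  hj.extend_apply _ _ _

lemma reindex_apply_of_notMem {j : ℕ → ℕ} (hj : Function.Injective j)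
    (x : lp (fun _ : ℕ => ℝ) 2) {k : ℕ} (hk : ¬ ∃ i, j i = k) : reindex j hj x k = 0 :=
  Function.extend_apply' _ _ _ hk

/-- Reindexing on the sphere. -/
noncomputable def sphereReindex (j : ℕ → ℕ) (hj : Function.Injective j) : C(SInfty, SInfty) :=
  ⟨fun x => ⟨reindex j hj x.1, by simp⟩, by fun_prop⟩

/-- The normalization of a map without zeros. -/
noncomputable def normalizedMap {Y : Type*} [TopologicalSpace Y] (F : C(Y, lp (fun _ : ℕ => ℝ) 2))
    (hF : ∀ y, F y ≠ 0) : C(Y, SInfty) :=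
  ⟨fun y => ⟨‖F y‖⁻¹ • F y, by simp [norm_smul, hF y]⟩, by
    refine Continuous.subtype_mk ?_ _
    exact (F.continuous.norm.inv₀ fun y => norm_ne_zero_iff.2 (hF y)).smul F.continuous⟩

/-- Normalize the straight-line homotopy. -/
lemma homotopic_of_combination_ne_zero {Y : Type*} [TopologicalSpace Y] {f g : C(Y, SInfty)}
    (h : ∀ (t : unitInterval) (y : Y), (1 - (t : ℝ)) • (f y).1 + (t : ℝ) • (g y).1 ≠ 0) :
    f.Homotopic g := by
  refine ⟨⟨normalizedMap ⟨fun p : unitInterval × Y =>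
    (1 - (p.1 : ℝ)) • (f p.2).1 + (p.1 : ℝ) • (g p.2).1, by fun_prop⟩ fun p => h p.1 p.2,
    fun y => ?_, fun y => ?_⟩⟩
  · refine Subtype.ext ?_
    simp [normalizedMap]
  · refine Subtype.ext ?_
    simp [normalizedMap]

/-- The sphere `SInfty` is contractible. -/
lemma exists_homotopic_const_sInfty :
    ∃ x₀ : SInfty, (ContinuousMap.id SInfty).Homotopic (ContinuousMap.const SInfty x₀) := by
  classical
  have hj : Function.Injective Nat.succ := Nat.succ_injective
  let x₀ : SInfty := ⟨lp.single 2 0 1, by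
    rw [mem_sphere_zero_iff_norm, lp.norm_single (by simp)]
    simp⟩
  have h0 : ∀ x : lp (fun _ : ℕ => ℝ) 2, reindex Nat.succ hj x 0 = 0 := fun x =>
    reindex_apply_of_notMem hj x (by simp)
  have hne : ∀ x : SInfty, x.1 ≠ 0 := fun x hx => by
    have := x.2
    rw [mem_sphere_zero_iff_norm, hx, norm_zero] at this
    exact zero_ne_one this
  -- First deform the identity to the shift, then the shift to the first basis vector, which is
  -- missed by the image of the shift. Vanishing of either segment forces `x = 0`, coordinate by
  -- coordinate.
  refine ⟨x₀, (homotopic_of_combination_ne_zero (g := sphereReindex Nat.succ hj) fun t x h => ?_).trans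
    (homotopic_of_combination_ne_zero fun t x h => ?_)⟩
  · have hk : ∀ k, (1 - (t : ℝ)) * x.1 k + (t : ℝ) * reindex Nat.succ hj x.1 k = 0 := fun k =>
      congr_arg (fun z : lp (fun _ : ℕ => ℝ) 2 => z k) h
    refine hne x (lp.ext (funext fun k => ?_))
    change x.1 k = 0
    rcases eq_or_ne (t : ℝ) 1 with ht | ht
    · have := hk (Nat.succ k)
      rw [ht, reindex_apply] at this
      linarith
    · have h1 : 1 - (t : ℝ) ≠ 0 := sub_ne_zero.2 ht.symm
      induction k with
      | zero =>
        have := hk 0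
        rw [h0, mul_zero, add_zero] at this
        exact (mul_eq_zero.1 this).resolve_left h1
      | succ k ih =>
        have := hk (Nat.succ k)
        rw [reindex_apply, ih, mul_zero, add_zero] at this
        exact (mul_eq_zero.1 this).resolve_left h1
  · have hk : ∀ k, (1 - (t : ℝ)) * reindex Nat.succ hj x.1 k + (t : ℝ) * x₀.1 k = 0 := fun k =>
      congr_arg (fun z : lp (fun _ : ℕ => ℝ) 2 => z k) h
    have ht : (t : ℝ) = 0 := by
      have := hk 0
      rw [h0] at this
      simpa [x₀] using this
    refine hne x (lp.ext (funext fun k => ?_))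
    have := hk (Nat.succ k)
    rw [reindex_apply, ht] at this
    simpa using this

lemma isFreeInvolution_neg_sInfty : IsFreeInvolution fun x : SInfty => -x where
  continuous := continuous_neg
  involutive := neg_neg
  free x h := by
    have h1 : -x.1 = x.1 := congr_arg Subtype.val h
    have h2 : x.1 = 0 := by
      have h3 : (2 : ℝ) • x.1 = 0 := by
        rw [two_smul]
        nth_rewrite 1 [← h1]
        exact neg_add_cancel _
      exact (smul_eq_zero.1 h3).resolve_left two_ne_zero
    have := x.2
    rw [mem_sphere_zero_iff_norm, h2, norm_zero] at this
    exact zero_ne_one this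

/-- A function with values in `ℤ/2` which changes under the antipodal map. -/
def IsOddFunction (s : SInfty → ZMod 2) : Prop := ∀ x, s (-x) = s x + 1

/-- The nonzero class in `H¹` of `RPInfty` lifts to the coboundary of an odd function. -/
lemma exists_isOddFunction {ξ : Cochain RPInfty 1} (hξ : IsCocycle ξ) (hξ' : ¬ IsCoboundary ξ) :
    ∃ s : SInfty → ZMod 2, IsOddFunction s ∧
      ∀ σ, ξ ((orbitProj fun x : SInfty => -x).comp σ) = endpointSum s σ := by
  obtain ⟨x₀, ⟨H⟩⟩ := exists_homotopic_const_sInfty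
  set pr := orbitProj fun x : SInfty => -x
  have hpr : ∀ x : SInfty, pr (-x) = pr x := orbitProj_apply_map
  let neg : C(SInfty, SInfty) := ⟨fun x => -x, continuous_neg⟩
  let a : Cochain SInfty 1 := fun σ => ξ (pr.comp σ)
  have ha : IsCocycle a := funext fun τ => congr_fun hξ (pr.comp τ)
  set s : SInfty → ZMod 2 := fun x => a (tracePath H x)
  have hs : ∀ σ, ξ (pr.comp σ) = endpointSum s σ := fun σ => ha.eq_endpointSum H σ
  -- The trace of `x` and its antipode project to the same simplex, so `ξ` has the same value on
  -- both.
  have hd : ∀ x, s (-x) + s x = s (-x₀) + s x₀ := by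
    intro x
    have h1 := hs (tracePath H x)
    have h2 := hs (neg.comp (tracePath H x))
    have h3 : pr.comp (neg.comp (tracePath H x)) = pr.comp (tracePath H x) :=
      ContinuousMap.ext fun y => hpr _
    rw [h3, h1] at h2
    simp only [endpointSum, ContinuousMap.comp_apply, tracePath_zero, tracePath_one] at h2
    have h4 : ∀ a b c d : ZMod 2, a + b = c + d → c + a = d + b := by decide
    exact h4 _ _ _ _ h2
  have h01 : ∀ r : ZMod 2, r = 0 ∨ r = 1 := by decide
  -- If the constant is `0`, then `s` descends to the quotient and `ξ` is a coboundary; hence it is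
  -- `1`, which is oddness.
  rcases h01 (s (-x₀) + s x₀) with h | h
  · exfalso
    refine hξ' ⟨fun σ => Quot.lift s (fun x y (hxy : y = -x) => ?_) (σ (stdSimplex.vertex 0)),
      funext fun σ => ?_⟩
    · have := hd x
      rw [h] at this
      rw [hxy]
      exact (CharTwo.add_eq_zero.1 this).symm
    · obtain ⟨τ, rfl⟩ := isFreeInvolution_neg_sInfty.exists_lift σ
      rw [hs]
      refine (Fin.sum_univ_two _).trans ?_
      simp only [ContinuousMap.comp_apply, simplexMap_eq, vertexMap_vertex, endpointSum]
      exact add_comm (s _) (s _)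
  · refine ⟨s, fun x => ?_, hs⟩
    have := hd x
    rw [h] at this
    have h4 : ∀ a b : ZMod 2, a + b = 1 → a = b + 1 := by decide
    exact h4 _ _ this

/-- Every odd function comes from a nonzero class in `H¹` of `RPInfty`. -/
lemma exists_cocycle_of_isOddFunction {s : SInfty → ZMod 2} (hs : IsOddFunction s) :
    ∃ ξ : Cochain RPInfty 1, IsCocycle ξ ∧ ¬ IsCoboundary ξ ∧
      ∀ σ, ξ ((orbitProj fun x : SInfty => -x).comp σ) = endpointSum s σ := by
  obtain ⟨x₀, ⟨H⟩⟩ := exists_homotopic_const_sInfty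
  have hT := isFreeInvolution_neg_sInfty
  set pr := orbitProj fun x : SInfty => -x
  have hpr : ∀ x : SInfty, pr (-x) = pr x := orbitProj_apply_map
  choose lift hlift using fun σ : SingularSimplex RPInfty 1 => hT.exists_lift σ
  have hsum : ∀ a b : ZMod 2, (a + 1) + (b + 1) = a + b := by decide
  have hξ : ∀ σ, endpointSum s (lift (pr.comp σ)) = endpointSum s σ := by
    intro σ
    rcases hT.lift_unique (hlift (pr.comp σ)) with h | h
    · rw [h]
    · rw [h]
      change s (-σ _) + s (-σ _) = _
      rw [hs, hs, hsum]
      rfl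
  refine ⟨fun σ => endpointSum s (lift σ), funext fun σ => ?_, ?_, hξ⟩
  · obtain ⟨τ, rfl⟩ := hT.exists_lift σ
    have h1 : coboundary (fun σ => endpointSum s (lift σ)) (pr.comp τ) =
        coboundary (endpointSum s) τ := Finset.sum_congr rfl fun i _ =>
        hξ (ContinuousMap.comp τ (simplexMap i.succAbove))
    rw [h1, coboundary_one]
    simp only [endpointSum, ContinuousMap.comp_apply, simplexMap_eq, vertexMap_vertex]
    have h2 : ∀ a b c : ZMod 2, b + c + (a + c) + (a + b) = 0 := by decide
    exact h2 _ _ _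
  · rintro ⟨b, hb⟩
    -- If the cocycle were the coboundary of `b`, then `s` and the even function `β` would have the
    -- same differences along traces; comparing `x₀` with `-x₀` contradicts oddness of `s`.
    let β : SInfty → ZMod 2 := fun x => b (ContinuousMap.const _ (pr x))
    have h1 : ∀ x, s x + s x₀ = β x + β x₀ := by
      intro x
      have h2 := congr_fun hb (pr.comp (tracePath H x))
      rw [hξ] at h2
      simp only [endpointSum, tracePath_zero, tracePath_one] at h2
      rw [← h2, coboundary, Fin.sum_univ_two, add_comm]
      congr 2
      · ext y
        have : y = stdSimplex.vertex 0 := Subsingleton.elim _ _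
        rw [this]
        simp only [ContinuousMap.comp_apply, simplexMap_eq, vertexMap_vertex]
        exact congr_arg pr (tracePath_zero H x)
      · ext y
        have : y = stdSimplex.vertex 0 := Subsingleton.elim _ _
        rw [this]
        simp only [ContinuousMap.comp_apply, simplexMap_eq, vertexMap_vertex]
        exact congr_arg pr (tracePath_one H x)
    have h2 := h1 (-x₀)
    have h3 : β (-x₀) = β x₀ := by simp only [β, hpr]
    rw [h3, hs, CharTwo.add_self_eq_zero] at h2
    have h4 : ∀ a : ZMod 2, a + 1 + a ≠ 0 := by decide
    exact h4 _ h2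

end AllenCahn

end InfiniteSphere

/-! ### The index in terms of odd functions -/

section Index

namespace AllenCahn

namespace FreeZ2Complex

lemma isFreeInvolution_T (K : FreeZ2Complex) : IsFreeInvolution K.T where
  continuous := by
    refine Continuous.subtype_mk (continuous_pi fun v => ?_) _
    exact (continuous_apply _).comp continuous_subtype_val
  involutive x := Subtype.ext (funext fun v => congr_arg x.1 (K.swap_swap v))
  free x h := K.free x.1 x.2 (congr_arg Subtype.val h)

/-- The involution as a continuous map. -/
def involution (K : FreeZ2Complex) : C(K.Space, K.Space) := ⟨K.T, K.isFreeInvolution_T.continuous⟩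

lemma orbitMap_comp {K : FreeZ2Complex} (f : C(K.Space, SInfty)) (hf : ∀ x, f (K.T x) = -f x)
    {p : ℕ} (σ : SingularSimplex K.Space p) :
    (orbitMap (T := K.T) (S := fun y : SInfty => -y) f hf).comp ((orbitProj K.T).comp σ) =
      (orbitProj fun y : SInfty => -y).comp (f.comp σ) := rfl

/-- The working form of nonvanishing: a certificate on the total space, which can be joined with
another one. The chain has dimension `p`, as `Chain` counts vertices. -/
lemma ClassPowNeZero.exists_chain {K : FreeZ2Complex} {p : ℕ} (h : K.ClassPowNeZero p) :
    ∃ (f : C(K.Space, SInfty)) (_ : ∀ x, f (K.T x) = -f x) (s : SInfty → ZMod 2)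
      (_ : IsOddFunction s) (c : Chain K.Space (p + 1)),
      chainMap K.involution p (boundary p c) = boundary p c ∧
        eval (altPow (fun x => s (f x)) p) c = 1 := by
  obtain ⟨f, hf, ξ, hξ, hξ', hn⟩ := h
  obtain ⟨s, hs, hsξ⟩ := exists_isOddFunction hξ hξ'
  refine ⟨f, hf, s, hs, K.isFreeInvolution_T.exists_chain hn fun σ => ?_⟩
  rw [pullback, orbitMap_comp, cupPow_eq_altPow _ hsξ]
  rfl

/-- The converse direction: a coboundary on the orbit space lifts to the coboundary of an invariant
cochain, so excluding the latter suffices. -/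
lemma classPowNeZero_of_forall {K : FreeZ2Complex} {p : ℕ} (f : C(K.Space, SInfty))
    (hf : ∀ x, f (K.T x) = -f x) {s : SInfty → ZMod 2} (hs : IsOddFunction s)
    (h : ∀ b : Simplex K.Space p → ZMod 2, (∀ σ, b (K.involution.comp σ) = b σ) →
      ¬ ∀ σ, altPow (fun x => s (f x)) p σ = ∑ i, b (Simplex.face σ i)) :
    K.ClassPowNeZero p := by
  obtain ⟨ξ, hξ, hξ', hsξ⟩ := exists_cocycle_of_isOddFunction hs
  refine ⟨f, hf, ξ, hξ, hξ', fun hc => ?_⟩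
  obtain ⟨b, hb, hb'⟩ := K.isFreeInvolution_T.exists_invariant_of_isCoboundary hc
  refine h b hb fun σ => ?_
  rw [← hb', pullback, orbitMap_comp, cupPow_eq_altPow _ hsξ]
  rfl

/-- The index is a supremum, so a lower bound yields some nonvanishing power of degree at least `p`,
not degree `p` itself; this is all that is needed. -/
lemma exists_classPowNeZero_of_le_index {K : FreeZ2Complex} {p : ℕ}
    (h : (p : ℕ∞) + 1 ≤ K.index) : ∃ q, p ≤ q ∧ K.ClassPowNeZero q := by
  have h1 : (p : ℕ∞) < K.index := lt_of_lt_of_le (by exact_mod_cast Nat.lt_succ_self p) h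
  rw [index] at h1
  simp only [lt_iSup_iff] at h1
  obtain ⟨q, ⟨hq, hc⟩, hpq⟩ := h1
  have : p < q := by exact_mod_cast hpq
  exact ⟨q - 1, by omega, hc⟩

lemma le_index_of_classPowNeZero {K : FreeZ2Complex} {q : ℕ} (h : K.ClassPowNeZero q) :
    (q : ℕ∞) + 1 ≤ K.index := by
  rw [index]
  exact_mod_cast le_iSup₂_of_le (f := fun (p : ℕ) (_ : 1 ≤ p ∧ K.ClassPowNeZero (p - 1)) => (p : ℕ∞))
    (q + 1) ⟨by omega, h⟩ le_rfl

end FreeZ2Complex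

end AllenCahn

end Index


/-! ### Parts of points of a simplex -/

section SimplexParts

namespace AllenCahn

variable {A B C D : Type*} [Fintype A] [Fintype B] [Fintype C] [Fintype D]

/-- The total weight of a family of vertices. -/
def mass (j : A → C) (w : stdSimplex ℝ C) : ℝ := ∑ a, w (j a)

lemma mass_nonneg (j : A → C) (w : stdSimplex ℝ C) : 0 ≤ mass j w :=
  Finset.sum_nonneg fun _ _ => stdSimplex.zero_le _ _

lemma mass_inl_add_mass_inr (w : stdSimplex ℝ (A ⊕ B)) :
    mass Sum.inl w + mass Sum.inr w = 1 := by
  rw [mass, mass, ← Fintype.sum_sum_type]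
  exact stdSimplex.sum_eq_one w

lemma continuous_mass (j : A → C) : Continuous (mass j) :=
  continuous_finsetSum _ fun a _ => (continuous_apply (j a)).comp continuous_subtype_val

/-- The normalized weights of a family of vertices. -/
noncomputable def part (j : A → C) (w : stdSimplex ℝ C) (h : mass j w ≠ 0) : stdSimplex ℝ A :=
  ⟨fun a => w (j a) / mass j w, fun a => div_nonneg (stdSimplex.zero_le _ _) (mass_nonneg j w), by
    rw [← Finset.sum_div]
    exact div_self h⟩

lemma part_apply (j : A → C) (w : stdSimplex ℝ C) (h : mass j w ≠ 0) (a : A) :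
    part j w h a = w (j a) / mass j w := rfl

lemma continuous_part (j : A → C) :
    Continuous fun w : {w : stdSimplex ℝ C // mass j w ≠ 0} => part j w.1 w.2 := by
  refine Continuous.subtype_mk (continuous_pi fun a => ?_) _
  refine Continuous.div ?_ ((continuous_mass j).comp continuous_subtype_val) fun w => w.2
  exact (continuous_apply (j a)).comp (continuous_subtype_val.comp continuous_subtype_val)

/-- Boundedness of `g` makes `r • g` tend to zero where `r` does, although `g` itself has no limit
there. Maps on joins are continuous at the ends for this reason. -/
lemma continuous_cone {Z E : Type*} [TopologicalSpace Z] [NormedAddCommGroup E] [NormedSpace ℝ E]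
    {r : Z → ℝ} (hr : Continuous r) {g : ∀ z, r z ≠ 0 → E}
    (hg : Continuous fun z : {z // r z ≠ 0} => g z.1 z.2) {M : ℝ} (hM : ∀ z h, ‖g z h‖ ≤ M) :
    Continuous fun z => if h : r z ≠ 0 then r z • g z h else 0 := by
  rw [continuous_iff_continuousAt]
  intro z
  by_cases hz : r z = 0
  · have h0 : (if h : r z ≠ 0 then r z • g z h else 0) = 0 := dif_neg (not_not.2 hz)
    rw [ContinuousAt, h0]
    have h1 : Tendsto (fun z => |r z| * M) (𝓝 z) (𝓝 0) := by
      have := (hr.abs.mul_const M).tendsto z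
      rwa [hz, abs_zero, zero_mul] at this
    refine squeeze_zero_norm (fun y => ?_) h1
    split_ifs with hy
    · rw [norm_smul]
      exact mul_le_mul_of_nonneg_left (hM _ _) (abs_nonneg _)
    · rw [not_not.1 hy]
      simp
  · have ho : IsOpen {z | r z ≠ 0} := isOpen_ne_fun hr continuous_const
    refine ContinuousOn.continuousAt (s := {z | r z ≠ 0}) ?_ (ho.mem_nhds hz)
    rw [continuousOn_iff_continuous_domRestrict]
    refine (((hr.comp continuous_subtype_val).smul hg).congr fun y => ?_)
    change r y.1 • g y.1 y.2 = if h : r y.1 ≠ 0 then r y.1 • g y.1 h else 0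
    rw [dif_pos y.2]

section Map

variable {A' C' : Type*} [Fintype A'] [Fintype C'] [DecidableEq A'] {j : A → C} {j' : A' → C'} {f : A → A'}
  {F : C → C'}

omit [Fintype A'] in
-- The hypothesis `hF` says that `F` maps the block `j` to the block `j'` through `f` and sends no
-- other vertex there, so block weights are only redistributed by `f`.
lemma map_apply_of_iff (hj : Function.Injective j)
    (hF : ∀ c a', F c = j' a' ↔ ∃ a, j a = c ∧ f a = a') (w : stdSimplex ℝ C) (a' : A') :
    stdSimplex.map F w (j' a') = ∑ a with f a = a', w (j a) := by
  classical
  refine (FunOnFinite.linearMap_apply_apply ..).trans ?_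
  symm
  refine Finset.sum_nbij j (fun a ha => ?_) hj.injOn (fun c hc => ?_) fun _ _ => rfl
  · simp only [Finset.mem_filter, Finset.mem_univ, true_and] at ha ⊢
    exact (hF _ _).2 ⟨a, rfl, ha⟩
  · simp only [Finset.coe_filter, Finset.mem_univ, true_and, Set.mem_ofPred_eq] at hc
    obtain ⟨a, rfl, ha⟩ := (hF _ _).1 hc
    exact ⟨a, by simpa using ha, rfl⟩

omit [DecidableEq A'] in
lemma mass_map (hj : Function.Injective j)
    (hF : ∀ c a', F c = j' a' ↔ ∃ a, j a = c ∧ f a = a') (w : stdSimplex ℝ C) :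
    mass j' (stdSimplex.map F w) = mass j w := by
  classical
  simp_rw [mass, map_apply_of_iff hj hF]
  exact Finset.sum_fiberwise Finset.univ f fun a => w (j a)

omit [DecidableEq A'] in
lemma part_map (hj : Function.Injective j)
    (hF : ∀ c a', F c = j' a' ↔ ∃ a, j a = c ∧ f a = a') (w : stdSimplex ℝ C)
    (h : mass j' (stdSimplex.map F w) ≠ 0) :
    part j' (stdSimplex.map F w) h =
      stdSimplex.map f (part j w (mass_map hj hF w ▸ h)) := by
  classical
  ext a'
  change stdSimplex.map F w (j' a') / mass j' (stdSimplex.map F w) = _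
  refine Eq.trans ?_ (FunOnFinite.linearMap_apply_apply ..).symm
  rw [map_apply_of_iff hj hF, Finset.sum_div]
  simp only [mass_map hj hF]
  rfl

end Map

end AllenCahn

end SimplexParts

/-! ### The join of free complexes -/

section Join

namespace AllenCahn.FreeZ2Complex

open Classical in
/-- The join of the underlying simplicial complexes. -/
noncomputable def joinComplex (K L : FreeZ2Complex) : PreAbstractSimplicialComplex (K.V ⊕ L.V) where
  faces := {s | s.Nonempty ∧ (s.toLeft.Nonempty → s.toLeft ∈ K.K.faces) ∧
    (s.toRight.Nonempty → s.toRight ∈ L.K.faces)}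
  isRelLowerSet_faces := fun _ hs => ⟨hs.1, fun _ ht htn => ⟨htn,
    fun h => (K.K.isRelLowerSet_faces (hs.2.1 (h.mono (Finset.toLeft_subset_toLeft ht)))).2
      (Finset.toLeft_subset_toLeft ht) h,
    fun h => (L.K.isRelLowerSet_faces (hs.2.2 (h.mono (Finset.toRight_subset_toRight ht)))).2
      (Finset.toRight_subset_toRight ht) h⟩⟩

variable {K L : FreeZ2Complex}

/-- A point of the join as a point of the standard simplex. -/
def toSimplex (z : realization (joinComplex K L)) : stdSimplex ℝ (K.V ⊕ L.V) := ⟨z.1, z.2.1⟩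

lemma continuous_toSimplex :
    Continuous (toSimplex : realization (joinComplex K L) → stdSimplex ℝ (K.V ⊕ L.V)) :=
  continuous_subtype_val.subtype_mk _

lemma exists_ne_zero_of_mass_ne_zero {A C : Type*} [Fintype A] [Fintype C] {j : A → C}
    {w : stdSimplex ℝ C} (h : mass j w ≠ 0) : ∃ a, w (j a) ≠ 0 := by
  by_contra! h0
  exact h (Finset.sum_eq_zero fun a _ => h0 a)

/-- The point of the first complex on the ray through a point of the join. -/
noncomputable def leftPoint (z : realization (joinComplex K L))
    (h : mass Sum.inl (toSimplex z) ≠ 0) : K.Space :=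
  ⟨part Sum.inl (toSimplex z) h, (part Sum.inl (toSimplex z) h).2, by
    obtain ⟨-, s, hs, hsz⟩ := z.2
    obtain ⟨a, ha⟩ := exists_ne_zero_of_mass_ne_zero h
    refine ⟨s.toLeft, hs.2.1 ⟨a, by rw [Finset.mem_toLeft]; exact (hsz _).2 ha⟩, fun v => ?_⟩
    rw [Finset.mem_toLeft, hsz]
    change _ ↔ z.1 (Sum.inl v) / mass Sum.inl (toSimplex z) ≠ 0
    simp [h]⟩

/-- The point of the second complex on the ray through a point of the join. -/
noncomputable def rightPoint (z : realization (joinComplex K L))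
    (h : mass Sum.inr (toSimplex z) ≠ 0) : L.Space :=
  ⟨part Sum.inr (toSimplex z) h, (part Sum.inr (toSimplex z) h).2, by
    obtain ⟨-, s, hs, hsz⟩ := z.2
    obtain ⟨a, ha⟩ := exists_ne_zero_of_mass_ne_zero h
    refine ⟨s.toRight, hs.2.2 ⟨a, by rw [Finset.mem_toRight]; exact (hsz _).2 ha⟩, fun v => ?_⟩
    rw [Finset.mem_toRight, hsz]
    change _ ↔ z.1 (Sum.inr v) / mass Sum.inr (toSimplex z) ≠ 0
    simp [h]⟩

lemma continuous_leftPoint : Continuous fun z : {z : realization (joinComplex K L) //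
    mass Sum.inl (toSimplex z) ≠ 0} => leftPoint z.1 z.2 := by
  have h := (continuous_part (Sum.inl : K.V → K.V ⊕ L.V)).comp
    ((continuous_toSimplex.comp continuous_subtype_val).subtype_mk
      fun z : {z : realization (joinComplex K L) // mass Sum.inl (toSimplex z) ≠ 0} => z.2)
  exact (continuous_subtype_val.comp h).subtype_mk _

lemma continuous_rightPoint : Continuous fun z : {z : realization (joinComplex K L) //
    mass Sum.inr (toSimplex z) ≠ 0} => rightPoint z.1 z.2 := by
  have h := (continuous_part (Sum.inr : L.V → K.V ⊕ L.V)).comp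
    ((continuous_toSimplex.comp continuous_subtype_val).subtype_mk
      fun z : {z : realization (joinComplex K L) // mass Sum.inr (toSimplex z) ≠ 0} => z.2)
  exact (continuous_subtype_val.comp h).subtype_mk _

lemma mem_realization_joinComplex {z : K.V ⊕ L.V → ℝ} (hz : z ∈ stdSimplex ℝ (K.V ⊕ L.V))
    (hl : (∀ v, z (Sum.inl v) = 0) ∨
      ∃ (m : ℝ) (x : K.Space), m ≠ 0 ∧ ∀ v, z (Sum.inl v) = m * x.1 v)
    (hr : (∀ v, z (Sum.inr v) = 0) ∨
      ∃ (m : ℝ) (y : L.Space), m ≠ 0 ∧ ∀ v, z (Sum.inr v) = m * y.1 v) :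
    z ∈ realization (joinComplex K L) := by
  classical
  refine ⟨hz, Finset.univ.filter fun v => z v ≠ 0, ⟨?_, fun h => ?_, fun h => ?_⟩, fun v => by simp⟩
  · by_contra h
    rw [Finset.not_nonempty_iff_eq_empty, Finset.filter_eq_empty_iff] at h
    have h1 := hz.2
    rw [Finset.sum_eq_zero fun v hv => not_not.1 (h hv)] at h1
    exact zero_ne_one h1
  · obtain ⟨v, hv⟩ := h
    rcases hl with hl | ⟨m, x, hm, hx⟩
    · simp [hl] at hv
    · obtain ⟨-, t, ht, hts⟩ := x.2
      convert ht using 1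
      ext v
      simp [hts, hx, hm]
  · obtain ⟨v, hv⟩ := h
    rcases hr with hr | ⟨m, y, hm, hy⟩
    · simp [hr] at hv
    · obtain ⟨-, t, ht, hts⟩ := y.2
      convert ht using 1
      ext v
      simp [hts, hy, hm]

open Classical in
variable (K L) in
/-- The join of two free complexes. -/
noncomputable def join : FreeZ2Complex where
  V := K.V ⊕ L.V
  K := joinComplex K L
  swap := Sum.map K.swap L.swap
  swap_swap v := by
    rcases v with v | v
    · exact congr_arg Sum.inl (K.swap_swap v)
    · exact congr_arg Sum.inr (L.swap_swap v)
  swap_faces s hs := by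
    refine ⟨Finset.univ.filter fun v => Sum.map K.swap L.swap v ∈ s, ⟨?_, fun h => ?_, fun h => ?_⟩,
      fun v => by simp⟩
    · obtain ⟨v, hv⟩ := hs.1
      refine ⟨Sum.map K.swap L.swap v, ?_⟩
      rcases v with v | v
      · simpa [K.swap_swap] using hv
      · simpa [L.swap_swap] using hv
    · obtain ⟨v, hv⟩ := h
      obtain ⟨t, ht, hts⟩ := K.swap_faces s.toLeft (hs.2.1 ⟨K.swap v, by simpa using hv⟩)
      convert ht using 1
      ext v
      simp [hts]
    · obtain ⟨v, hv⟩ := h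
      obtain ⟨t, ht, hts⟩ := L.swap_faces s.toRight (hs.2.2 ⟨L.swap v, by simpa using hv⟩)
      convert ht using 1
      ext v
      simp [hts]
  free := by
    intro z hz h
    have h1 := mass_inl_add_mass_inr (toSimplex ⟨z, hz⟩)
    -- At least one block has positive mass, and normalizing that block turns a fixed point of the
    -- join into a fixed point of a factor.
    by_cases hl : mass Sum.inl (toSimplex (K := K) (L := L) ⟨z, hz⟩) = 0
    · have hr : mass Sum.inr (toSimplex (K := K) (L := L) ⟨z, hz⟩) ≠ 0 := by
        intro hr
        rw [hl, hr, zero_add] at h1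
        exact zero_ne_one h1
      refine L.free _ (rightPoint ⟨z, hz⟩ hr).2 (funext fun v => ?_)
      exact congr_arg (· / mass Sum.inr (toSimplex (K := K) (L := L) ⟨z, hz⟩))
        (congr_fun h (Sum.inr v))
    · refine K.free _ (leftPoint ⟨z, hz⟩ hl).2 (funext fun v => ?_)
      exact congr_arg (· / mass Sum.inl (toSimplex (K := K) (L := L) ⟨z, hz⟩))
        (congr_fun h (Sum.inl v))

lemma mass_inl_T (z : (join K L).Space) :
    mass Sum.inl (toSimplex ((join K L).T z)) = mass Sum.inl (toSimplex z) :=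
  (Function.Involutive.bijective K.swap_swap).sum_comp fun v => z.1 (Sum.inl v)

lemma mass_inr_T (z : (join K L).Space) :
    mass Sum.inr (toSimplex ((join K L).T z)) = mass Sum.inr (toSimplex z) :=
  (Function.Involutive.bijective L.swap_swap).sum_comp fun v => z.1 (Sum.inr v)

lemma leftPoint_T (z : (join K L).Space) (h : mass Sum.inl (toSimplex ((join K L).T z)) ≠ 0) :
    leftPoint ((join K L).T z) h = K.T (leftPoint z (mass_inl_T z ▸ h)) := by
  refine Subtype.ext (funext fun v => ?_)
  change z.1 (Sum.inl (K.swap v)) / mass Sum.inl (toSimplex ((join K L).T z)) =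
    z.1 (Sum.inl (K.swap v)) / mass Sum.inl (toSimplex z)
  rw [mass_inl_T]

lemma rightPoint_T (z : (join K L).Space) (h : mass Sum.inr (toSimplex ((join K L).T z)) ≠ 0) :
    rightPoint ((join K L).T z) h = L.T (rightPoint z (mass_inr_T z ▸ h)) := by
  refine Subtype.ext (funext fun v => ?_)
  change z.1 (Sum.inr (L.swap v)) / mass Sum.inr (toSimplex ((join K L).T z)) =
    z.1 (Sum.inr (L.swap v)) / mass Sum.inr (toSimplex z)
  rw [mass_inr_T]

/-! ### Joins of singular simplices -/

section JoinSimplex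

variable {A B : Type*} [Fintype A] [Fintype B]

/-- The coordinates of the join of two singular simplices. -/
noncomputable def joinFun (σ : C(stdSimplex ℝ A, K.Space)) (τ : C(stdSimplex ℝ B, L.Space))
    (w : stdSimplex ℝ (A ⊕ B)) : K.V ⊕ L.V → ℝ :=
  Sum.elim
    (fun v => if h : mass Sum.inl w ≠ 0 then mass Sum.inl w • (σ (part Sum.inl w h)).1 v else 0)
    (fun v => if h : mass Sum.inr w ≠ 0 then mass Sum.inr w • (τ (part Sum.inr w h)).1 v else 0)

lemma joinFun_mem (σ : C(stdSimplex ℝ A, K.Space)) (τ : C(stdSimplex ℝ B, L.Space))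
    (w : stdSimplex ℝ (A ⊕ B)) : joinFun σ τ w ∈ realization (joinComplex K L) := by
  have hl : ∀ v, 0 ≤ joinFun σ τ w (Sum.inl v) := by
    intro v
    simp only [joinFun, Sum.elim_inl]
    split_ifs with h
    · exact mul_nonneg (mass_nonneg _ _) ((σ (part Sum.inl w h)).2.1.1 v)
    · exact le_rfl
  have hr : ∀ v, 0 ≤ joinFun σ τ w (Sum.inr v) := by
    intro v
    simp only [joinFun, Sum.elim_inr]
    split_ifs with h
    · exact mul_nonneg (mass_nonneg _ _) ((τ (part Sum.inr w h)).2.1.1 v)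
    · exact le_rfl
  refine mem_realization_joinComplex ⟨fun v => ?_, ?_⟩ ?_ ?_
  · rcases v with v | v
    exacts [hl v, hr v]
  · have h1 : ∑ v, joinFun σ τ w (Sum.inl v) = mass Sum.inl w := by
      simp only [joinFun, Sum.elim_inl]
      split_ifs with h
      · rw [← Finset.smul_sum, (σ (part Sum.inl w h)).2.1.2, smul_eq_mul, mul_one]
      · rw [not_not.1 h, Finset.sum_const_zero]
    have h2 : ∑ v, joinFun σ τ w (Sum.inr v) = mass Sum.inr w := by
      simp only [joinFun, Sum.elim_inr]
      split_ifs with h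
      · rw [← Finset.smul_sum, (τ (part Sum.inr w h)).2.1.2, smul_eq_mul, mul_one]
      · rw [not_not.1 h, Finset.sum_const_zero]
    rw [Fintype.sum_sum_type, h1, h2, mass_inl_add_mass_inr]
  · by_cases h : mass Sum.inl w ≠ 0
    · exact Or.inr ⟨_, σ (part Sum.inl w h), h, fun v => dif_pos h⟩
    · exact Or.inl fun v => dif_neg h
  · by_cases h : mass Sum.inr w ≠ 0
    · exact Or.inr ⟨_, τ (part Sum.inr w h), h, fun v => dif_pos h⟩
    · exact Or.inl fun v => dif_neg h

lemma abs_coordinate_le_one {V : Type} [Fintype V] {K : PreAbstractSimplicialComplex V}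
    (x : realization K) (v : V) : ‖x.1 v‖ ≤ 1 := by
  rw [Real.norm_of_nonneg (x.2.1.1 v), ← x.2.1.2]
  exact Finset.single_le_sum (f := x.1) (fun v _ => x.2.1.1 v) (Finset.mem_univ v)

/-- The join of two singular simplices. -/
noncomputable def joinMap (σ : C(stdSimplex ℝ A, K.Space)) (τ : C(stdSimplex ℝ B, L.Space)) :
    C(stdSimplex ℝ (A ⊕ B), (join K L).Space) :=
  ⟨fun w => ⟨joinFun σ τ w, joinFun_mem σ τ w⟩, by
    refine Continuous.subtype_mk (continuous_pi fun v => ?_) _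
    rcases v with v | v
    · refine continuous_cone (g := fun w h => (σ (part Sum.inl w h)).1 v) (continuous_mass _) ?_
        fun w h => abs_coordinate_le_one _ v
      exact (continuous_apply v).comp (continuous_subtype_val.comp
        (σ.continuous.comp (continuous_part _)))
    · refine continuous_cone (g := fun w h => (τ (part Sum.inr w h)).1 v) (continuous_mass _) ?_
        fun w h => abs_coordinate_le_one _ v
      exact (continuous_apply v).comp (continuous_subtype_val.comp
        (τ.continuous.comp (continuous_part _)))⟩

lemma joinMap_involution (σ : C(stdSimplex ℝ A, K.Space)) (τ : C(stdSimplex ℝ B, L.Space)) :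
    (join K L).involution.comp (joinMap σ τ) =
      joinMap (K.involution.comp σ) (L.involution.comp τ) := by
  refine ContinuousMap.ext fun w => Subtype.ext (funext fun v => ?_)
  rcases v with v | v <;> rfl

/-- Naturality in the two blocks of vertices, from which the faces of a join of simplices are read
off. -/
lemma joinMap_map {A' B' : Type*} [Fintype A'] [Fintype B'] (f : A → A') (g : B → B')
    (σ : C(stdSimplex ℝ A', K.Space)) (τ : C(stdSimplex ℝ B', L.Space))
    (w : stdSimplex ℝ (A ⊕ B)) :
    joinMap σ τ (stdSimplex.map (Sum.map f g) w) =
      joinMap (σ.comp ⟨stdSimplex.map f, stdSimplex.continuous_map f⟩)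
        (τ.comp ⟨stdSimplex.map g, stdSimplex.continuous_map g⟩) w := by
  have hl : ∀ (c : A ⊕ B) a', Sum.map f g c = Sum.inl a' ↔ ∃ a, Sum.inl a = c ∧ f a = a' := by
    rintro (c | c) a' <;> simp
  have hr : ∀ (c : A ⊕ B) b', Sum.map f g c = Sum.inr b' ↔ ∃ b, Sum.inr b = c ∧ g b = b' := by
    rintro (c | c) a' <;> simp
  have hml := mass_map Sum.inl_injective hl w
  have hmr := mass_map Sum.inr_injective hr w
  refine Subtype.ext (funext fun v => ?_)
  rcases v with v | v
  · change (if h : mass Sum.inl (stdSimplex.map (Sum.map f g) w) ≠ 0 then _ else _) =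
      if h : mass Sum.inl w ≠ 0 then _ else _
    by_cases h : mass Sum.inl w ≠ 0
    · rw [dif_pos h, dif_pos (by rwa [hml]), part_map Sum.inl_injective hl]
      exact congrArg (· • _) hml
    · rw [dif_neg h, dif_neg (by rwa [hml])]
  · change (if h : mass Sum.inr (stdSimplex.map (Sum.map f g) w) ≠ 0 then _ else _) =
      if h : mass Sum.inr w ≠ 0 then _ else _
    by_cases h : mass Sum.inr w ≠ 0
    · rw [dif_pos h, dif_pos (by rwa [hmr]), part_map Sum.inr_injective hr]
      exact congrArg (· • _) hmr
    · rw [dif_neg h, dif_neg (by rwa [hmr])]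

end JoinSimplex

end AllenCahn.FreeZ2Complex

end Join


/-! ### Joins of chains -/

section JoinChains

namespace AllenCahn

/-- The decomposition of an ordered set of vertices into two blocks. -/
def splitEquiv {N p q : ℕ} (h : N = p + q) : Fin N ≃ Fin p ⊕ Fin q :=
  (finCongr h).trans finSumFinEquiv.symm

lemma splitEquiv_symm_inl_val {N p q : ℕ} (h : N = p + q) (i : Fin p) :
    ((splitEquiv h).symm (Sum.inl i)).val = i := rfl

lemma splitEquiv_symm_inr_val {N p q : ℕ} (h : N = p + q) (j : Fin q) :
    ((splitEquiv h).symm (Sum.inr j)).val = p + j := rfl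

lemma splitEquiv_eq_inl {N p q : ℕ} (h : N = p + q) {k : Fin N} {i : Fin p} (hk : k.val = i) :
    splitEquiv h k = Sum.inl i :=
  (Equiv.eq_symm_apply _).1 (Fin.ext hk)

lemma splitEquiv_eq_inr {N p q : ℕ} (h : N = p + q) {k : Fin N} {j : Fin q}
    (hk : k.val = p + j) : splitEquiv h k = Sum.inr j :=
  (Equiv.eq_symm_apply _).1 (Fin.ext hk)

lemma splitEquiv_succAbove_inl {N p q : ℕ} (h : N + 1 = p + 1 + q) (h' : N = p + q)
    (i : Fin (p + 1)) (k : Fin N) :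
    splitEquiv h (((splitEquiv h).symm (Sum.inl i)).succAbove k) =
      Sum.map i.succAbove id (splitEquiv h' k) := by
  obtain ⟨y, rfl⟩ := (splitEquiv h').symm.surjective k
  rw [Equiv.apply_symm_apply]
  rcases y with y | y
  · refine splitEquiv_eq_inl h ?_
    simp only [Fin.succAbove, Fin.lt_def, Fin.val_castSucc, splitEquiv_symm_inl_val]
    split_ifs <;> simp [splitEquiv_symm_inl_val]
  · refine splitEquiv_eq_inr h ?_
    have := i.2
    simp only [Fin.succAbove, Fin.lt_def, Fin.val_castSucc, splitEquiv_symm_inl_val,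
      splitEquiv_symm_inr_val]
    rw [if_neg (by omega)]
    simp only [Fin.val_succ, splitEquiv_symm_inr_val, id]
    omega

lemma splitEquiv_succAbove_inr {N p q : ℕ} (h : N + 1 = p + (q + 1)) (h' : N = p + q)
    (j : Fin (q + 1)) (k : Fin N) :
    splitEquiv h (((splitEquiv h).symm (Sum.inr j)).succAbove k) =
      Sum.map id j.succAbove (splitEquiv h' k) := by
  obtain ⟨y, rfl⟩ := (splitEquiv h').symm.surjective k
  rw [Equiv.apply_symm_apply]
  rcases y with y | y
  · refine splitEquiv_eq_inl h ?_
    have := y.2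
    simp only [Fin.succAbove, Fin.lt_def, Fin.val_castSucc, splitEquiv_symm_inl_val,
      splitEquiv_symm_inr_val]
    rw [if_pos (by omega)]
    rfl
  · refine splitEquiv_eq_inr h ?_
    simp only [Fin.succAbove, Fin.lt_def, Fin.val_castSucc, splitEquiv_symm_inr_val,
      add_lt_add_iff_left]
    split_ifs <;> simp [splitEquiv_symm_inr_val, add_assoc]

/-- Consecutive pairs in the concatenation of two sequences are those of the first, those of the
second, and one pair at the junction. The junction factor accounts for the extra degree in `p + q +
1`. -/
lemma prod_adjacent_splitEquiv {R : Type*} [CommSemiring R] {p q : ℕ}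
    (h : p + q + 1 + 1 = p + 1 + (q + 1)) (a : Fin (p + 1) → R) (b : Fin (q + 1) → R) :
    ∏ k : Fin (p + q + 1), (Sum.elim a b (splitEquiv h k.castSucc) +
        Sum.elim a b (splitEquiv h k.succ)) =
      (∏ i : Fin p, (a i.castSucc + a i.succ)) * (a (Fin.last p) + b 0) *
        ∏ j : Fin q, (b j.castSucc + b j.succ) := by
  refine (Fin.prod_univ_add (a := p) (b := q + 1) (fun k : Fin (p + q + 1) =>
    (Sum.elim a b (splitEquiv h k.castSucc) + Sum.elim a b (splitEquiv h k.succ)))).trans ?_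
  rw [Fin.prod_univ_succ, mul_assoc]
  congr 1
  · refine Finset.prod_congr rfl fun i _ => ?_
    rw [splitEquiv_eq_inl h (i := i.castSucc) rfl, splitEquiv_eq_inl h (i := i.succ) rfl]
    rfl
  · congr 1
    · rw [splitEquiv_eq_inl h (i := Fin.last p) rfl, splitEquiv_eq_inr h (j := 0) rfl]
      rfl
    · refine Finset.prod_congr rfl fun j _ => ?_
      rw [splitEquiv_eq_inr h (j := j.castSucc)
          (show p + (j.val + 1) = p + 1 + j.val by omega),
        splitEquiv_eq_inr h (j := j.succ) (show p + (j.val + 1) + 1 = p + 1 + (j.val + 1) by omega)]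
      rfl

namespace FreeZ2Complex

variable {K L : FreeZ2Complex}

section Points

variable {A B : Type*} [Fintype A] [Fintype B]

lemma mass_inl_joinMap (σ : C(stdSimplex ℝ A, K.Space)) (τ : C(stdSimplex ℝ B, L.Space))
    (w : stdSimplex ℝ (A ⊕ B)) :
    mass Sum.inl (toSimplex (joinMap σ τ w)) = mass Sum.inl w := by
  by_cases h : mass Sum.inl w ≠ 0
  · have h1 : ∀ v, toSimplex (joinMap σ τ w) (Sum.inl v) =
        mass Sum.inl w * (σ (part Sum.inl w h)).1 v := fun v => dif_pos h
    rw [mass, Finset.sum_congr rfl fun v _ => h1 v, ← Finset.mul_sum,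
      (σ (part Sum.inl w h)).2.1.2, mul_one]
  · have h1 : ∀ v, toSimplex (joinMap σ τ w) (Sum.inl v) = 0 := fun v => dif_neg h
    rw [mass, Finset.sum_congr rfl fun v _ => h1 v, Finset.sum_const_zero, not_not.1 h]

lemma mass_inr_joinMap (σ : C(stdSimplex ℝ A, K.Space)) (τ : C(stdSimplex ℝ B, L.Space))
    (w : stdSimplex ℝ (A ⊕ B)) :
    mass Sum.inr (toSimplex (joinMap σ τ w)) = mass Sum.inr w := by
  have h1 := mass_inl_add_mass_inr (toSimplex (joinMap σ τ w))
  rw [mass_inl_joinMap, ← mass_inl_add_mass_inr w] at h1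
  exact add_left_cancel h1

lemma leftPoint_joinMap (σ : C(stdSimplex ℝ A, K.Space)) (τ : C(stdSimplex ℝ B, L.Space))
    (w : stdSimplex ℝ (A ⊕ B)) (h : mass Sum.inl (toSimplex (joinMap σ τ w)) ≠ 0) :
    leftPoint (joinMap σ τ w) h = σ (part Sum.inl w (mass_inl_joinMap σ τ w ▸ h)) := by
  have h0 : mass Sum.inl w ≠ 0 := mass_inl_joinMap σ τ w ▸ h
  refine Subtype.ext (funext fun v => ?_)
  have h1 : toSimplex (joinMap σ τ w) (Sum.inl v) =
    mass Sum.inl w * (σ (part Sum.inl w h0)).1 v := dif_pos h0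
  change toSimplex (joinMap σ τ w) (Sum.inl v) / mass Sum.inl (toSimplex (joinMap σ τ w)) =
    (σ (part Sum.inl w h0)).1 v
  rw [h1, mass_inl_joinMap, mul_div_cancel_left₀ _ h0]

lemma rightPoint_joinMap (σ : C(stdSimplex ℝ A, K.Space)) (τ : C(stdSimplex ℝ B, L.Space))
    (w : stdSimplex ℝ (A ⊕ B)) (h : mass Sum.inr (toSimplex (joinMap σ τ w)) ≠ 0) :
    rightPoint (joinMap σ τ w) h = τ (part Sum.inr w (mass_inr_joinMap σ τ w ▸ h)) := by
  have h0 : mass Sum.inr w ≠ 0 := mass_inr_joinMap σ τ w ▸ h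
  refine Subtype.ext (funext fun v => ?_)
  have h1 : toSimplex (joinMap σ τ w) (Sum.inr v) =
    mass Sum.inr w * (τ (part Sum.inr w h0)).1 v := dif_pos h0
  change toSimplex (joinMap σ τ w) (Sum.inr v) / mass Sum.inr (toSimplex (joinMap σ τ w)) =
    (τ (part Sum.inr w h0)).1 v
  rw [h1, mass_inr_joinMap, mul_div_cancel_left₀ _ h0]

end Points

/-- The join of two singular simplices with ordered vertices. -/
noncomputable def joinSimplex {N p q : ℕ} (h : N = p + q) (σ : Simplex K.Space p)
    (τ : Simplex L.Space q) : Simplex (join K L).Space N :=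
  (joinMap σ τ).comp ⟨stdSimplex.map (splitEquiv h), stdSimplex.continuous_map _⟩

lemma involution_comp_joinSimplex {N p q : ℕ} (h : N = p + q) (σ : Simplex K.Space p)
    (τ : Simplex L.Space q) : (join K L).involution.comp (joinSimplex h σ τ) =
      joinSimplex h (K.involution.comp σ) (L.involution.comp τ) := by
  rw [joinSimplex, ← ContinuousMap.comp_assoc, joinMap_involution]
  rfl

lemma joinSimplex_vertex {N p q : ℕ} (h : N = p + q) (σ : Simplex K.Space p)
    (τ : Simplex L.Space q) (k : Fin N) : joinSimplex h σ τ (stdSimplex.vertex k) =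
      joinMap σ τ (stdSimplex.vertex (splitEquiv h k)) :=
  congr_arg (joinMap σ τ) (stdSimplex.map_vertex _ _)

lemma joinSimplex_face_inl {N p q : ℕ} (h : N + 1 = p + 1 + q) (h' : N = p + q)
    (σ : Simplex K.Space (p + 1)) (τ : Simplex L.Space q) (i : Fin (p + 1)) :
    Simplex.face (joinSimplex h σ τ) ((splitEquiv h).symm (Sum.inl i)) =
      joinSimplex h' (Simplex.face σ i) τ := by
  refine ContinuousMap.ext fun w => ?_
  have h1 : stdSimplex.map (splitEquiv h)
      (stdSimplex.map ((splitEquiv h).symm (Sum.inl i)).succAbove w) =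
      stdSimplex.map (Sum.map i.succAbove id) (stdSimplex.map (splitEquiv h') w) := by
    rw [stdSimplex.map_comp_apply, stdSimplex.map_comp_apply]
    congr 1
    exact funext fun k => splitEquiv_succAbove_inl h h' i k
  refine (congr_arg (joinMap σ τ) h1).trans ((joinMap_map _ _ _ _ _).trans ?_)
  have h2 : τ.comp ⟨stdSimplex.map id, stdSimplex.continuous_map id⟩ = τ :=
    ContinuousMap.ext fun y => congr_arg τ (stdSimplex.map_id_apply y)
  rw [h2]
  rfl

lemma joinSimplex_face_inr {N p q : ℕ} (h : N + 1 = p + (q + 1)) (h' : N = p + q)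
    (σ : Simplex K.Space p) (τ : Simplex L.Space (q + 1)) (j : Fin (q + 1)) :
    Simplex.face (joinSimplex h σ τ) ((splitEquiv h).symm (Sum.inr j)) =
      joinSimplex h' σ (Simplex.face τ j) := by
  refine ContinuousMap.ext fun w => ?_
  have h1 : stdSimplex.map (splitEquiv h)
      (stdSimplex.map ((splitEquiv h).symm (Sum.inr j)).succAbove w) =
      stdSimplex.map (Sum.map id j.succAbove) (stdSimplex.map (splitEquiv h') w) := by
    rw [stdSimplex.map_comp_apply, stdSimplex.map_comp_apply]
    congr 1
    exact funext fun k => splitEquiv_succAbove_inr h h' j k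
  refine (congr_arg (joinMap σ τ) h1).trans ((joinMap_map _ _ _ _ _).trans ?_)
  have h2 : σ.comp ⟨stdSimplex.map id, stdSimplex.continuous_map id⟩ = σ :=
    ContinuousMap.ext fun y => congr_arg σ (stdSimplex.map_id_apply y)
  rw [h2]
  rfl

/-- The join of chains. -/
noncomputable def joinChain {N p q : ℕ} (h : N = p + q) :
    Chain K.Space p →ₗ[ZMod 2] Chain L.Space q →ₗ[ZMod 2] Chain (join K L).Space N :=
  Finsupp.linearCombination (ZMod 2) fun σ => Finsupp.linearCombination (ZMod 2) fun τ =>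
    Finsupp.single (joinSimplex h σ τ) 1

lemma joinChain_single {N p q : ℕ} (h : N = p + q) (σ : Simplex K.Space p)
    (τ : Simplex L.Space q) : joinChain h (Finsupp.single σ 1) (Finsupp.single τ 1) =
      Finsupp.single (joinSimplex h σ τ) 1 := by
  simp [joinChain]

lemma bilinear_ext {X Y : Type*} [TopologicalSpace X] [TopologicalSpace Y] {p q : ℕ} {V : Type*}
    [AddCommGroup V] [Module (ZMod 2) V]
    {F G : Chain X p →ₗ[ZMod 2] Chain Y q →ₗ[ZMod 2] V}
    (h : ∀ σ τ, F (Finsupp.single σ 1) (Finsupp.single τ 1) =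
      G (Finsupp.single σ 1) (Finsupp.single τ 1)) (c : Chain X p) (d : Chain Y q) :
    F c d = G c d := by
  have : F = G := Finsupp.lhom_ext' fun σ => LinearMap.ext_ring (Finsupp.lhom_ext' fun τ =>
    LinearMap.ext_ring (h σ τ))
  rw [this]

lemma chainMap_joinChain {N p q : ℕ} (h : N = p + q) (c : Chain K.Space p)
    (d : Chain L.Space q) : chainMap (join K L).involution N (joinChain h c d) =
      joinChain h (chainMap K.involution p c) (chainMap L.involution q d) := by
  refine bilinear_ext (F := (joinChain h).compr₂ (chainMap (join K L).involution N))
    (G := (joinChain h).compl₁₂ (chainMap K.involution p) (chainMap L.involution q))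
    (fun σ τ => ?_) c d
  simp only [LinearMap.compr₂_apply, LinearMap.compl₁₂_apply, chainMap_single, joinChain_single,
    involution_comp_joinSimplex]

/-- The Leibniz rule: a face of a join omits a vertex of one of the two blocks. Signs are absent
modulo `2`, and the augmented boundary makes the formula valid for single vertices too. -/
lemma boundary_joinChain {p q : ℕ} (h : p + q + 1 + 1 = p + 1 + (q + 1))
    (h₁ : p + q + 1 = p + (q + 1)) (h₂ : p + q + 1 = p + 1 + q) (c : Chain K.Space (p + 1))
    (d : Chain L.Space (q + 1)) : boundary (p + q + 1) (joinChain h c d) =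
      joinChain h₁ (boundary p c) d + joinChain h₂ c (boundary q d) := by
  refine bilinear_ext (F := (joinChain h).compr₂ (boundary (p + q + 1)))
    (G := (joinChain h₁).compl₁₂ (boundary p) LinearMap.id +
      (joinChain h₂).compl₁₂ LinearMap.id (boundary q)) (fun σ τ => ?_) c d
  have hb : ∀ {X : Type} [TopologicalSpace X] {r : ℕ} (ρ : Simplex X (r + 1)),
      boundary r (Finsupp.single ρ 1) = ∑ i, Finsupp.single (ρ.face i) 1 := fun ρ => by
    simp [boundary]
  simp only [LinearMap.compr₂_apply, LinearMap.compl₁₂_apply, LinearMap.add_apply,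
    LinearMap.id_apply, joinChain_single, hb, map_sum, LinearMap.sum_apply]
  rw [← (splitEquiv h).symm.sum_comp, Fintype.sum_sum_type]
  congr 1
  · exact Finset.sum_congr rfl fun i _ => by rw [joinSimplex_face_inl h h₁]
  · exact Finset.sum_congr rfl fun j _ => by rw [joinSimplex_face_inr h h₂]

end FreeZ2Complex

end AllenCahn

end JoinChains


/-! ### The index of a join -/

section JoinIndex

namespace AllenCahn

lemma even_injective : Function.Injective fun k : ℕ => 2 * k :=
  mul_right_injective₀ two_ne_zero

lemma odd_injective : Function.Injective fun k : ℕ => 2 * k + 1 :=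
  (add_left_injective 1).comp even_injective

/-- The embeddings of `ℓ²` as the even and the odd coordinates are complementary. -/
lemma reindex_add_reindex_eq_zero {a b : lp (fun _ : ℕ => ℝ) 2}
    (h : reindex _ even_injective a + reindex _ odd_injective b = 0) : a = 0 ∧ b = 0 := by
  have hk : ∀ k, reindex _ even_injective a k + reindex _ odd_injective b k = 0 := fun k =>
    congr_arg (fun z : lp (fun _ : ℕ => ℝ) 2 => z k) h
  constructor
  · refine lp.ext (funext fun k => ?_)
    have h1 := hk (2 * k)
    rw [reindex_apply even_injective, reindex_apply_of_notMem odd_injective, add_zero] at h1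
    · exact h1
    · rintro ⟨i, hi⟩
      change _ = _ at hi
      omega
  · refine lp.ext (funext fun k => ?_)
    have h1 := hk (2 * k + 1)
    rw [reindex_apply odd_injective, reindex_apply_of_notMem even_injective, zero_add] at h1
    · exact h1
    · rintro ⟨i, hi⟩
      change _ = _ at hi
      omega

lemma SInfty.ne_zero (x : SInfty) : x.1 ≠ 0 := fun hx => by
  have := x.2
  rw [mem_sphere_zero_iff_norm, hx, norm_zero] at this
  exact zero_ne_one this

/-- Two odd functions have a common extension along the complementary embeddings. -/
lemma exists_isOddFunction_extension {s₁ s₂ : SInfty → ZMod 2} (h₁ : IsOddFunction s₁)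
    (h₂ : IsOddFunction s₂) : ∃ s, IsOddFunction s ∧
      (∀ x, s (sphereReindex _ even_injective x) = s₁ x) ∧
      ∀ x, s (sphereReindex _ odd_injective x) = s₂ x := by
  classical
  set E := sphereReindex _ even_injective
  set O := sphereReindex _ odd_injective
  have hE : Function.Injective E := fun x y h => Subtype.ext
    ((reindex _ even_injective).injective (congr_arg Subtype.val h))
  have hO : Function.Injective O := fun x y h => Subtype.ext
    ((reindex _ odd_injective).injective (congr_arg Subtype.val h))
  have hEn : ∀ x, E (-x) = -E x := fun x => Subtype.ext (map_neg (reindex _ even_injective) x.1)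
  have hOn : ∀ x, O (-x) = -O x := fun x => Subtype.ext (map_neg (reindex _ odd_injective) x.1)
  have hEO : ∀ x y, O y ≠ E x := by
    intro x y h
    refine x.ne_zero (reindex_add_reindex_eq_zero (a := x.1) (b := -y.1) ?_).1
    rw [map_neg, ← sub_eq_add_neg, sub_eq_zero]
    exact (congr_arg Subtype.val h).symm
  -- The two embedded spheres are disjoint and symmetric; off their union any odd function will do,
  -- and `s₁` is taken.
  refine ⟨fun z => if h : ∃ x, E x = z then s₁ h.choose else
    if h : ∃ y, O y = z then s₂ h.choose else s₁ z, fun z => ?_, fun x => ?_, fun y => ?_⟩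
  · by_cases h : ∃ x, E x = z
    · obtain ⟨x, rfl⟩ := h
      have e1 : ∃ y, E y = E x := ⟨x, rfl⟩
      have e2 : ∃ y, E y = -E x := ⟨-x, hEn x⟩
      simp only [dif_pos e1, dif_pos e2]
      rw [hE e1.choose_spec, hE (e2.choose_spec.trans (hEn x).symm), h₁]
    · have h' : ¬ ∃ x, E x = -z := fun ⟨x, hx⟩ => h ⟨-x, by rw [hEn, hx, neg_neg]⟩
      by_cases k : ∃ y, O y = z
      · obtain ⟨y, rfl⟩ := k
        have e1 : ∃ x, O x = O y := ⟨y, rfl⟩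
        have e2 : ∃ x, O x = -O y := ⟨-y, hOn y⟩
        simp only [dif_neg h, dif_neg h', dif_pos e1, dif_pos e2]
        rw [hO e1.choose_spec, hO (e2.choose_spec.trans (hOn y).symm), h₂]
      · have k' : ¬ ∃ x, O x = -z := fun ⟨x, hx⟩ => k ⟨-x, by rw [hOn, hx, neg_neg]⟩
        simp only [dif_neg h, dif_neg h', dif_neg k, dif_neg k']
        exact h₁ z
  · have e1 : ∃ y, E y = E x := ⟨x, rfl⟩
    simp only [dif_pos e1]
    rw [hE e1.choose_spec]
  · have e1 : ∃ x, O x = O y := ⟨y, rfl⟩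
    have h : ¬ ∃ x, E x = O y := fun ⟨x, hx⟩ => hEO x y hx.symm
    simp only [dif_neg h, dif_pos e1]
    rw [hO e1.choose_spec]

namespace FreeZ2Complex

variable {K L : FreeZ2Complex}

/-- The equivariant map to the sphere on a join. -/
lemma exists_joinSphereMap {f₁ : C(K.Space, SInfty)} (hf₁ : ∀ x, f₁ (K.T x) = -f₁ x)
    {f₂ : C(L.Space, SInfty)} (hf₂ : ∀ x, f₂ (L.T x) = -f₂ x) :
    ∃ f : C((join K L).Space, SInfty), (∀ z, f ((join K L).T z) = -f z) ∧
      (∀ z h, mass Sum.inr (toSimplex z) = 0 →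
        f z = sphereReindex _ even_injective (f₁ (leftPoint z h))) ∧
      (∀ z h, mass Sum.inl (toSimplex z) = 0 →
        f z = sphereReindex _ odd_injective (f₂ (rightPoint z h))) := by
  let a : (join K L).Space → lp (fun _ : ℕ => ℝ) 2 := fun z =>
    if h : mass Sum.inl (toSimplex z) ≠ 0 then
      mass Sum.inl (toSimplex z) • (f₁ (leftPoint z h)).1 else 0
  let b : (join K L).Space → lp (fun _ : ℕ => ℝ) 2 := fun z =>
    if h : mass Sum.inr (toSimplex z) ≠ 0 then
      mass Sum.inr (toSimplex z) • (f₂ (rightPoint z h)).1 else 0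
  have ha : Continuous a := continuous_cone (g := fun z h => (f₁ (leftPoint z h)).1)
    ((continuous_mass _).comp continuous_toSimplex) (continuous_subtype_val.comp
      (f₁.continuous.comp continuous_leftPoint)) (M := 1) fun z h =>
        (mem_sphere_zero_iff_norm.1 (f₁ _).2).le
  have hb : Continuous b := continuous_cone (g := fun z h => (f₂ (rightPoint z h)).1)
    ((continuous_mass _).comp continuous_toSimplex) (continuous_subtype_val.comp
      (f₂.continuous.comp continuous_rightPoint)) (M := 1) fun z h =>
        (mem_sphere_zero_iff_norm.1 (f₂ _).2).le
  have ha0 : ∀ z, a z = 0 → mass Sum.inl (toSimplex z) = 0 := by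
    intro z hz
    by_contra h
    have h1 : a z = mass Sum.inl (toSimplex z) • (f₁ (leftPoint z h)).1 := dif_pos h
    rw [hz] at h1
    exact (smul_ne_zero h (SInfty.ne_zero _)) h1.symm
  have hb0 : ∀ z, b z = 0 → mass Sum.inr (toSimplex z) = 0 := by
    intro z hz
    by_contra h
    have h1 : b z = mass Sum.inr (toSimplex z) • (f₂ (rightPoint z h)).1 := dif_pos h
    rw [hz] at h1
    exact (smul_ne_zero h (SInfty.ne_zero _)) h1.symm
  have haT : ∀ z, a ((join K L).T z) = -a z := by
    intro z
    by_cases h : mass Sum.inl (toSimplex z) ≠ 0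
    · have h' : mass Sum.inl (toSimplex ((join K L).T z)) ≠ 0 := by rwa [mass_inl_T]
      have h1 : a z = mass Sum.inl (toSimplex z) • (f₁ (leftPoint z h)).1 := dif_pos h
      have h2 : a ((join K L).T z) = mass Sum.inl (toSimplex ((join K L).T z)) •
        (f₁ (leftPoint ((join K L).T z) h')).1 := dif_pos h'
      rw [h1, h2, leftPoint_T, hf₁]
      exact (smul_neg _ _).trans (congr_arg (fun m : ℝ => -(m • _)) (mass_inl_T z))
    · have h' : ¬ mass Sum.inl (toSimplex ((join K L).T z)) ≠ 0 := by rwa [mass_inl_T]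
      have h1 : a z = 0 := dif_neg h
      have h2 : a ((join K L).T z) = 0 := dif_neg h'
      rw [h1, h2, neg_zero]
  have hbT : ∀ z, b ((join K L).T z) = -b z := by
    intro z
    by_cases h : mass Sum.inr (toSimplex z) ≠ 0
    · have h' : mass Sum.inr (toSimplex ((join K L).T z)) ≠ 0 := by rwa [mass_inr_T]
      have h1 : b z = mass Sum.inr (toSimplex z) • (f₂ (rightPoint z h)).1 := dif_pos h
      have h2 : b ((join K L).T z) = mass Sum.inr (toSimplex ((join K L).T z)) •
        (f₂ (rightPoint ((join K L).T z) h')).1 := dif_pos h'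
      rw [h1, h2, rightPoint_T, hf₂]
      exact (smul_neg _ _).trans (congr_arg (fun m : ℝ => -(m • _)) (mass_inr_T z))
    · have h' : ¬ mass Sum.inr (toSimplex ((join K L).T z)) ≠ 0 := by rwa [mass_inr_T]
      have h1 : b z = 0 := dif_neg h
      have h2 : b ((join K L).T z) = 0 := dif_neg h'
      rw [h1, h2, neg_zero]
  -- The two sphere maps, weighted by the block masses, are placed in complementary coordinates, so
  -- their sum vanishes only if both masses do.
  let F : C((join K L).Space, lp (fun _ : ℕ => ℝ) 2) :=
    ⟨fun z => reindex _ even_injective (a z) + reindex _ odd_injective (b z),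
      ((reindex _ even_injective).continuous.comp ha).add
        ((reindex _ odd_injective).continuous.comp hb)⟩
  have hF : ∀ z, F z ≠ 0 := by
    intro z hz
    obtain ⟨h1, h2⟩ := reindex_add_reindex_eq_zero hz
    have h3 := mass_inl_add_mass_inr (toSimplex z)
    rw [ha0 z h1, hb0 z h2, zero_add] at h3
    exact zero_ne_one h3
  have hFT : ∀ z, F ((join K L).T z) = -F z := by
    intro z
    change reindex _ even_injective (a ((join K L).T z)) +
      reindex _ odd_injective (b ((join K L).T z)) =
      -(reindex _ even_injective (a z) + reindex _ odd_injective (b z))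
    rw [haT, hbT, map_neg, map_neg, neg_add]
  refine ⟨normalizedMap F hF, fun z => Subtype.ext ?_, fun z h h0 => Subtype.ext ?_,
    fun z h h0 => Subtype.ext ?_⟩
  · change ‖F ((join K L).T z)‖⁻¹ • F ((join K L).T z) = -(‖F z‖⁻¹ • F z)
    rw [hFT, norm_neg, smul_neg]
  · have h1 : mass Sum.inl (toSimplex z) = 1 := by
      rw [← mass_inl_add_mass_inr (toSimplex z), h0, add_zero]
    have h2 : a z = mass Sum.inl (toSimplex z) • (f₁ (leftPoint z h)).1 := dif_pos h
    have h3 : b z = 0 := dif_neg (not_not.2 h0)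
    have h4 : F z = reindex _ even_injective (f₁ (leftPoint z h)).1 := by
      change reindex _ even_injective (a z) + reindex _ odd_injective (b z) = _
      rw [h3, map_zero, add_zero, h2, h1, one_smul]
    change ‖F z‖⁻¹ • F z = reindex _ even_injective (f₁ (leftPoint z h)).1
    rw [h4, LinearIsometry.norm_map, mem_sphere_zero_iff_norm.1 (f₁ _).2, inv_one, one_smul]
  · have h1 : mass Sum.inr (toSimplex z) = 1 := by
      rw [← mass_inl_add_mass_inr (toSimplex z), h0, zero_add]
    have h2 : b z = mass Sum.inr (toSimplex z) • (f₂ (rightPoint z h)).1 := dif_pos h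
    have h3 : a z = 0 := dif_neg (not_not.2 h0)
    have h4 : F z = reindex _ odd_injective (f₂ (rightPoint z h)).1 := by
      change reindex _ even_injective (a z) + reindex _ odd_injective (b z) = _
      rw [h3, map_zero, zero_add, h2, h1, one_smul]
    change ‖F z‖⁻¹ • F z = reindex _ odd_injective (f₂ (rightPoint z h)).1
    rw [h4, LinearIsometry.norm_map, mem_sphere_zero_iff_norm.1 (f₂ _).2, inv_one, one_smul]

section Vertices

variable {A B : Type*} [Fintype A] [Fintype B] [DecidableEq A] [DecidableEq B]

lemma mass_inl_vertex_inl (a : A) :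
    mass Sum.inl (stdSimplex.vertex (Sum.inl a : A ⊕ B) : stdSimplex ℝ (A ⊕ B)) = 1 := by
  simp [mass, Pi.single_apply]

lemma mass_inr_vertex_inl (a : A) :
    mass Sum.inr (stdSimplex.vertex (Sum.inl a : A ⊕ B) : stdSimplex ℝ (A ⊕ B)) = 0 := by
  simp [mass]

lemma mass_inr_vertex_inr (b : B) :
    mass Sum.inr (stdSimplex.vertex (Sum.inr b : A ⊕ B) : stdSimplex ℝ (A ⊕ B)) = 1 := by
  simp [mass, Pi.single_apply]

lemma mass_inl_vertex_inr (b : B) :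
    mass Sum.inl (stdSimplex.vertex (Sum.inr b : A ⊕ B) : stdSimplex ℝ (A ⊕ B)) = 0 := by
  simp [mass]

lemma part_inl_vertex (a : A) (h) :
    part Sum.inl (stdSimplex.vertex (Sum.inl a : A ⊕ B) : stdSimplex ℝ (A ⊕ B)) h =
      stdSimplex.vertex a := by
  ext a'
  rw [part_apply, mass_inl_vertex_inl]
  simp [Pi.single_apply]

lemma part_inr_vertex (b : B) (h) :
    part Sum.inr (stdSimplex.vertex (Sum.inr b : A ⊕ B) : stdSimplex ℝ (A ⊕ B)) h =
      stdSimplex.vertex b := by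
  ext a'
  rw [part_apply, mass_inr_vertex_inr]
  simp [Pi.single_apply]

end Vertices

/-- The involution adds `1` to the value at every vertex, which cancels in each difference. -/
lemma altPow_involution {s : SInfty → ZMod 2} (hs : IsOddFunction s) {f : C(K.Space, SInfty)}
    (hf : ∀ x, f (K.T x) = -f x) {p : ℕ} (σ : SingularSimplex K.Space p) :
    altPow (fun x => s (f x)) p (K.involution.comp σ) = altPow (fun x => s (f x)) p σ := by
  refine Finset.prod_congr rfl fun i _ => ?_
  have h1 : ∀ y, s (f (K.involution.comp σ y)) = s (f (σ y)) + 1 := fun y =>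
    (congr_arg s (hf (σ y))).trans (hs _)
  have h2 : ∀ a b : ZMod 2, (a + 1) + (b + 1) = a + b := by decide
  simp only [h1, h2]

lemma eval_boundary {X : Type*} [TopologicalSpace X] {p : ℕ} {a : Simplex X (p + 1) → ZMod 2}
    {b : Simplex X p → ZMod 2} (h : ∀ σ, a σ = ∑ i, b (Simplex.face σ i)) (c : Chain X (p + 1)) :
    eval a c = eval b (boundary p c) := by
  refine LinearMap.congr_fun (f := eval a) (g := (eval b).comp (boundary p))
    (Finsupp.lhom_ext' fun σ => LinearMap.ext_ring ?_) c
  simp only [LinearMap.comp_apply, Finsupp.lsingle_apply, eval_single, eval_boundary_single, h]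

lemma eval_chainMap {X : Type*} [TopologicalSpace X] {t : C(X, X)} {p : ℕ}
    {b : Simplex X p → ZMod 2} (h : ∀ σ, b (t.comp σ) = b σ) (c : Chain X p) :
    eval b (chainMap t p c) = eval b c := by
  refine LinearMap.congr_fun (f := (eval b).comp (chainMap t p)) (g := eval b)
    (Finsupp.lhom_ext' fun σ => LinearMap.ext_ring ?_) c
  simp only [LinearMap.comp_apply, Finsupp.lsingle_apply, eval_single, chainMap_single, h]

/-- The cohomological index is superadditive under joins. -/
lemma classPowNeZero_join {p q : ℕ} (hK : K.ClassPowNeZero p) (hL : L.ClassPowNeZero q) :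
    (join K L).ClassPowNeZero (p + q + 1) := by
  obtain ⟨f₁, hf₁, s₁, hs₁, c, hc, hc1⟩ := hK.exists_chain
  obtain ⟨f₂, hf₂, s₂, hs₂, d, hd, hd1⟩ := hL.exists_chain
  obtain ⟨f, hf, hfl, hfr⟩ := exists_joinSphereMap hf₁ hf₂
  obtain ⟨s, hs, hse, hso⟩ := exists_isOddFunction_extension hs₁ hs₂
  refine classPowNeZero_of_forall f hf hs fun b hb hab => ?_
  have h : p + q + 1 + 1 = p + 1 + (q + 1) := by omega
  have h₁ : p + q + 1 = p + (q + 1) := by omega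
  have h₂ : p + q + 1 = p + 1 + q := by omega
  set S : (join K L).Space → ZMod 2 := fun z => s (f z)
  set a₁ : SingularSimplex K.Space p → ZMod 2 := altPow (fun x => s₁ (f₁ x)) p with ha₁
  set a₂ : SingularSimplex L.Space q → ZMod 2 := altPow (fun x => s₂ (f₂ x)) q with ha₂
  -- Only values at vertices enter the power, and each vertex of a join lies in one of the factors,
  -- where `f` and `s` restrict to the given data.
  have hvert : ∀ (σ : Simplex K.Space (p + 1)) (τ : Simplex L.Space (q + 1)) k,
      S (joinSimplex h σ τ (stdSimplex.vertex k)) =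
        Sum.elim (fun i => s₁ (f₁ (σ (stdSimplex.vertex i))))
          (fun j => s₂ (f₂ (τ (stdSimplex.vertex j)))) (splitEquiv h k) := by
    intro σ τ k
    rw [joinSimplex_vertex]
    rcases splitEquiv h k with i | j
    · have h0 := (mass_inr_joinMap σ τ (stdSimplex.vertex (Sum.inl i))).trans
        (mass_inr_vertex_inl i)
      have h1 := (mass_inl_joinMap σ τ (stdSimplex.vertex (Sum.inl i))).trans
        (mass_inl_vertex_inl i)
      have h2 := h1.trans_ne one_ne_zero
      simp only [S, Sum.elim_inl]
      rw [hfl _ h2 h0, hse, leftPoint_joinMap, part_inl_vertex]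
    · have h0 := (mass_inl_joinMap σ τ (stdSimplex.vertex (Sum.inr j))).trans
        (mass_inl_vertex_inr j)
      have h1 := (mass_inr_joinMap σ τ (stdSimplex.vertex (Sum.inr j))).trans
        (mass_inr_vertex_inr j)
      have h2 := h1.trans_ne one_ne_zero
      simp only [S, Sum.elim_inr]
      rw [hfr _ h2 h0, hso, rightPoint_joinMap, part_inr_vertex]
  have hpow : ∀ (σ : Simplex K.Space (p + 1)) (τ : Simplex L.Space (q + 1)),
      altPow S (p + q + 1) (joinSimplex h σ τ) =
        a₁ σ * (s₁ (f₁ (σ (stdSimplex.vertex (Fin.last p)))) +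
          s₂ (f₂ (τ (stdSimplex.vertex 0)))) * a₂ τ := by
    intro σ τ
    rw [altPow, Finset.prod_congr rfl fun k _ => by rw [hvert, hvert]]
    exact prod_adjacent_splitEquiv h _ _
  -- Applying the involution to `τ` changes only the junction factor, by `1`; in the sum over `τ`
  -- and its translate this factor therefore becomes `1`.
  have hflip : ∀ x y z w : ZMod 2, x * (y + z) * w + x * (y + (z + 1)) * w = x * w := by decide
  set d' := chainMap L.involution (q + 1) d with hd'
  have hbd' : boundary q d' = boundary q d := by rw [hd', boundary_chainMap, hd]
  have h1 : eval (altPow S (p + q + 1)) (joinChain h c (d + d')) = 1 := by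
    have h3 := bilinear_ext
      (F := (joinChain h).compr₂ (eval (altPow S (p + q + 1))) +
        ((joinChain h).compr₂ (eval (altPow S (p + q + 1)))).compl₁₂ LinearMap.id
          (chainMap L.involution (q + 1)))
      (G := (LinearMap.mul (ZMod 2) (ZMod 2)).compl₁₂ (eval a₁) (eval a₂)) (fun σ τ => ?_) c d
    · simp only [LinearMap.compr₂_apply, LinearMap.compl₁₂_apply, LinearMap.add_apply,
        LinearMap.id_apply, LinearMap.mul_apply'] at h3
      rw [map_add, map_add, h3, hc1, hd1, mul_one]
    · simp only [LinearMap.compr₂_apply, LinearMap.compl₁₂_apply, LinearMap.add_apply,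
        LinearMap.id_apply, LinearMap.mul_apply', chainMap_single, joinChain_single, eval_single]
      rw [hpow, hpow, ha₂, altPow_involution hs₂ hf₂]
      have h4 : s₂ (f₂ (L.involution.comp τ (stdSimplex.vertex 0))) =
        s₂ (f₂ (τ (stdSimplex.vertex 0))) + 1 := (congr_arg s₂ (hf₂ _)).trans (hs₂ _)
      rw [h4]
      exact hflip _ _ _ _
  -- Since `d` and its translate have the same boundary, only the terms `∂c * d` and `∂c * Td`
  -- remain.
  rw [eval_boundary hab, boundary_joinChain h h₁ h₂, map_add, map_add (boundary q), hbd',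
    ZModModule.add_self, map_zero, map_zero, add_zero, map_add, map_add] at h1
  -- As `∂c` is invariant, `∂c * Td` is the translate of `∂c * d`, and the invariant cochain `b`
  -- agrees on both; so the total value would be `0`.
  have h5 : eval b (joinChain h₁ (boundary p c) d') = eval b (joinChain h₁ (boundary p c) d) := by
    rw [← eval_chainMap hb (joinChain h₁ (boundary p c) d), chainMap_joinChain, hc]
  rw [h5, CharTwo.add_self_eq_zero] at h1
  exact zero_ne_one h1

end FreeZ2Complex

end AllenCahn

end JoinIndex


/-! ### Complexes of large index -/

section Spheres

namespace AllenCahn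

/-- Choose one point in each antipodal pair; no continuity is asked for. -/
lemma exists_isOddFunction_sInfty : ∃ s, IsOddFunction s := by
  classical
  have hT := isFreeInvolution_neg_sInfty
  set pr := orbitProj fun x : SInfty => -x
  have hpr : ∀ x : SInfty, pr (-x) = pr x := orbitProj_apply_map
  refine ⟨fun x => if Quot.out (pr x) = x then 0 else 1, fun x => ?_⟩
  have h1 : pr (Quot.out (pr x)) = pr x := Quot.out_eq (pr x)
  simp only [hpr]
  rcases hT.orbitProj_eq_iff.1 h1 with h | h
  · rw [h, if_pos rfl, if_neg (hT.free x).symm, zero_add]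
  · rw [h, if_pos rfl, if_neg (hT.free x)]
    rfl

namespace FreeZ2Complex

lemma sphereZero_support {x : Bool → ℝ}
    (hx : ∃ s : Finset Bool, s.card = 1 ∧ ∀ v, v ∈ s ↔ x v ≠ 0) : x true ≠ x false := by
  obtain ⟨s, hs, hsx⟩ := hx
  obtain ⟨v, rfl⟩ := Finset.card_eq_one.1 hs
  intro h
  have h1 := hsx true
  have h2 := hsx false
  rw [h, ← h2, Finset.mem_singleton, Finset.mem_singleton] at h1
  cases v <;> simp at h1

/-- Two points which are exchanged by the action. -/
def sphereZero : FreeZ2Complex where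
  V := Bool
  K :=
    { faces := {s | s.card = 1}
      isRelLowerSet_faces := fun s hs => ⟨Finset.card_pos.1 (by
        rw [show s.card = 1 from hs]; exact one_pos), fun t ht htn =>
        le_antisymm ((Finset.card_le_card ht).trans hs.le) htn.card_pos⟩ }
  swap := not
  swap_swap := Bool.not_not
  swap_faces s hs := ⟨s.map ⟨not, Bool.not_injective⟩, by simpa using hs, fun v => by
    cases v <;> simp⟩
  free x hx h := sphereZero_support hx.2 (congr_fun h false)

/-- The two coordinates never agree on the complex, so the case distinction has empty frontier. -/
lemma continuous_sphereZero {Y : Type*} [TopologicalSpace Y] (a b : Y) :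
    Continuous fun x : sphereZero.Space => if 0 < x.1 true - x.1 false then a else b := by
  have hv (v : sphereZero.V) : Continuous fun x : sphereZero.Space => x.1 v :=
    (continuous_apply v).comp continuous_subtype_val
  have h : Continuous fun x : sphereZero.Space => x.1 true - x.1 false := (hv true).sub (hv false)
  refine continuous_const.if (fun x hx => ?_) continuous_const
  exact (sphereZero_support x.2.2 (sub_eq_zero.1
    (frontier_lt_subset_eq continuous_const h hx).symm)).elim

/-- The map which takes the value `a` at one of the two points and `b` at the other one. -/
noncomputable def sphereZeroMap {Y : Type*} [TopologicalSpace Y] (a b : Y) :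
    C(sphereZero.Space, Y) :=
  ⟨_, continuous_sphereZero a b⟩

lemma sphereZeroMap_cases {Y : Type*} [TopologicalSpace Y] (a b : Y) (x : sphereZero.Space) :
    sphereZeroMap a b x = a ∧ sphereZeroMap a b (sphereZero.T x) = b ∨
      sphereZeroMap a b x = b ∧ sphereZeroMap a b (sphereZero.T x) = a := by
  have hne := sphereZero_support x.2.2
  rcases lt_or_gt_of_ne hne with h | h
  · exact Or.inr ⟨if_neg (show ¬ 0 < x.1 true - x.1 false from not_lt.2 (sub_nonpos.2 h.le)),
      if_pos (show 0 < x.1 false - x.1 true from sub_pos.2 h)⟩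
  · exact Or.inl ⟨if_pos (show 0 < x.1 true - x.1 false from sub_pos.2 h),
      if_neg (show ¬ 0 < x.1 false - x.1 true from not_lt.2 (sub_nonpos.2 h.le))⟩

/-- The power `0` is the unit cochain, which is nonzero as soon as the orbit space has a point. -/
lemma classPowNeZero_sphereZero : sphereZero.ClassPowNeZero 0 := by
  obtain ⟨s, hs⟩ := exists_isOddFunction_sInfty
  obtain ⟨ξ, hξ, hξ', -⟩ := exists_cocycle_of_isOddFunction hs
  obtain ⟨x₀, -⟩ := exists_homotopic_const_sInfty
  refine ⟨sphereZeroMap x₀ (-x₀), fun x => ?_, ξ, hξ, hξ', fun h => ?_⟩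
  · rcases sphereZeroMap_cases x₀ (-x₀) x with ⟨h1, h2⟩ | ⟨h1, h2⟩
    · rw [h1, h2]
    · rw [h1, h2, neg_neg]
  · have hv : ∀ v : Bool, v ∈ ({true} : Finset Bool) ↔ (Pi.single true 1 : Bool → ℝ) v ≠ 0 := by
      intro v
      cases v <;> simp
    let p : sphereZero.Space := ⟨(Pi.single true 1 : Bool → ℝ),
      single_mem_stdSimplex ℝ (ι := Bool) true, ({true} : Finset Bool),
      Finset.card_singleton (α := Bool) true, hv⟩
    exact one_ne_zero (congr_fun h (ContinuousMap.const _ (orbitProj sphereZero.T p)))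

/-- There are complexes of every index. -/
lemma exists_classPowNeZero (p : ℕ) : ∃ K : FreeZ2Complex, K.ClassPowNeZero p := by
  induction p with
  | zero => exact ⟨_, classPowNeZero_sphereZero⟩
  | succ p ih =>
    obtain ⟨K, hK⟩ := ih
    -- Joining with the two-point complex is suspension and raises the degree by one.
    exact ⟨_, classPowNeZero_join hK classPowNeZero_sphereZero⟩

end FreeZ2Complex

end AllenCahn

end Spheres


/-! ### Subadditivity of the phase-transition spectrum -/

section Subadditivity

variable {n : ℕ} {M : Type*} [EMetricSpace M] [MeasurableSpace M] [BorelSpace M]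
  [ChartedSpace (EuclideanSpace ℝ (Fin (n + 1))) M] [IsManifold (𝓡 (n + 1)) ∞ M]
  [RiemannianBundle (fun x : M => TangentSpace (𝓡 (n + 1)) x)]
  [IsContMDiffRiemannianBundle (𝓡 (n + 1)) ∞ (EuclideanSpace ℝ (Fin (n + 1)))
    (fun x : M => TangentSpace (𝓡 (n + 1)) x)]
  [IsRiemannianManifold (𝓡 (n + 1)) M] [CompactSpace M] {W : ℝ → ℝ} {ε : ℝ}

namespace AllenCahn

open FreeZ2Complex

/-- There is no nonzero chain over the empty space. A point is needed later to fill in the lost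
factor at an end of a join. -/
lemma FreeZ2Complex.ClassPowNeZero.nonempty {K : FreeZ2Complex} {p : ℕ}
    (h : K.ClassPowNeZero p) : Nonempty K.Space := by
  obtain ⟨_, _, _, _, c, _, hc⟩ := h.exists_chain
  by_contra hK
  rw [not_nonempty_iff] at hK
  have h1 : c = 0 := Finsupp.ext fun σ => hK.elim (σ (stdSimplex.vertex 0))
  rw [h1, map_zero] at hc
  exact zero_ne_one hc

/-! ### The glued family over a join -/

section JoinFamily

variable {K L : FreeZ2Complex} (h₁ : C(K.Space, H1 n M)) (h₂ : C(L.Space, H1 n M))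
  (h₃ : C(unitInterval, H1 n M))

/-- The family of functions over the first complex, extended by zero. -/
noncomputable def leftFamily (z : (join K L).Space) : H1 n M :=
  if h : mass Sum.inl (toSimplex z) ≠ 0 then h₁ (leftPoint z h) else H1.const n M 0

/-- The family of functions over the second complex, extended by zero. -/
noncomputable def rightFamily (z : (join K L).Space) : H1 n M :=
  if h : mass Sum.inr (toSimplex z) ≠ 0 then h₂ (rightPoint z h) else H1.const n M 0

/-- The path between the constants as a function of the join parameter; it is constant near
both ends. -/
noncomputable def middleFamily (z : (join K L).Space) : H1 n M :=
  h₃ (Set.projIcc 0 1 zero_le_one (3 * mass Sum.inr (toSimplex z) - 1))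

lemma continuous_mass_toSimplex {A : Type} [Fintype A] (j : A → K.V ⊕ L.V) :
    Continuous fun z : (join K L).Space => mass j (toSimplex z) :=
  (continuous_mass j).comp continuous_toSimplex

omit [IsManifold (𝓡 (n + 1)) ∞ M]
  [IsContMDiffRiemannianBundle (𝓡 (n + 1)) ∞ (EuclideanSpace ℝ (Fin (n + 1)))
    (fun x : M => TangentSpace (𝓡 (n + 1)) x)]
  [IsRiemannianManifold (𝓡 (n + 1)) M] [CompactSpace M] in
lemma continuous_middleFamily : Continuous (middleFamily (K := K) (L := L) h₃) :=
  h₃.continuous.comp (continuous_projIcc.comp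
    (((continuous_mass_toSimplex Sum.inr).const_mul 3).sub continuous_const))

lemma continuousOn_leftFamily :
    ContinuousOn (leftFamily h₁) {z : (join K L).Space | mass Sum.inl (toSimplex z) ≠ 0} := by
  rw [continuousOn_iff_continuous_domRestrict]
  refine (h₁.continuous.comp continuous_leftPoint).congr fun z => ?_
  exact (dif_pos (c := mass Sum.inl (toSimplex z.1) ≠ 0)
    (t := fun h => h₁ (leftPoint z.1 h)) (e := fun _ => H1.const n M 0) z.2).symm

lemma continuousOn_rightFamily :
    ContinuousOn (rightFamily h₂) {z : (join K L).Space | mass Sum.inr (toSimplex z) ≠ 0} := by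
  rw [continuousOn_iff_continuous_domRestrict]
  refine (h₂.continuous.comp continuous_rightPoint).congr fun z => ?_
  exact (dif_pos (c := mass Sum.inr (toSimplex z.1) ≠ 0)
    (t := fun h => h₂ (rightPoint z.1 h)) (e := fun _ => H1.const n M 0) z.2).symm

omit [IsManifold (𝓡 (n + 1)) ∞ M]
  [IsContMDiffRiemannianBundle (𝓡 (n + 1)) ∞ (EuclideanSpace ℝ (Fin (n + 1)))
    (fun x : M => TangentSpace (𝓡 (n + 1)) x)]
  [IsRiemannianManifold (𝓡 (n + 1)) M] [CompactSpace M] in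
lemma middleFamily_of_le (z : (join K L).Space) (hz : mass Sum.inr (toSimplex z) ≤ 1 / 3) :
    middleFamily h₃ z = h₃ 0 := by
  rw [middleFamily, Set.projIcc_of_le_left _ (by linarith)]
  rfl

omit [IsManifold (𝓡 (n + 1)) ∞ M]
  [IsContMDiffRiemannianBundle (𝓡 (n + 1)) ∞ (EuclideanSpace ℝ (Fin (n + 1)))
    (fun x : M => TangentSpace (𝓡 (n + 1)) x)]
  [IsRiemannianManifold (𝓡 (n + 1)) M] [CompactSpace M] in
lemma middleFamily_of_ge (z : (join K L).Space) (hz : 2 / 3 ≤ mass Sum.inr (toSimplex z)) :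
    middleFamily h₃ z = h₃ 1 := by
  rw [middleFamily, Set.projIcc_of_right_le _ (by linarith)]
  rfl

lemma mass_inl_eq (z : (join K L).Space) :
    mass Sum.inl (toSimplex z) = 1 - mass Sum.inr (toSimplex z) :=
  eq_sub_of_add_eq (mass_inl_add_mass_inr _)

variable {h₃} (hp : h₃ ∈ connectingPaths n M)
include hp

/-- The families extended by zero need not be continuous at the ends of the join, but the path is
constantly `1` for parameter at most `1/3` and constantly `-1` for parameter at least `2/3`. There
the family that may jump can be replaced by a constant, and in between both families are continuous.
-/
lemma continuous_merge_join : Continuous fun z : (join K L).Space =>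
    H1.merge (leftFamily h₁ z) (rightFamily h₂ z) (middleFamily h₃ z) := by
  have hr : Continuous fun z : (join K L).Space => mass Sum.inr (toSimplex z) :=
    continuous_mass_toSimplex Sum.inr
  have key : ∀ {U : Set (join K L).Space} {f g : (join K L).Space → H1 n M}, IsOpen U →
      ContinuousOn f U → ContinuousOn g U →
      ContinuousOn (fun z => H1.merge (f z) (g z) (middleFamily h₃ z)) U := by
    intro U f g _ hf hg
    rw [continuousOn_iff_continuous_domRestrict] at hf hg ⊢
    exact H1.continuous_merge hf hg ((continuous_middleFamily h₃).comp continuous_subtype_val)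
  rw [continuous_iff_continuousAt]
  intro z
  have hz := mass_inl_eq z
  rcases lt_or_ge (mass Sum.inr (toSimplex z)) (1 / 3) with h | h
  · have ho : IsOpen {z : (join K L).Space | mass Sum.inr (toSimplex z) < 1 / 3} :=
      isOpen_lt hr continuous_const
    refine ContinuousOn.continuousAt ?_ (ho.mem_nhds h)
    refine (key (f := leftFamily h₁) (g := fun _ => H1.const n M 0) ho
      ((continuousOn_leftFamily h₁).mono fun y hy => ?_) continuousOn_const).congr fun y hy => ?_
    · have h1 := mass_inl_eq y
      have h2 : mass Sum.inr (toSimplex y) < 1 / 3 := hy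
      exact ne_of_gt (by linarith)
    · refine H1.merge_eq_of_one ?_
      rw [middleFamily_of_le h₃ y (le_of_lt hy)]
      exact hp.1
  rcases lt_or_ge (2 / 3) (mass Sum.inr (toSimplex z)) with h' | h'
  · have ho : IsOpen {z : (join K L).Space | 2 / 3 < mass Sum.inr (toSimplex z)} :=
      isOpen_lt continuous_const hr
    refine ContinuousOn.continuousAt ?_ (ho.mem_nhds h')
    refine (key (f := fun _ => H1.const n M 0) (g := rightFamily h₂) ho
      continuousOn_const ((continuousOn_rightFamily h₂).mono fun y hy => ?_)).congr fun y hy => ?_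
    · have h2 : 2 / 3 < mass Sum.inr (toSimplex y) := hy
      exact ne_of_gt (by linarith)
    · refine H1.merge_eq_of_neg_one ?_
      rw [middleFamily_of_ge h₃ y (le_of_lt hy)]
      exact hp.2
  · have ho : IsOpen ({z : (join K L).Space | mass Sum.inl (toSimplex z) ≠ 0} ∩
        {z : (join K L).Space | mass Sum.inr (toSimplex z) ≠ 0}) :=
      (isOpen_ne_fun (continuous_mass_toSimplex Sum.inl) continuous_const).inter
        (isOpen_ne_fun hr continuous_const)
    refine ContinuousOn.continuousAt ?_ (ho.mem_nhds ⟨?_, ?_⟩)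
    · exact key ho ((continuousOn_leftFamily h₁).mono Set.inter_subset_left)
        ((continuousOn_rightFamily h₂).mono Set.inter_subset_right)
    · exact ne_of_gt (by linarith)
    · exact ne_of_gt (by linarith)

/-- The extension by the zero function would spoil the energy bound. At an end the lost factor is
irrelevant, so any genuine member of its family may stand in. -/
lemma exists_merge_eq [Nonempty K.Space] [Nonempty L.Space] (z : (join K L).Space) :
    ∃ x y t, H1.merge (leftFamily h₁ z) (rightFamily h₂ z) (middleFamily h₃ z) =
      H1.merge (h₁ x) (h₂ y) (h₃ t) := by
  have hz := mass_inl_eq z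
  by_cases hl : mass Sum.inl (toSimplex z) = 0
  · have hr : mass Sum.inr (toSimplex z) ≠ 0 := by
      intro h
      linarith
    have h0 : rightFamily h₂ z = h₂ (rightPoint z hr) := dif_pos hr
    refine ⟨Classical.arbitrary _, rightPoint z hr, 1, ?_⟩
    rw [h0, middleFamily_of_ge h₃ z (by linarith)]
    exact H1.merge_eq_of_neg_one hp.2
  · have h0 : leftFamily h₁ z = h₁ (leftPoint z hl) := dif_pos hl
    by_cases hr : mass Sum.inr (toSimplex z) = 0
    · refine ⟨leftPoint z hl, Classical.arbitrary _, 0, ?_⟩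
      rw [h0, middleFamily_of_le h₃ z (by linarith)]
      exact H1.merge_eq_of_one hp.1
    · have h0' : rightFamily h₂ z = h₂ (rightPoint z hr) := dif_pos hr
      exact ⟨leftPoint z hl, rightPoint z hr, _, by rw [h0, h0']; rfl⟩

end JoinFamily

lemma H1.const_zero : (H1.const n M 0).1 = 0 :=
  Lp.ext ((H1.const_ae_eq 0).trans (Lp.coeFn_zero _ _ _).symm)

lemma H1.const_neg (c : ℝ) : (H1.const n M (-c)).1 = -(H1.const n M c).1 := by
  refine Lp.ext ?_
  filter_upwards [H1.const_ae_eq (n := n) (M := M) c, H1.const_ae_eq (n := n) (M := M) (-c),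
    Lp.coeFn_neg (H1.const n M c).1] with x h1 h2 h3
  rw [h2, h3, Pi.neg_apply, h1]

lemma leftFamily_T {K L : FreeZ2Complex} {h₁ : C(K.Space, H1 n M)}
    (hh : h₁ ∈ equivariantMaps n M K) (z : (join K L).Space) :
    (leftFamily h₁ ((join K L).T z)).1 = -(leftFamily h₁ z).1 := by
  by_cases h : mass Sum.inl (toSimplex z) ≠ 0
  · have h' : mass Sum.inl (toSimplex ((join K L).T z)) ≠ 0 := by rwa [mass_inl_T]
    have e1 : leftFamily h₁ z = h₁ (leftPoint z h) := dif_pos h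
    have e2 : leftFamily h₁ ((join K L).T z) = h₁ (leftPoint ((join K L).T z) h') := dif_pos h'
    rw [e1, e2, leftPoint_T]
    exact hh.2 _
  · have h' : ¬ mass Sum.inl (toSimplex ((join K L).T z)) ≠ 0 := by rwa [mass_inl_T]
    have e1 : leftFamily h₁ z = H1.const n M 0 := dif_neg h
    have e2 : leftFamily h₁ ((join K L).T z) = H1.const n M 0 := dif_neg h'
    rw [e1, e2, H1.const_zero, neg_zero]

lemma rightFamily_T {K L : FreeZ2Complex} {h₂ : C(L.Space, H1 n M)}
    (hh : h₂ ∈ equivariantMaps n M L) (z : (join K L).Space) :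
    (rightFamily h₂ ((join K L).T z)).1 = -(rightFamily h₂ z).1 := by
  by_cases h : mass Sum.inr (toSimplex z) ≠ 0
  · have h' : mass Sum.inr (toSimplex ((join K L).T z)) ≠ 0 := by rwa [mass_inr_T]
    have e1 : rightFamily h₂ z = h₂ (rightPoint z h) := dif_pos h
    have e2 : rightFamily h₂ ((join K L).T z) = h₂ (rightPoint ((join K L).T z) h') := dif_pos h'
    rw [e1, e2, rightPoint_T]
    exact hh.2 _
  · have h' : ¬ mass Sum.inr (toSimplex ((join K L).T z)) ≠ 0 := by rwa [mass_inr_T]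
    have e1 : rightFamily h₂ z = H1.const n M 0 := dif_neg h
    have e2 : rightFamily h₂ ((join K L).T z) = H1.const n M 0 := dif_neg h'
    rw [e1, e2, H1.const_zero, neg_zero]

/-- A family which almost realizes the value `c_ε(p)`. -/
lemma exists_equivariantMap_of_lt (hW : IsDoubleWell W) {p : ℕ} {b : ℝ≥0∞}
    (hb : cSpectrum n M W ε p < b) (hb' : b < ENNReal.ofReal (W 0 / ε) * vol n M Set.univ) :
    ∃ (K : FreeZ2Complex) (q : ℕ), p ≤ q ∧ K.ClassPowNeZero q ∧
      ∃ h ∈ equivariantMaps n M K, ∀ x, energy n W ε (h x) ≤ b := by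
  rcases eq_or_ne p 0 with rfl | hp
  -- The value `c_ε(0) = 0` is a convention, so a family is supplied by hand: the constants `±1`
  -- over the two-point complex. They are not the zero class, since the zero function has positive
  -- energy by `hb'`.
  · have hE : ∀ c : ℝ, W c = 0 → energy n W ε (H1.const n M c) = 0 := fun c hc => by
      rw [energy_const, hc, zero_div, ENNReal.ofReal_zero, zero_mul]
    have hne : ∀ c : ℝ, W c = 0 → (H1.const n M c).1 ≠ 0 := fun c hc h0 => by
      have h1 := energy_of_eq_zero (W := W) (ε := ε) h0
      rw [hE c hc] at h1
      rw [← h1] at hb'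
      exact not_lt_zero hb'
    refine ⟨sphereZero, 0, le_rfl, classPowNeZero_sphereZero,
      sphereZeroMap (H1.const n M 1) (H1.const n M (-1)), ⟨fun x => ?_, fun x => ?_⟩, fun x => ?_⟩ <;>
    rcases sphereZeroMap_cases (H1.const n M 1) (H1.const n M (-1)) x with ⟨h1, h2⟩ | ⟨h1, h2⟩ <;>
    rw [h1]
    · exact hne 1 hW.zero_one
    · exact hne (-1) hW.zero_neg_one
    · rw [h2, H1.const_neg]
    · rw [h2, H1.const_neg, neg_neg]
    · exact (hE 1 hW.zero_one).trans_le zero_le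
    · exact (hE (-1) hW.zero_neg_one).trans_le zero_le
  · rw [cSpectrum, if_neg hp] at hb
    simp only [iInf_lt_iff] at hb
    obtain ⟨K, hK, h, hh, hlt⟩ := hb
    obtain ⟨q, hq, hKq⟩ := exists_classPowNeZero_of_le_index hK
    exact ⟨K, q, hq, hKq, h, hh, fun x => (le_iSup _ x).trans hlt.le⟩

lemma cSpectrum_le_add_of_lt (hW : IsDoubleWell W) {k m : ℕ} {b₁ b₂ b₃ : ℝ≥0∞}
    (hk : cSpectrum n M W ε k < b₁) (hm : cSpectrum n M W ε m < b₂)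
    (hg : gammaWidth n M W ε < b₃)
    (hb : b₁ + b₂ + b₃ < ENNReal.ofReal (W 0 / ε) * vol n M Set.univ) :
    cSpectrum n M W ε (k + m + 1) ≤ b₁ + b₂ + b₃ := by
  obtain ⟨K, q₁, hq₁, hK, h₁, hh₁, hb₁⟩ := exists_equivariantMap_of_lt hW hk
    ((le_self_add.trans le_self_add).trans_lt hb)
  obtain ⟨L, q₂, hq₂, hL, h₂, hh₂, hb₂⟩ := exists_equivariantMap_of_lt hW hm
    ((le_add_self.trans le_self_add).trans_lt hb)
  simp only [gammaWidth, iInf_lt_iff] at hg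
  obtain ⟨h₃, hp, hb₃⟩ := hg
  have := hK.nonempty
  have := hL.nonempty
  have hE : ∀ z, energy n W ε (H1.merge (leftFamily h₁ z) (rightFamily h₂ z)
      (middleFamily h₃ z)) ≤ b₁ + b₂ + b₃ := by
    intro z
    obtain ⟨x, y, t, h⟩ := exists_merge_eq h₁ h₂ hp z
    rw [h]
    exact (energy_merge_le hW.even hW.smooth.continuous _ _ _).trans
      (add_le_add (add_le_add (hb₁ x) (hb₂ y)) ((le_iSup _ t).trans hb₃.le))
  rw [cSpectrum, if_neg (Nat.succ_ne_zero _)]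
  refine iInf₂_le_of_le (join K L) ?_ (iInf₂_le_of_le
    ⟨_, continuous_merge_join h₁ h₂ hp⟩ ⟨fun z h0 => ?_, fun z => ?_⟩ (iSup_le hE))
  · refine le_trans ?_ (le_index_of_classPowNeZero (classPowNeZero_join hK hL))
    exact_mod_cast Nat.succ_le_succ (by omega)
  -- The glued functions lie below the energy of the zero function, so none of them is zero.
  · have h1 := hE z
    have h2 := energy_of_eq_zero (W := W) (ε := ε) h0
    exact absurd hb (h2.symm.trans_le h1).not_gt
  · have h1 : middleFamily h₃ ((join K L).T z) = middleFamily h₃ z := by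
      rw [middleFamily, middleFamily, mass_inr_T]
    change (H1.merge (leftFamily h₁ ((join K L).T z)) (rightFamily h₂ ((join K L).T z))
      (middleFamily h₃ ((join K L).T z))).1 = _
    rw [h1]
    exact H1.merge_neg (leftFamily_T hh₁ z) (rightFamily_T hh₂ z)

variable [Nonempty M]

lemma cSpectrum_le (hW : IsDoubleWell W) (hε : 0 < ε) (p : ℕ) :
    cSpectrum n M W ε p ≤ ENNReal.ofReal (W 0 / ε) * vol n M Set.univ := by
  obtain ⟨K, hK⟩ := exists_classPowNeZero p
  exact cSpectrum_le_of_le_index hW hε (le_index_of_classPowNeZero hK)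

lemma cSpectrum_ne_top (hW : IsDoubleWell W) (hε : 0 < ε) (p : ℕ) :
    cSpectrum n M W ε p ≠ ⊤ :=
  ((cSpectrum_le hW hε p).trans_lt
    (ENNReal.mul_lt_top ENNReal.ofReal_lt_top (measure_lt_top _ _))).ne

/-- Either the right-hand side plus a small slack is below the energy of the zero function, and
gluing applies, or it exceeds the universal bound `cSpectrum_le`. -/
lemma cSpectrum_add_add_one_le (hW : IsDoubleWell W) (hε : 0 < ε) (k m : ℕ) :
    cSpectrum n M W ε (k + m + 1) ≤
      cSpectrum n M W ε k + cSpectrum n M W ε m + gammaWidth n M W ε := by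
  refine ENNReal.le_of_forall_pos_le_add fun δ hδ _ => ?_
  set d : ℝ≥0∞ := (δ : ℝ≥0∞) / 3
  have hd : d ≠ 0 := (ENNReal.div_pos (by exact_mod_cast hδ.ne') (by simp)).ne'
  have hsum : cSpectrum n M W ε k + d + (cSpectrum n M W ε m + d) + (gammaWidth n M W ε + d) =
      cSpectrum n M W ε k + cSpectrum n M W ε m + gammaWidth n M W ε + δ := by
    rw [← ENNReal.add_thirds (δ : ℝ≥0∞)]
    ring
  rw [← hsum]
  by_cases hlt : cSpectrum n M W ε k + d + (cSpectrum n M W ε m + d) +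
      (gammaWidth n M W ε + d) < ENNReal.ofReal (W 0 / ε) * vol n M Set.univ
  · exact cSpectrum_le_add_of_lt hW (ENNReal.lt_add_right (cSpectrum_ne_top hW hε k) hd)
      (ENNReal.lt_add_right (cSpectrum_ne_top hW hε m) hd)
      (ENNReal.lt_add_right (gammaWidth_ne_top hW hε) hd) hlt
  · exact (cSpectrum_le hW hε _).trans (not_lt.1 hlt)

/-- Division in `[0, ∞]` is additive and monotone in the numerator, whatever the denominator, so
nothing about `σ` is needed. -/
lemma rescaledSpectrum_add_add_one_le (hW : IsDoubleWell W) (hε : 0 < ε) (k m : ℕ) :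
    rescaledSpectrum n M W (k + m + 1) ε ≤
      rescaledSpectrum n M W k ε + rescaledSpectrum n M W m ε + rescaledWidth n M W ε := by
  rw [rescaledSpectrum, rescaledSpectrum, rescaledSpectrum, rescaledWidth, ← ENNReal.add_div,
    ← ENNReal.add_div]
  exact ENNReal.div_le_div_right (cSpectrum_add_add_one_le hW hε k m) _

end AllenCahn

end Subadditivity


/-! ### Passage to the limit `ε → 0+` -/

lemma ENNReal.limsup_add_le_add {α : Type*} (f : Filter α) (u v : α → ℝ≥0∞) :
    limsup (u + v) f ≤ limsup u f + limsup v f := by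
  refine ENNReal.le_of_forall_pos_le_add fun δ hδ htop => ?_
  obtain ⟨hu, hv⟩ := ENNReal.add_lt_top.1 htop
  have hd : (δ : ℝ≥0∞) / 2 ≠ 0 := (ENNReal.half_pos (by exact_mod_cast hδ.ne')).ne'
  rw [← ENNReal.add_halves (δ : ℝ≥0∞), add_add_add_comm]
  refine limsup_le_of_le (h := ?_)
  filter_upwards [eventually_lt_of_limsup_lt (ENNReal.lt_add_right hu.ne hd),
    eventually_lt_of_limsup_lt (ENNReal.lt_add_right hv.ne hd)] with x hx hx'
  exact add_le_add hx.le hx'.le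

theorem theorem1p2 (n : ℕ) (M : Type*) [EMetricSpace M] [MeasurableSpace M] [BorelSpace M]
    [CompactSpace M] [Nonempty M]
    [ChartedSpace (EuclideanSpace ℝ (Fin (n + 1))) M] [IsManifold (𝓡 (n + 1)) ∞ M]
    [RiemannianBundle (fun x : M => TangentSpace (𝓡 (n + 1)) x)]
    [IsContMDiffRiemannianBundle (𝓡 (n + 1)) ∞ (EuclideanSpace ℝ (Fin (n + 1)))
      (fun x : M => TangentSpace (𝓡 (n + 1)) x)]
    [IsRiemannianManifold (𝓡 (n + 1)) M]
    (W : ℝ → ℝ) (hW : IsDoubleWell W) :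
    (∀ ε : ℝ, 0 < ε →
      (∀ p, cSpectrum n M W ε p ≠ ⊤) ∧ gammaWidth n M W ε ≠ ⊤ ∧
      ∀ k m, cSpectrum n M W ε (k + m + 1) ≤
        cSpectrum n M W ε k + cSpectrum n M W ε m + gammaWidth n M W ε) ∧
    (∀ k m, phaseTransitionSpectrum n M W (k + m + 1) ≤
      phaseTransitionSpectrum n M W k + phaseTransitionSpectrum n M W m + allenCahnWidth n M W) ∧
    (∀ (k m : ℕ) (l l₁ l₂ g : ℝ≥0∞), IsPhaseTransitionLimit n M W (k + m + 1) l →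
      IsPhaseTransitionLimit n M W k l₁ → IsPhaseTransitionLimit n M W m l₂ →
      IsAllenCahnWidthLimit n M W g → l ≤ l₁ + l₂ + g) := by
  refine ⟨fun ε hε => ⟨cSpectrum_ne_top hW hε, gammaWidth_ne_top hW hε,
    cSpectrum_add_add_one_le hW hε⟩, fun k m => ?_, fun k m l l₁ l₂ g hl hl₁ hl₂ hg => ?_⟩
  · refine (limsup_le_limsup (v := rescaledSpectrum n M W k + rescaledSpectrum n M W m +
      rescaledWidth n M W) ?_).trans ?_
    · filter_upwards [self_mem_nhdsWithin] with ε hε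
      exact rescaledSpectrum_add_add_one_le hW hε k m
    · exact (ENNReal.limsup_add_le_add _ _ _).trans (add_le_add (ENNReal.limsup_add_le_add _ _ _) le_rfl)
  · refine le_of_tendsto_of_tendsto hl ((hl₁.add hl₂).add hg) ?_
    filter_upwards [self_mem_nhdsWithin] with ε hε
    exact rescaledSpectrum_add_add_one_le hW hε k m
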